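/- Let $n\ge 1$, let $\omega=\sum_{i=1}^n dx_i\wedge dy_i$ on $\mathbb R^{2n}$ and let $\mathrm{Sp}(2n)$ be the group of linear maps preserving $\omega$, with Lie algebra $\mathfrak{sp}(2n)=\{X : \omega(\cdot,X\cdot)\text{ is symmetric}\}$. Let $C$ be the bi-invariant closed cone structure on $\mathrm{Sp}(2n)$ given by $C(W)=W\,C(id)$, where $C(id)=\{X\in\mathfrak{sp}(2n)\setminus\{0\} : \omega(\cdot,X\cdot)\text{ is positive semi-definite}\}$; its interior is given by $W\,\mathfrak{sp}^+(2n)$, where $\mathfrak{sp}^+(2n)=\{X\in\mathfrak{sp}(2n) : \omega(\cdot,X\cdot)\text{ is positive definite}\}$. Let $p:\widetilde{\mathrm{Sp}(2n)}\to\mathrm{Sp}(2n)$ be the universal cover, with the lifted smooth and cone structures and a base point $id$ over the identity. A smooth curve is timelike (causal) if its velocity lies everywhere in the interior of the cone (in the cone). $I^+(a)$ is the set of all $b$ such that there is a timelike curve from $a$ to $b$, and $I^-(a)$ is the set of all $b$ such that there is a timelike curve from $b$ to $a$. For a subset $U$ of the universal cover and $a\in U$ let $J_U^{+}(a)$ (resp.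 $J_U^-(a)$) consist of $a$ and all points reached from $a$ (resp. from which $a$ is reached) by causal curves inside $U$; $U$ is called globally hyperbolic if it contains no closed causal curve and $J_U^+(a)\cap J_U^-(b)$ is compact for all $a,b\in U$. Let $\kappa=-i\omega$ be the Krein form on $\mathbb C^{2n}$, where $\omega$ is extended to be complex linear in the first and conjugate linear in the second variable. The positively elliptic region $\mathrm{Sp}_{\mathrm{ell}}^+(2n)$ is the set of all $W\in\mathrm{Sp}(2n)$ all of whose complex eigenvalues lie in $S^1\setminus\{\pm1\}$ and such that, for each eigenvalue $\lambda$, $\kappa$ is positive definite on the generalised eigenspace $E_\lambda$ if and only if $\operatorname{Im}\lambda>0$. A lift of this region is the image of a continuous section of $p$ over it. Then there is a unique lift $\widetilde{\mathrm{Sp}_{\mathrm{ell}}^+(2n)}$ of $\mathrm{Sp}_{\mathrm{ell}}^+(2n)$ whose boundary contains $id$, there is a unique point $\widetilde{-id}$ over $-id$ on the boundary of $\widetilde{\mathrm{Sp}_{\mathrm{ell}}^+(2n)}$, and the following hold. (i) $\widetilde{\mathrm{Sp}_{\mathrm{ell}}^+(2n)}=I^+(id)\cap I^-(\widetilde{-id})$.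 (ii) For every $w\in\widetilde{\mathrm{Sp}(2n)}$: if $I^+(id)\cap I^-(w)$ is nonempty and globally hyperbolic, then $w$ lies in the closure of $\widetilde{\mathrm{Sp}_{\mathrm{ell}}^+(2n)}$. (iii) For every $w\in\widetilde{\mathrm{Sp}(2n)}$: if $I^+(id)\cap I^-(w)=\widetilde{\mathrm{Sp}_{\mathrm{ell}}^+(2n)}$, then $w=\widetilde{-id}$. -/

import Mathlib

open scoped ContDiff Matrix

namespace SpCausal

noncomputable section

/-- The linear symplectic group `Sp(2n)`: the `2n × 2n` real matrices preserving
`ω = ∑ dxᵢ ∧ dyᵢ`. The index `Sum.inl i` stands for `xᵢ` and `Sum.inr i` for `yᵢ`. -/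
abbrev Sp (n : ℕ) : Type := Matrix.symplecticGroup (Fin n) ℝ

/-- The canonical symplectic form `ω = ∑ dxᵢ ∧ dyᵢ` on `ℝ²ⁿ`. -/
def omega {n : ℕ} (v w : Fin n ⊕ Fin n → ℝ) : ℝ :=
  ∑ i, (v (Sum.inl i) * w (Sum.inr i) - v (Sum.inr i) * w (Sum.inl i))

/-- The Lie algebra `𝔰𝔭(2n)`: the matrices `X` for which `ω(·, X·)` is symmetric. -/
def lieSp (n : ℕ) : Set (Matrix (Fin n ⊕ Fin n) (Fin n ⊕ Fin n) ℝ) :=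
  {X | ∀ v w, omega v (X *ᵥ w) = omega w (X *ᵥ v)}

/-- The closed cone `C(id)`: the nonzero `X` in the Lie algebra with `ω(·, X·)` positive
semi-definite (a closed cone does not contain the zero vector). -/
def cone (n : ℕ) : Set (Matrix (Fin n ⊕ Fin n) (Fin n ⊕ Fin n) ℝ) :=
  {X | X ∈ lieSp n ∧ X ≠ 0 ∧ ∀ v, 0 ≤ omega v (X *ᵥ v)}

/-- The open cone `𝔰𝔭⁺(2n) = Int C(id)`: the `X` in the Lie algebra with `ω(·, X·)` positive
definite. -/
def openCone (n : ℕ) : Set (Matrix (Fin n ⊕ Fin n) (Fin n ⊕ Fin n) ℝ) :=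
  {X | X ∈ lieSp n ∧ ∀ v, v ≠ 0 → 0 < omega v (X *ᵥ v)}

/-- The velocity at time `t` of a curve in `Sp(2n)` defined on `[0,1]`, as a matrix. -/
def velocity {n : ℕ} (W : ℝ → Sp n) (t : ℝ) : Matrix (Fin n ⊕ Fin n) (Fin n ⊕ Fin n) ℝ :=
  Matrix.of fun i j =>
    derivWithin (fun s => (W s : Matrix (Fin n ⊕ Fin n) (Fin n ⊕ Fin n) ℝ) i j) (Set.Icc 0 1) t

/-- `W` restricts to a smooth curve `[0,1] → Sp(2n)` with `W'(t) ∈ W(t) K` for all `t`, i.e.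
a smooth curve tangent to the left-invariant cone field generated by `K`. -/
def IsTangentCurve {n : ℕ} (K : Set (Matrix (Fin n ⊕ Fin n) (Fin n ⊕ Fin n) ℝ))
    (W : ℝ → Sp n) : Prop :=
  (∀ i j, ContDiffOn ℝ ∞
    (fun s => (W s : Matrix (Fin n ⊕ Fin n) (Fin n ⊕ Fin n) ℝ) i j) (Set.Icc 0 1)) ∧
  ∀ t ∈ Set.Icc (0 : ℝ) 1, ∃ X ∈ K,
    velocity W t = (W t : Matrix (Fin n ⊕ Fin n) (Fin n ⊕ Fin n) ℝ) * X

/-! ### Causality on a covering space of `Sp(2n)`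

A covering space `p : E → Sp(2n)` carries the smooth structure and the cone structure pulled back
along the local homeomorphism `p`. Hence a curve in `E` is smooth and tangent to the lifted cones
if and only if it is continuous and its projection is smooth and tangent to the cones. -/

variable {n : ℕ} {E : Type*} [TopologicalSpace E]

/-- `γ` restricts to a smooth timelike curve `[0,1] → E`, for the lifted cone structure. -/
def IsTimelikeCurve (p : E → Sp n) (γ : ℝ → E) : Prop :=
  ContinuousOn γ (Set.Icc 0 1) ∧ IsTangentCurve (openCone n) (fun t => p (γ t))

/-- `γ` restricts to a smooth causal curve `[0,1] → E`, for the lifted cone structure. -/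
def IsCausalCurve (p : E → Sp n) (γ : ℝ → E) : Prop :=
  ContinuousOn γ (Set.Icc 0 1) ∧ IsTangentCurve (cone n) (fun t => p (γ t))

/-- The chronological future `I⁺(a)`. -/
def chronFuture (p : E → Sp n) (a : E) : Set E :=
  {b | ∃ γ : ℝ → E, IsTimelikeCurve p γ ∧ γ 0 = a ∧ γ 1 = b}

/-- The chronological past `I⁻(a)`. -/
def chronPast (p : E → Sp n) (a : E) : Set E :=
  {b | ∃ γ : ℝ → E, IsTimelikeCurve p γ ∧ γ 0 = b ∧ γ 1 = a}

/-- The causal future `J⁺(a)` of `a` in the subspace `U`. -/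
def causalFutureIn (p : E → Sp n) (U : Set E) (a : E) : Set E :=
  {b | ∃ γ : ℝ → E, IsCausalCurve p γ ∧ (∀ t ∈ Set.Icc (0 : ℝ) 1, γ t ∈ U) ∧
    γ 0 = a ∧ γ 1 = b} ∪ {a}

/-- The causal past `J⁻(a)` of `a` in the subspace `U`. -/
def causalPastIn (p : E → Sp n) (U : Set E) (a : E) : Set E :=
  {b | ∃ γ : ℝ → E, IsCausalCurve p γ ∧ (∀ t ∈ Set.Icc (0 : ℝ) 1, γ t ∈ U) ∧
    γ 0 = b ∧ γ 1 = a} ∪ {a}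

/-- The subspace `U` of `E`, with the restricted cone structure, is globally hyperbolic: it has no
closed causal curve, and all the sets `J⁺(a) ∩ J⁻(b)` with `a, b ∈ U` are compact, where only
causal curves inside `U` are considered. -/
def IsGloballyHyperbolic (p : E → Sp n) (U : Set E) : Prop :=
  (∀ γ : ℝ → E, IsCausalCurve p γ → (∀ t ∈ Set.Icc (0 : ℝ) 1, γ t ∈ U) → γ 0 ≠ γ 1) ∧
  ∀ a ∈ U, ∀ b ∈ U, IsCompact (causalFutureIn p U a ∩ causalPastIn p U b)

/-! ### The positively elliptic region -/

/-- The Krein form `κ = -iω` on `ℂ²ⁿ`, where `ω` is extended to a form that is linear in the first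
and conjugate linear in the second variable. -/
def krein (v w : Fin n ⊕ Fin n → ℂ) : ℂ :=
  -Complex.I * ∑ i, (v (Sum.inl i) * (starRingEnd ℂ) (w (Sum.inr i)) -
    v (Sum.inr i) * (starRingEnd ℂ) (w (Sum.inl i)))

/-- `W` as a linear endomorphism of `ℂ²ⁿ`. -/
def complexify (W : Sp n) : Module.End ℂ (Fin n ⊕ Fin n → ℂ) :=
  Matrix.toLin' ((W : Matrix (Fin n ⊕ Fin n) (Fin n ⊕ Fin n) ℝ).map Complex.ofReal)

/-- The Krein form (which is Hermitian, so that `κ(v, v)` is real) is positive definite on the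
generalised eigenspace of `W` for `z`. -/
def KreinPositive (W : Sp n) (z : ℂ) : Prop :=
  ∀ v ∈ (complexify W).maxGenEigenspace z, v ≠ 0 → 0 < (krein v v).re

variable (n) in
/-- The positively elliptic region: all complex eigenvalues lie in `S¹ ∖ {1, -1}`, and the Krein
form is positive definite on the generalised eigenspace of an eigenvalue exactly if this
eigenvalue has positive imaginary part. -/
def ellPos : Set (Sp n) :=
  {W | ∀ z : ℂ, (complexify W).HasEigenvalue z →
    ‖z‖ = 1 ∧ z ≠ 1 ∧ z ≠ -1 ∧ (KreinPositive W z ↔ 0 < z.im)}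

/-- `L ⊆ E` is a lift of the positively elliptic region, i.e. the image of a continuous section
of `p` over this region, and its boundary contains the point `e`. -/
def IsEllLift (p : E → Sp n) (e : E) (L : Set E) : Prop :=
  (∃ s : ellPos n → E, Continuous s ∧ (∀ W, p (s W) = W) ∧ L = Set.range s) ∧ e ∈ frontier L

/-- `m` is a lift of `-id` that lies on the boundary of `L`. -/
def IsNegIdLift (p : E → Sp n) (L : Set E) (m : E) : Prop :=
  (p m : Matrix (Fin n ⊕ Fin n) (Fin n ⊕ Fin n) ℝ) = -1 ∧ m ∈ frontier L

end

end SpCausal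

/-!
The proof rests on the Cayley transform `C = (W - 1)(W + 1)⁻¹`. By linear algebra over `ℂ`
(`mem_ellPos_iff`), the positively elliptic region consists of the symplectic `W` for which
`ω(u, W u) > 0` for all `u ≠ 0`, and this holds if and only if `W + 1` is invertible and `C` lies in
the open cone (`pos_iff_cay`). So the Cayley transform identifies the region with the convex set
`openCone n`. Moreover `t ↦ ω(v, C(t) v)` increases strictly along timelike curves (`cay_lt`), while
straight segments `C + t B` with `B` in the open cone are Cayley transforms of timelike curves
(`isTangentCurve_icaySp`). The involution `W ↦ -W⁻¹` preserves the region, exchanges `1` and `-1`,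
and reverses time. If `p` is a covering, then so is `-p⁻¹`, and every statement about the initial
point of the lift yields a statement about its end point.

Contracting Cayley transforms to `0` gives existence and uniqueness of the lift and of its end point
(`exists_section`, `section_unique`, `exists_end_point`, `end_point_unique`). Straight segments from
both ends show that the lift is contained in `I⁺(e) ∩ I⁻(m)`.

For the converse inclusion (`mem_range_of_chron`), a timelike curve from `e` that leaves the lift
passes through a point `x` whose projection has the eigenvalue `-1` (`exists_exit`). Suppose that it
continues to `m`. Close to `m` it lies in the lift again, so it is homotopic to a path inside the
lift, and this path contracts to `e` along paths whose end points do not have the eigenvalue `-1`.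
To a fine partition of a path from `1` belongs a quadratic form on antiperiodic sequences of vectors
(`stepForm`) that is degenerate only if the end point has the eigenvalue `-1`. Its positive index is
therefore constant under these homotopies. But a timelike path has a larger form than the constant
path, and a crossing of the eigenvalue `-1` strictly raises the index (`sigPos_lt_of_crossing`), a
contradiction.

If `I⁺(e) ∩ I⁻(w)` is the lift, then `w` can be reached from points with arbitrarily large Cayley
transform inside the region, and monotonicity forces `-1` for the projection of `w`
(`eq_of_inter_eq_range`). Finally, if `e ≪ w` and `w` is outside of the closure of the lift, then a
curve from `e` to `w` leaves the lift at a point `x ≪ w` with eigenvalue `-1` that does not have the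
eigenvalue `1`. There is an unbounded family of points `y` with `e ≪ y ≪ x`
(`exists_unbounded_family`). A translation that moves `e` to the future and `x` to a point before `w`
makes room for this family in a set `J⁺(a) ∩ J⁻(b)` of the region `I⁺(e) ∩ I⁻(w)`, which is thus not
globally hyperbolic.
-/

open scoped Topology

namespace SpCausal

noncomputable section

/-- Square matrices of size `2n`. -/
abbrev Mat (n : ℕ) : Type := Matrix (Fin n ⊕ Fin n) (Fin n ⊕ Fin n) ℝ

/-- The vector space `ℝ²ⁿ`. -/
abbrev Vec (n : ℕ) : Type := Fin n ⊕ Fin n → ℝ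

/-! ### The symplectic form -/

section

variable {n : ℕ}

lemma omega_eq (v w : Vec n) : omega v w = -(v ⬝ᵥ (Matrix.J (Fin n) ℝ *ᵥ w)) := by
  simp [omega, dotProduct, Matrix.J, Matrix.mulVec, Matrix.fromBlocks, Fintype.sum_sum_type,
    Matrix.one_apply, Finset.sum_sub_distrib]
  ring

lemma omega_add_left (u v w : Vec n) : omega (u + v) w = omega u w + omega v w := by
  simp [omega_eq, add_dotProduct]; ring

lemma omega_add_right (u v w : Vec n) : omega u (v + w) = omega u v + omega u w := by
  simp [omega_eq, dotProduct_add, Matrix.mulVec_add]; ring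

lemma omega_smul_left (c : ℝ) (v w : Vec n) : omega (c • v) w = c * omega v w := by
  simp [omega_eq, smul_dotProduct]

lemma omega_smul_right (c : ℝ) (v w : Vec n) : omega v (c • w) = c * omega v w := by
  simp [omega_eq, dotProduct_smul, Matrix.mulVec_smul]

lemma omega_neg_left (v w : Vec n) : omega (-v) w = -omega v w := by
  simp [omega_eq]

lemma omega_neg_right (v w : Vec n) : omega v (-w) = -omega v w := by
  simp [omega_eq, Matrix.mulVec_neg]

lemma omega_sub_left (u v w : Vec n) : omega (u - v) w = omega u w - omega v w := by
  rw [sub_eq_add_neg, omega_add_left, omega_neg_left]; ring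

lemma omega_sub_right (u v w : Vec n) : omega u (v - w) = omega u v - omega u w := by
  rw [sub_eq_add_neg, omega_add_right, omega_neg_right]; ring

lemma omega_swap (v w : Vec n) : omega v w = -omega w v := by
  simp only [omega, ← Finset.sum_neg_distrib]
  exact Finset.sum_congr rfl fun i _ => by ring

@[simp] lemma omega_self (v : Vec n) : omega v v = 0 := by
  have := omega_swap v v; linarith

@[simp] lemma omega_zero_left (v : Vec n) : omega 0 v = 0 := by simp [omega]

@[simp] lemma omega_zero_right (v : Vec n) : omega v 0 = 0 := by simp [omega]

lemma exists_omega_eq_one {u : Vec n} (hu : u ≠ 0) : ∃ v, omega u v = 1 := by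
  have : ∃ w, omega u w ≠ 0 := by
    by_contra! h
    refine hu (funext ?_)
    rintro (i | i)
    · simpa [omega, Pi.single_apply] using h (Pi.single (Sum.inr i) 1)
    · simpa [omega, Pi.single_apply] using h (Pi.single (Sum.inl i) 1)
  obtain ⟨w, hw⟩ := this
  exact ⟨(omega u w)⁻¹ • w, by rw [omega_smul_right, inv_mul_cancel₀ hw]⟩

lemma eq_zero_of_omega_left {u : Vec n} (h : ∀ w, omega w u = 0) : u = 0 := by
  by_contra hu
  obtain ⟨v, hv⟩ := exists_omega_eq_one hu
  rw [omega_swap, h v] at hv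
  norm_num at hv

lemma mem_symplectic_iff {W : Mat n} :
    W ∈ Matrix.symplecticGroup (Fin n) ℝ ↔ ∀ v w, omega (W *ᵥ v) (W *ᵥ w) = omega v w := by
  have key : ∀ v w : Vec n, omega (W *ᵥ v) (W *ᵥ w)
      = -(v ⬝ᵥ ((Wᵀ * Matrix.J (Fin n) ℝ * W) *ᵥ w)) := by
    intro v w
    rw [omega_eq, Matrix.dotProduct_mulVec, Matrix.vecMul_mulVec, ← Matrix.dotProduct_mulVec,
      Matrix.mulVec_mulVec]
  rw [SymplecticGroup.mem_iff']
  constructor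
  · intro h v w
    rw [key, h, omega_eq]
  · intro h
    ext i j
    have := h (Pi.single i 1) (Pi.single j 1)
    rw [key, omega_eq] at this
    simpa using this

lemma omega_mulVec (W : Sp n) (v w : Vec n) :
    omega (W.1 *ᵥ v) (W.1 *ᵥ w) = omega v w := mem_symplectic_iff.1 W.2 v w

lemma inv_mulVec_mulVec (W : Sp n) (v : Vec n) : (W⁻¹).1 *ᵥ (W.1 *ᵥ v) = v := by
  rw [Matrix.mulVec_mulVec, ← Submonoid.coe_mul, inv_mul_cancel]; simp

lemma mulVec_inv_mulVec (W : Sp n) (v : Vec n) : W.1 *ᵥ ((W⁻¹).1 *ᵥ v) = v := by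
  rw [Matrix.mulVec_mulVec, ← Submonoid.coe_mul, mul_inv_cancel]; simp

lemma omega_inv_mulVec (W : Sp n) (v w : Vec n) :
    omega v ((W⁻¹).1 *ᵥ w) = omega (W.1 *ᵥ v) w := by
  rw [← omega_mulVec W, mulVec_inv_mulVec]

/-- The quadratic form `u ↦ ω(u, Wu)` is positive definite. -/
def Pos (W : Mat n) : Prop := ∀ u, u ≠ 0 → 0 < omega u (W *ᵥ u)

lemma det_ne_zero_of_injective {A : Mat n} (h : ∀ u, A *ᵥ u = 0 → u = 0) : A.det ≠ 0 := by
  intro h0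
  obtain ⟨v, hv, hAv⟩ := Matrix.exists_mulVec_eq_zero_iff.2 h0
  exact hv (h v hAv)

lemma eq_zero_of_det_ne_zero {A : Mat n} (hA : A.det ≠ 0) {u : Vec n} (h : A *ᵥ u = 0) :
    u = 0 := by
  by_contra hu
  exact hA (Matrix.exists_mulVec_eq_zero_iff.1 ⟨u, hu, h⟩)

lemma exists_mulVec_eq {A : Mat n} (hA : A.det ≠ 0) (v : Vec n) : ∃ u, A *ᵥ u = v :=
  ⟨A⁻¹ *ᵥ v, by rw [Matrix.mulVec_mulVec, Matrix.mul_nonsing_inv _ hA.isUnit, Matrix.one_mulVec]⟩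

lemma Pos.det_add_one {W : Mat n} (h : Pos W) : (W + 1).det ≠ 0 := by
  refine det_ne_zero_of_injective fun u hu => ?_
  by_contra h0
  have h1 := h u h0
  rw [Matrix.add_mulVec, Matrix.one_mulVec, add_eq_zero_iff_eq_neg] at hu
  rw [hu, omega_neg_right, omega_self] at h1
  simp at h1

/-! ### The Cayley transform -/

/-- The Cayley transform `W ↦ (W - 1)(W + 1)⁻¹`, meaningful where `W + 1` is invertible. -/
def cay (W : Mat n) : Mat n := (W - 1) * (W + 1)⁻¹

/-- The inverse Cayley transform `C ↦ (1 + C)(1 - C)⁻¹`, meaningful where `1 - C` is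
invertible. -/
def icay (C : Mat n) : Mat n := (1 + C) * (1 - C)⁻¹

lemma cay_mulVec {W : Mat n} (h : (W + 1).det ≠ 0) (u : Vec n) :
    cay W *ᵥ ((W + 1) *ᵥ u) = (W - 1) *ᵥ u := by
  rw [cay, Matrix.mulVec_mulVec, Matrix.mul_assoc, Matrix.nonsing_inv_mul _ h.isUnit,
    Matrix.mul_one]

lemma icay_mulVec {C : Mat n} (h : (1 - C).det ≠ 0) (u : Vec n) :
    icay C *ᵥ ((1 - C) *ᵥ u) = (1 + C) *ᵥ u := by
  rw [icay, Matrix.mulVec_mulVec, Matrix.mul_assoc, Matrix.nonsing_inv_mul _ h.isUnit,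
    Matrix.mul_one]

lemma cay_mul {W : Mat n} (h : (W + 1).det ≠ 0) : cay W * (W + 1) = W - 1 := by
  rw [cay, Matrix.mul_assoc, Matrix.nonsing_inv_mul _ h.isUnit, Matrix.mul_one]

lemma icay_mul {C : Mat n} (h : (1 - C).det ≠ 0) : icay C * (1 - C) = 1 + C := by
  rw [icay, Matrix.mul_assoc, Matrix.nonsing_inv_mul _ h.isUnit, Matrix.mul_one]

lemma cay_eq {W : Mat n} (h : (W + 1).det ≠ 0) : cay W = 1 - (2 : ℝ) • (W + 1)⁻¹ := by
  have : W - 1 = (W + 1) - (2 : ℝ) • (1 : Mat n) := by rw [two_smul]; abel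
  rw [cay, this, Matrix.sub_mul, Matrix.mul_nonsing_inv _ h.isUnit, Matrix.smul_mul,
    Matrix.one_mul]

lemma icay_eq {C : Mat n} (h : (1 - C).det ≠ 0) : icay C = (2 : ℝ) • (1 - C)⁻¹ - 1 := by
  have : 1 + C = (2 : ℝ) • (1 : Mat n) - (1 - C) := by rw [two_smul]; abel
  rw [icay, this, Matrix.sub_mul, Matrix.mul_nonsing_inv _ h.isUnit, Matrix.smul_mul,
    Matrix.one_mul]

lemma one_sub_cay_mul {W : Mat n} (h : (W + 1).det ≠ 0) :
    (1 - cay W) * (W + 1) = (2 : ℝ) • 1 := by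
  rw [Matrix.sub_mul, cay_mul h, two_smul, Matrix.one_mul]; abel

lemma icay_add_one_mul {C : Mat n} (h : (1 - C).det ≠ 0) :
    (icay C + 1) * (1 - C) = (2 : ℝ) • 1 := by
  rw [Matrix.add_mul, icay_mul h, two_smul, Matrix.one_mul]; abel

lemma det_two_smul_one : ((2 : ℝ) • (1 : Mat n)).det ≠ 0 := by
  rw [Matrix.det_smul]; simp

lemma det_one_sub_cay {W : Mat n} (h : (W + 1).det ≠ 0) : (1 - cay W).det ≠ 0 := by
  intro h0
  have := congrArg Matrix.det (one_sub_cay_mul h)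
  rw [Matrix.det_mul, h0, zero_mul] at this
  exact det_two_smul_one this.symm

lemma det_icay_add_one {C : Mat n} (h : (1 - C).det ≠ 0) : (icay C + 1).det ≠ 0 := by
  intro h0
  have := congrArg Matrix.det (icay_add_one_mul h)
  rw [Matrix.det_mul, h0, zero_mul] at this
  exact det_two_smul_one this.symm

lemma mul_right_cancel_det {A B D : Mat n} (hD : D.det ≠ 0) (h : A * D = B * D) : A = B := by
  have := congrArg (· * D⁻¹) h
  simpa [Matrix.mul_assoc, Matrix.mul_nonsing_inv _ hD.isUnit] using this

lemma icay_cay {W : Mat n} (h : (W + 1).det ≠ 0) : icay (cay W) = W := by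
  apply mul_right_cancel_det (det_one_sub_cay h)
  apply mul_right_cancel_det h
  rw [icay_mul (det_one_sub_cay h), Matrix.add_mul, cay_mul h, Matrix.mul_assoc,
    one_sub_cay_mul h, Matrix.mul_smul, Matrix.mul_one, Matrix.one_mul, two_smul]
  abel

lemma cay_icay {C : Mat n} (h : (1 - C).det ≠ 0) : cay (icay C) = C := by
  apply mul_right_cancel_det (det_icay_add_one h)
  apply mul_right_cancel_det h
  rw [cay_mul (det_icay_add_one h), Matrix.sub_mul, icay_mul h, Matrix.mul_assoc,
    icay_add_one_mul h, Matrix.mul_smul, Matrix.mul_one, Matrix.one_mul, two_smul]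
  abel

@[simp] lemma cay_one : cay (1 : Mat n) = 0 := by simp [cay]

@[simp] lemma icay_zero : icay (0 : Mat n) = 1 := by simp [icay]

lemma lieSp_antisymm {C : Mat n} (hC : C ∈ lieSp n) (v w : Vec n) :
    omega (C *ᵥ v) w = -omega v (C *ᵥ w) := by
  rw [omega_swap, hC w v]

lemma omega_add_one_sub_one (W : Sp n) (u v : Vec n) :
    omega ((W.1 + 1) *ᵥ u) ((W.1 - 1) *ᵥ v) = omega u (W.1 *ᵥ v) + omega v (W.1 *ᵥ u) := by
  rw [Matrix.add_mulVec, Matrix.sub_mulVec, Matrix.one_mulVec, Matrix.one_mulVec, omega_sub_right,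
    omega_add_left, omega_add_left, omega_mulVec, omega_swap (W.1 *ᵥ u) v]
  ring

/-- In terms of the Cayley transform, `u ↦ ω(u, Wu)` is the quadratic form of `cay W` up to a
linear change of variables and the factor `2`. -/
lemma omega_cay (W : Sp n) (h : (W.1 + 1).det ≠ 0) (u : Vec n) :
    omega ((W.1 + 1) *ᵥ u) (cay W.1 *ᵥ ((W.1 + 1) *ᵥ u)) = 2 * omega u (W.1 *ᵥ u) := by
  rw [cay_mulVec h, omega_add_one_sub_one]; ring

lemma cay_mem_lieSp (W : Sp n) (h : (W.1 + 1).det ≠ 0) : cay W.1 ∈ lieSp n := by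
  intro v w
  obtain ⟨a, rfl⟩ := exists_mulVec_eq h v
  obtain ⟨b, rfl⟩ := exists_mulVec_eq h w
  rw [cay_mulVec h, cay_mulVec h, omega_add_one_sub_one, omega_add_one_sub_one, add_comm]

lemma icay_mem {C : Mat n} (hC : C ∈ lieSp n) (h : (1 - C).det ≠ 0) :
    icay C ∈ Matrix.symplecticGroup (Fin n) ℝ := by
  rw [mem_symplectic_iff]
  intro v w
  obtain ⟨a, rfl⟩ := exists_mulVec_eq h v
  obtain ⟨b, rfl⟩ := exists_mulVec_eq h w
  rw [icay_mulVec h, icay_mulVec h]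
  simp only [Matrix.add_mulVec, Matrix.sub_mulVec, Matrix.one_mulVec, omega_add_left,
    omega_add_right, omega_sub_left, omega_sub_right, lieSp_antisymm hC]
  ring

lemma pos_iff_cay (W : Sp n) : Pos W.1 ↔ (W.1 + 1).det ≠ 0 ∧ Pos (cay W.1) := by
  constructor
  · intro h
    refine ⟨h.det_add_one, fun v hv => ?_⟩
    obtain ⟨a, rfl⟩ := exists_mulVec_eq h.det_add_one v
    rw [omega_cay _ h.det_add_one]
    have : a ≠ 0 := by rintro rfl; simp at hv
    linarith [h a this]
  · rintro ⟨h, hC⟩ u hu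
    have h1 : (W.1 + 1) *ᵥ u ≠ 0 := fun h0 => hu (eq_zero_of_det_ne_zero h h0)
    have := hC _ h1
    rw [omega_cay _ h] at this
    linarith

/-- A positive semi-definite element of the Lie algebra has no eigenvalue `1`, as
`ω(u, u) = 0`. -/
lemma det_one_sub_ne_zero {C : Mat n} (hC : C ∈ lieSp n) (h : ∀ u, 0 ≤ omega u (C *ᵥ u)) :
    (1 - C).det ≠ 0 := by
  refine det_ne_zero_of_injective fun u hu => ?_
  rw [Matrix.sub_mulVec, Matrix.one_mulVec, sub_eq_zero] at hu
  -- `u` is a null vector of a semi-definite form, hence in its radical.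
  refine eq_zero_of_omega_left fun w => ?_
  have key : ∀ t : ℝ, 0 ≤ 2 * t * omega w u + t ^ 2 * omega w (C *ᵥ w) := by
    intro t
    have h1 := h (u + t • w)
    have h2 : omega u (C *ᵥ w) = omega w u := by rw [hC u w, ← hu]
    rw [Matrix.mulVec_add, Matrix.mulVec_smul, ← hu] at h1
    simp only [omega_add_left, omega_add_right, omega_smul_left, omega_smul_right, omega_self,
      h2] at h1
    nlinarith [h1]
  set a := omega w u
  set b := omega w (C *ᵥ w)
  have hb : 0 ≤ b := h w
  by_contra ha
  have := key (-a / (b + 1))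
  have h3 : 2 * (-a / (b + 1)) * a + (-a / (b + 1)) ^ 2 * b = -(a ^ 2 * (b + 2) / (b + 1) ^ 2) := by
    field_simp; ring
  rw [h3] at this
  have : 0 < a ^ 2 * (b + 2) / (b + 1) ^ 2 := by positivity
  linarith

lemma openCone_nonneg {X : Mat n} (hX : X ∈ openCone n) (u : Vec n) : 0 ≤ omega u (X *ᵥ u) := by
  by_cases hu : u = 0
  · simp [hu]
  · exact (hX.2 u hu).le

lemma add_mem_lieSp {X Y : Mat n} (hX : X ∈ lieSp n) (hY : Y ∈ lieSp n) : X + Y ∈ lieSp n := by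
  intro v w
  rw [Matrix.add_mulVec, Matrix.add_mulVec, omega_add_right, omega_add_right, hX v w, hY v w]

lemma smul_mem_lieSp {X : Mat n} (c : ℝ) (hX : X ∈ lieSp n) : c • X ∈ lieSp n := by
  intro v w
  rw [Matrix.smul_mulVec, Matrix.smul_mulVec, omega_smul_right, omega_smul_right, hX v w]

lemma zero_mem_lieSp : (0 : Mat n) ∈ lieSp n := by intro v w; simp

/-- Sums of a positive semi-definite and a positive definite element are positive definite. -/
lemma add_mem_openCone {X Y : Mat n} (hX : X ∈ lieSp n) (hX' : ∀ u, 0 ≤ omega u (X *ᵥ u))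
    (hY : Y ∈ openCone n) : X + Y ∈ openCone n := by
  refine ⟨add_mem_lieSp hX hY.1, fun u hu => ?_⟩
  rw [Matrix.add_mulVec, omega_add_right]
  linarith [hX' u, hY.2 u hu]

lemma smul_mem_openCone {X : Mat n} {c : ℝ} (hc : 0 < c) (hX : X ∈ openCone n) :
    c • X ∈ openCone n := by
  refine ⟨smul_mem_lieSp c hX.1, fun u hu => ?_⟩
  rw [Matrix.smul_mulVec, omega_smul_right]
  exact mul_pos hc (hX.2 u hu)

lemma conj_mem_openCone (W : Sp n) {X : Mat n} (hX : X ∈ openCone n) :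
    (W⁻¹).1 * X * W.1 ∈ openCone n := by
  have h : ∀ v w, omega v (((W⁻¹).1 * X * W.1) *ᵥ w) = omega (W.1 *ᵥ v) (X *ᵥ (W.1 *ᵥ w)) := by
    intro v w
    rw [← Matrix.mulVec_mulVec, ← Matrix.mulVec_mulVec, omega_inv_mulVec]
  refine ⟨fun v w => ?_, fun u hu => ?_⟩
  · rw [h, h, hX.1]
  · rw [h]
    refine hX.2 _ fun h0 => hu ?_
    have := inv_mulVec_mulVec W u
    rw [h0] at this
    simpa using this.symm

lemma openCone_subset_cone (hn : 0 < n) : openCone n ⊆ cone n := by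
  intro X hX
  refine ⟨hX.1, ?_, openCone_nonneg hX⟩
  rintro rfl
  have : (Pi.single (Sum.inl ⟨0, hn⟩) 1 : Vec n) ≠ 0 := by simp
  have := hX.2 _ this
  rw [Matrix.zero_mulVec, omega_zero_right] at this
  exact lt_irrefl _ this

/-- The standard complex structure is an element of the open cone. -/
lemma J_mem_openCone : Matrix.J (Fin n) ℝ ∈ openCone n := by
  have h : ∀ v w : Vec n, omega v (Matrix.J (Fin n) ℝ *ᵥ w) = v ⬝ᵥ w := by
    intro v w
    rw [omega_eq, Matrix.mulVec_mulVec, Matrix.J_squared]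
    simp [Matrix.neg_mulVec]
  refine ⟨fun v w => by rw [h, h, dotProduct_comm], fun u hu => ?_⟩
  rw [h]
  exact lt_of_le_of_ne (Finset.sum_nonneg fun i _ => mul_self_nonneg (u i))
    fun h0 => hu (dotProduct_self_eq_zero.1 h0.symm)

lemma exists_eq_neg_of_det {W : Mat n} (h : (W + 1).det = 0) : ∃ u ≠ 0, W *ᵥ u = -u := by
  obtain ⟨u, hu, h⟩ := Matrix.exists_mulVec_eq_zero_iff.2 h
  rw [Matrix.add_mulVec, Matrix.one_mulVec, add_eq_zero_iff_eq_neg] at h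
  exact ⟨u, hu, h⟩

end

/-! ### Topology of the symplectic group -/

section

variable {n : ℕ}

lemma continuousAt_matrix_inv {A : Mat n} (hA : A.det ≠ 0) :
    ContinuousAt (fun B : Mat n => B⁻¹) A := by
  have h : (fun B : Mat n => B⁻¹) = fun B => (B.det)⁻¹ • B.adjugate := by
    funext B
    rw [Matrix.inv_def, Ring.inverse_eq_inv']
  rw [h]
  exact ((continuous_id.matrix_det).continuousAt.inv₀ hA).smul
    (continuous_id.matrix_adjugate).continuousAt

lemma continuousAt_cay {W : Mat n} (h : (W + 1).det ≠ 0) : ContinuousAt (cay (n := n)) W := by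
  refine ContinuousAt.mul (by fun_prop) ?_
  exact ContinuousAt.comp (f := fun W : Mat n => W + 1) (continuousAt_matrix_inv h) (by fun_prop)

lemma continuousAt_icay {C : Mat n} (h : (1 - C).det ≠ 0) : ContinuousAt (icay (n := n)) C := by
  refine ContinuousAt.mul (by fun_prop) ?_
  exact ContinuousAt.comp (f := fun C : Mat n => 1 - C) (continuousAt_matrix_inv h) (by fun_prop)

lemma continuous_omega {X : Type*} [TopologicalSpace X] {f g : X → Vec n} (hf : Continuous f)
    (hg : Continuous g) : Continuous fun x => omega (f x) (g x) := by
  unfold omega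
  fun_prop

lemma continuous_sp_inv : Continuous fun W : Sp n => W⁻¹ := by
  rw [continuous_induced_rng]
  have : (Subtype.val ∘ fun W : Sp n => W⁻¹)
      = fun W : Sp n => (-Matrix.J (Fin n) ℝ) * W.1ᵀ * Matrix.J (Fin n) ℝ := by
    funext W
    exact SymplecticGroup.coe_inv W
  rw [this]
  exact ((continuous_const.mul continuous_subtype_val.matrix_transpose).mul continuous_const)

/-- The inverse Cayley transform as a map to the symplectic group; the junk value `1` is taken
where it is not defined. -/
def icaySp (C : Mat n) : Sp n :=
  open Classical in if h : C ∈ lieSp n ∧ (1 - C).det ≠ 0 then ⟨icay C, icay_mem h.1 h.2⟩ else 1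

lemma coe_icaySp {C : Mat n} (hC : C ∈ lieSp n) (h : (1 - C).det ≠ 0) :
    (icaySp C).1 = icay C := by
  rw [icaySp, dif_pos ⟨hC, h⟩]

@[simp] lemma icaySp_zero : icaySp (0 : Mat n) = 1 := by
  apply Subtype.ext
  rw [coe_icaySp zero_mem_lieSp (by simp)]
  simp

lemma icaySp_cay (W : Sp n) (h : (W.1 + 1).det ≠ 0) : icaySp (cay W.1) = W := by
  apply Subtype.ext
  rw [coe_icaySp (cay_mem_lieSp W h) (det_one_sub_cay h), icay_cay h]

lemma cay_icaySp {C : Mat n} (hC : C ∈ lieSp n) (h : (1 - C).det ≠ 0) :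
    cay (icaySp C).1 = C := by
  rw [coe_icaySp hC h, cay_icay h]

lemma det_icaySp_add_one {C : Mat n} (hC : C ∈ lieSp n) (h : (1 - C).det ≠ 0) :
    ((icaySp C).1 + 1).det ≠ 0 := by
  rw [coe_icaySp hC h]
  exact det_icay_add_one h

lemma continuousOn_icaySp :
    ContinuousOn (icaySp (n := n)) {C | C ∈ lieSp n ∧ (1 - C).det ≠ 0} := by
  rw [Topology.IsInducing.subtypeVal.continuousOn_iff]
  have : ContinuousOn (icay (n := n)) {C | C ∈ lieSp n ∧ (1 - C).det ≠ 0} :=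
    fun C hC => (continuousAt_icay hC.2).continuousWithinAt
  exact this.congr fun C hC => coe_icaySp hC.1 hC.2

lemma det_one_sub_of_openCone {C : Mat n} (hC : C ∈ openCone n) : (1 - C).det ≠ 0 :=
  det_one_sub_ne_zero hC.1 (openCone_nonneg hC)

lemma pos_icaySp {C : Mat n} (hC : C ∈ openCone n) : Pos (icaySp C).1 := by
  have h := det_one_sub_of_openCone hC
  rw [pos_iff_cay, cay_icaySp hC.1 h]
  exact ⟨det_icaySp_add_one hC.1 h, hC.2⟩

lemma cay_mem_openCone (W : Sp n) (h : Pos W.1) : cay W.1 ∈ openCone n :=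
  ⟨cay_mem_lieSp W h.det_add_one, ((pos_iff_cay W).1 h).2⟩

/-- The involution `W ↦ -W⁻¹` of the symplectic group. It exchanges `1` and `-1` and reverses
the cone structure. -/
def negInv (W : Sp n) : Sp n := ⟨-(W⁻¹).1, SymplecticGroup.neg_mem (W⁻¹).2⟩

lemma coe_negInv (W : Sp n) : (negInv W).1 = -(W⁻¹).1 := rfl

lemma negInv_negInv (W : Sp n) : negInv (negInv W) = W := by
  apply Subtype.ext
  rw [coe_negInv]
  have : (negInv W)⁻¹ = ⟨-W.1, SymplecticGroup.neg_mem W.2⟩ := by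
    apply inv_eq_of_mul_eq_one_left
    apply Subtype.ext
    rw [Submonoid.coe_mul, coe_negInv]
    show -W.1 * -(W⁻¹).1 = 1
    rw [neg_mul_neg, ← Submonoid.coe_mul, mul_inv_cancel, Submonoid.coe_one]
  rw [this]
  simp

lemma continuous_negInv : Continuous (negInv (n := n)) :=
  Continuous.subtype_mk (continuous_subtype_val.comp continuous_sp_inv).neg _

/-- `W ↦ -W⁻¹` as a homeomorphism. -/
def negInvHomeo : Sp n ≃ₜ Sp n where
  toFun := negInv
  invFun := negInv
  left_inv := negInv_negInv
  right_inv := negInv_negInv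
  continuous_toFun := continuous_negInv
  continuous_invFun := continuous_negInv

lemma negInv_mulVec (W : Sp n) (u : Vec n) : (negInv W).1 *ᵥ (W.1 *ᵥ u) = -u := by
  rw [coe_negInv, Matrix.neg_mulVec, inv_mulVec_mulVec]

lemma pos_negInv (W : Sp n) (h : Pos W.1) : Pos (negInv W).1 := by
  intro u hu
  rw [coe_negInv, Matrix.neg_mulVec, omega_neg_right, omega_inv_mulVec, ← omega_swap]
  exact h u hu

/-! ### Velocities of curves of matrices -/

/-- Entrywise derivative within `s` of a curve of matrices. -/
def HasVel (W : ℝ → Mat n) (W' : Mat n) (s : Set ℝ) (t : ℝ) : Prop :=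
  ∀ i j, HasDerivWithinAt (fun r => W r i j) (W' i j) s t

/-- Entrywise smoothness on `s` of a curve of matrices. -/
def MSmooth (W : ℝ → Mat n) (s : Set ℝ) : Prop :=
  ∀ i j, ContDiffOn ℝ ∞ (fun r => W r i j) s

lemma HasVel.unique {W : ℝ → Mat n} {A B : Mat n} {t : ℝ} (ht : t ∈ Set.Icc (0 : ℝ) 1)
    (hA : HasVel W A (Set.Icc 0 1) t) (hB : HasVel W B (Set.Icc 0 1) t) : A = B := by
  ext i j
  have hu := uniqueDiffOn_Icc (zero_lt_one (α := ℝ)) t ht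
  rw [← (hA i j).derivWithin hu, ← (hB i j).derivWithin hu]

lemma hasVel_const (A : Mat n) (s : Set ℝ) (t : ℝ) : HasVel (fun _ => A) 0 s t :=
  fun _ _ => hasDerivWithinAt_const ..

lemma HasVel.mul {A B : ℝ → Mat n} {A' B' : Mat n} {s : Set ℝ} {t : ℝ}
    (hA : HasVel A A' s t) (hB : HasVel B B' s t) :
    HasVel (fun r => A r * B r) (A' * B t + A t * B') s t := by
  intro i j
  have h := HasDerivWithinAt.fun_sum (u := Finset.univ) fun k _ => (hA i k).mul (hB k j)
  refine h.congr_deriv ?_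
  simp [Matrix.mul_apply, Finset.sum_add_distrib]

lemma HasVel.add {A B : ℝ → Mat n} {A' B' : Mat n} {s : Set ℝ} {t : ℝ}
    (hA : HasVel A A' s t) (hB : HasVel B B' s t) :
    HasVel (fun r => A r + B r) (A' + B') s t :=
  fun i j => (hA i j).add (hB i j)

lemma HasVel.sub {A B : ℝ → Mat n} {A' B' : Mat n} {s : Set ℝ} {t : ℝ}
    (hA : HasVel A A' s t) (hB : HasVel B B' s t) :
    HasVel (fun r => A r - B r) (A' - B') s t :=
  fun i j => (hA i j).sub (hB i j)

lemma HasVel.neg {A : ℝ → Mat n} {A' : Mat n} {s : Set ℝ} {t : ℝ}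
    (hA : HasVel A A' s t) : HasVel (fun r => -A r) (-A') s t :=
  fun i j => (hA i j).neg

lemma HasVel.congr {A B : ℝ → Mat n} {A' : Mat n} {s : Set ℝ} {t : ℝ}
    (hA : HasVel A A' s t) (h : ∀ r ∈ s, B r = A r) (ht : t ∈ s) : HasVel B A' s t :=
  fun i j => (hA i j).congr (fun r hr => by rw [h r hr]) (by rw [h t ht])

lemma HasVel.congr_vel {W : ℝ → Mat n} {A B : Mat n} {s : Set ℝ} {t : ℝ} (h : HasVel W A s t)
    (hAB : A = B) : HasVel W B s t := hAB ▸ h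

lemma HasVel.comp_affine {A : ℝ → Mat n} {A' : Mat n} {s s' : Set ℝ} {t a b : ℝ}
    (hA : HasVel A A' s (a + b * t)) (h : Set.MapsTo (fun r => a + b * r) s' s) :
    HasVel (fun r => A (a + b * r)) (b • A') s' t := by
  intro i j
  have h1 : HasDerivWithinAt (fun r => a + b * r) b s' t := by
    simpa using ((hasDerivWithinAt_id t s').const_mul b).const_add a
  have h2 : HasDerivWithinAt ((fun r => A r i j) ∘ fun r => a + b * r) (A' i j * b) s' t :=
    HasDerivWithinAt.comp t (hA i j) h1 h
  exact h2.congr_deriv (by simp [mul_comm])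

lemma MSmooth.mul {A B : ℝ → Mat n} {s : Set ℝ} (hA : MSmooth A s) (hB : MSmooth B s) :
    MSmooth (fun r => A r * B r) s := by
  intro i j
  simp only [Matrix.mul_apply]
  exact ContDiffOn.sum fun k _ => (hA i k).mul (hB k j)

lemma msmooth_const (A : Mat n) (s : Set ℝ) : MSmooth (fun _ => A) s :=
  fun _ _ => contDiffOn_const

lemma MSmooth.add {A B : ℝ → Mat n} {s : Set ℝ} (hA : MSmooth A s) (hB : MSmooth B s) :
    MSmooth (fun r => A r + B r) s := fun i j => (hA i j).add (hB i j)

lemma MSmooth.sub {A B : ℝ → Mat n} {s : Set ℝ} (hA : MSmooth A s) (hB : MSmooth B s) :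
    MSmooth (fun r => A r - B r) s := fun i j => (hA i j).sub (hB i j)

lemma MSmooth.neg {A : ℝ → Mat n} {s : Set ℝ} (hA : MSmooth A s) :
    MSmooth (fun r => -A r) s := fun i j => (hA i j).neg

lemma MSmooth.congr {A B : ℝ → Mat n} {s : Set ℝ} (hA : MSmooth A s)
    (h : ∀ r ∈ s, B r = A r) : MSmooth B s :=
  fun i j => (hA i j).congr fun r hr => by rw [h r hr]

lemma MSmooth.comp_affine {A : ℝ → Mat n} {s s' : Set ℝ} {a b : ℝ}
    (hA : MSmooth A s) (h : Set.MapsTo (fun r => a + b * r) s' s) :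
    MSmooth (fun r => A (a + b * r)) s' := by
  intro i j
  have h1 : ContDiffOn ℝ ∞ (fun r => a + b * r) s' := by fun_prop
  exact (hA i j).comp h1 h

lemma MSmooth.transpose {A : ℝ → Mat n} {s : Set ℝ} (hA : MSmooth A s) :
    MSmooth (fun r => (A r)ᵀ) s := fun i j => hA j i

lemma MSmooth.sp_inv {W : ℝ → Sp n} {s : Set ℝ} (hW : MSmooth (fun t => (W t).1) s) :
    MSmooth (fun t => ((W t)⁻¹).1) s := by
  have := ((msmooth_const (-Matrix.J (Fin n) ℝ) s).mul hW.transpose).mul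
    (msmooth_const (Matrix.J (Fin n) ℝ) s)
  exact this.congr fun r _ => SymplecticGroup.coe_inv (W r)

lemma MSmooth.det {A : ℝ → Mat n} {s : Set ℝ} (hA : MSmooth A s) :
    ContDiffOn ℝ ∞ (fun r => (A r).det) s := by
  simp only [Matrix.det_apply]
  refine ContDiffOn.sum fun σ _ => ContDiffOn.const_smul _ ?_
  exact contDiffOn_prod fun i _ => hA _ _

lemma MSmooth.inv {A : ℝ → Mat n} {s : Set ℝ} (hA : MSmooth A s)
    (h : ∀ r ∈ s, (A r).det ≠ 0) : MSmooth (fun r => (A r)⁻¹) s := by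
  intro i j
  have h1 : (fun r => (A r)⁻¹ i j)
      = fun r => ((A r).det)⁻¹ * ((A r).updateRow j (Pi.single i 1)).det := by
    funext r
    rw [Matrix.inv_def, Ring.inverse_eq_inv', Matrix.smul_apply, Matrix.adjugate_apply,
      smul_eq_mul]
  rw [h1]
  refine (hA.det.inv h).mul (MSmooth.det fun k l => ?_)
  by_cases hk : k = j
  · subst hk
    simpa [Matrix.updateRow_self] using contDiffOn_const
  · simpa [Matrix.updateRow_ne hk] using hA k l

lemma MSmooth.hasVel {A : ℝ → Mat n} {s : Set ℝ} (hA : MSmooth A s) {t : ℝ} (ht : t ∈ s) :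
    ∃ A', HasVel A A' s t :=
  ⟨Matrix.of fun i j => derivWithin (fun r => A r i j) s t, fun i j =>
    (((hA i j).differentiableOn (by simp)) t ht).hasDerivWithinAt⟩

lemma MSmooth.continuousOn {A : ℝ → Mat n} {s : Set ℝ} (hA : MSmooth A s) :
    ContinuousOn A s :=
  continuousOn_pi.2 fun i => continuousOn_pi.2 fun j => (hA i j).continuousOn

/-- Derivative of the inverse of a curve of matrices, from `A A⁻¹ = 1`. -/
lemma HasVel.of_mul_eq_one {A B : ℝ → Mat n} {A' : Mat n} {t : ℝ}
    (ht : t ∈ Set.Icc (0 : ℝ) 1) (hA : HasVel A A' (Set.Icc 0 1) t)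
    (hB : MSmooth B (Set.Icc 0 1)) (h : ∀ r ∈ Set.Icc (0 : ℝ) 1, A r * B r = 1) :
    HasVel B (-(B t * A' * B t)) (Set.Icc 0 1) t := by
  obtain ⟨B', hB'⟩ := hB.hasVel ht
  have h1 := ((hasVel_const 1 (Set.Icc 0 1) t).congr h ht).unique ht (hA.mul hB')
  have h2 : B t * A t = 1 := mul_eq_one_comm.1 (h t ht)
  have h3 : B' = -(B t * A' * B t) := by
    have h4 := congrArg (B t * ·) h1
    simp only [mul_zero, mul_add, ← mul_assoc, h2, one_mul] at h4
    rw [eq_neg_iff_add_eq_zero, add_comm]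
    exact h4.symm
  exact h3 ▸ hB'

lemma isTangentCurve_iff {K : Set (Mat n)} {W : ℝ → Sp n} :
    IsTangentCurve K W ↔ MSmooth (fun t => (W t).1) (Set.Icc 0 1) ∧
      ∀ t ∈ Set.Icc (0 : ℝ) 1, ∃ X ∈ K,
        HasVel (fun t => (W t).1) ((W t).1 * X) (Set.Icc 0 1) t := by
  refine and_congr_right fun hs => forall₂_congr fun t ht => exists_congr fun X =>
    and_congr_right fun _ => ?_
  have hv : HasVel (fun t => (W t).1) (velocity W t) (Set.Icc 0 1) t := fun i j =>
    ((hs i j).differentiableOn (by simp) t ht).hasDerivWithinAt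
  exact ⟨fun h => h ▸ hv, fun h => hv.unique ht h⟩

end

/-! ### Timelike curves in the symplectic group -/

section

variable {n : ℕ}

lemma IsTangentCurve.congr {K : Set (Mat n)} {W V : ℝ → Sp n} (hW : IsTangentCurve K W)
    (h : ∀ t ∈ Set.Icc (0 : ℝ) 1, V t = W t) : IsTangentCurve K V := by
  rw [isTangentCurve_iff] at hW ⊢
  refine ⟨hW.1.congr fun r hr => by rw [h r hr], fun t ht => ?_⟩
  obtain ⟨X, hX, hv⟩ := hW.2 t ht
  refine ⟨X, hX, ?_⟩
  rw [h t ht]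
  exact hv.congr (fun r hr => by rw [h r hr]) ht

/-- Since the cone field is bi-invariant, pointwise products of timelike curves are timelike.
This replaces the concatenation of timelike curves, which need not be smooth. -/
lemma IsTangentCurve.mul_mul {V W : ℝ → Sp n} (hV : IsTangentCurve (openCone n) V) (c : Sp n)
    (hW : IsTangentCurve (openCone n) W) :
    IsTangentCurve (openCone n) fun t => V t * c * W t := by
  rw [isTangentCurve_iff] at hV hW ⊢
  refine ⟨(hV.1.mul (msmooth_const c.1 _)).mul hW.1, fun t ht => ?_⟩
  obtain ⟨X, hX, hXv⟩ := hV.2 t ht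
  obtain ⟨Y, hY, hYv⟩ := hW.2 t ht
  have hc := conj_mem_openCone (c * W t) hX
  refine ⟨_, add_mem_openCone hc.1 (openCone_nonneg hc) hY, ?_⟩
  have h := (hXv.mul (hasVel_const c.1 (Set.Icc 0 1) t)).mul hYv
  refine HasVel.congr_vel (W := fun t => (V t * c * W t).1) h (Eq.symm ?_)
  have h1 : (V t * c * W t).1 * (((c * W t)⁻¹).1 * X * (c * W t).1)
      = (V t).1 * (((c * W t) * (c * W t)⁻¹ : Sp n).1) * X * (c.1 * (W t).1) := by
    simp only [Submonoid.coe_mul]; noncomm_ring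
  rw [mul_add, h1, mul_inv_cancel]
  simp only [Submonoid.coe_mul, Submonoid.coe_one, mul_one, mul_zero, add_zero]
  noncomm_ring

lemma IsTangentCurve.const_mul {K : Set (Mat n)} {W : ℝ → Sp n} (hW : IsTangentCurve K W)
    (g : Sp n) : IsTangentCurve K fun t => g * W t := by
  rw [isTangentCurve_iff] at hW ⊢
  refine ⟨(msmooth_const g.1 _).mul hW.1, fun t ht => ?_⟩
  obtain ⟨X, hX, hv⟩ := hW.2 t ht
  refine ⟨X, hX, ?_⟩
  have h := (hasVel_const g.1 (Set.Icc 0 1) t).mul hv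
  rw [zero_mul, zero_add, ← mul_assoc] at h
  exact h

lemma IsTangentCurve.mul_const {W : ℝ → Sp n} (hW : IsTangentCurve (openCone n) W)
    (g : Sp n) : IsTangentCurve (openCone n) fun t => W t * g := by
  rw [isTangentCurve_iff] at hW ⊢
  refine ⟨hW.1.mul (msmooth_const g.1 _), fun t ht => ?_⟩
  obtain ⟨X, hX, hv⟩ := hW.2 t ht
  refine ⟨_, conj_mem_openCone g hX, ?_⟩
  have h := hv.mul (hasVel_const g.1 (Set.Icc 0 1) t)
  refine HasVel.congr_vel (W := fun t => (W t * g).1) h (Eq.symm ?_)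
  have h1 : (W t * g).1 * ((g⁻¹).1 * X * g.1) = (W t).1 * ((g * g⁻¹ : Sp n).1) * X * g.1 := by
    simp only [Submonoid.coe_mul]; noncomm_ring
  rw [h1, mul_inv_cancel]
  simp

lemma mapsTo_affine {r s : ℝ} (hr : 0 ≤ r) (hrs : r ≤ s) (hs : s ≤ 1) :
    Set.MapsTo (fun t : ℝ => r + (s - r) * t) (Set.Icc 0 1) (Set.Icc 0 1) := by
  intro t ht
  constructor <;> nlinarith [ht.1, ht.2]

/-- The restriction of a timelike curve to `[r, s]`, reparametrized by `[0, 1]`. -/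
lemma IsTangentCurve.affine {W : ℝ → Sp n} (hW : IsTangentCurve (openCone n) W) {r s : ℝ}
    (hr : 0 ≤ r) (hrs : r < s) (hs : s ≤ 1) :
    IsTangentCurve (openCone n) fun t => W (r + (s - r) * t) := by
  have hm := mapsTo_affine hr hrs.le hs
  rw [isTangentCurve_iff] at hW ⊢
  refine ⟨hW.1.comp_affine hm, fun t ht => ?_⟩
  obtain ⟨X, hX, hv⟩ := hW.2 _ (hm ht)
  refine ⟨_, smul_mem_openCone (sub_pos.2 hrs) hX, ?_⟩
  rw [mul_smul_comm]
  exact hv.comp_affine hm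

lemma coe_mul_coe_inv (W : Sp n) : W.1 * (W⁻¹).1 = 1 := by
  rw [← Submonoid.coe_mul, mul_inv_cancel, Submonoid.coe_one]

lemma coe_inv_mul_coe (W : Sp n) : (W⁻¹).1 * W.1 = 1 := by
  rw [← Submonoid.coe_mul, inv_mul_cancel, Submonoid.coe_one]

/-- The involution `W ↦ -W⁻¹` reverses time. -/
lemma IsTangentCurve.negInv_reverse {W : ℝ → Sp n} (hW : IsTangentCurve (openCone n) W) :
    IsTangentCurve (openCone n) fun t => negInv (W (1 - t)) := by
  have hm : Set.MapsTo (fun t : ℝ => 1 + -1 * t) (Set.Icc 0 1) (Set.Icc 0 1) := by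
    intro t ht
    constructor <;> linarith [ht.1, ht.2]
  rw [isTangentCurve_iff] at hW ⊢
  have he : (fun t : ℝ => (negInv (W (1 - t))).1) = fun t => -((W (1 + -1 * t))⁻¹).1 := by
    funext t
    rw [coe_negInv, show 1 - t = 1 + -1 * t by ring]
  rw [he]
  refine ⟨(hW.1.sp_inv.comp_affine hm).neg, fun t ht => ?_⟩
  obtain ⟨X, hX, hv⟩ := hW.2 _ (hm ht)
  set V := W (1 + -1 * t) with hV
  have h1 := (hv.of_mul_eq_one (hm ht) hW.1.sp_inv fun r _ => coe_mul_coe_inv (W r)).comp_affine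
    hm
  have hc := conj_mem_openCone V⁻¹ hX
  refine ⟨_, hc, ?_⟩
  convert h1.neg using 1
  have h2 : 1 - t = 1 + -1 * t := by ring
  rw [h2, coe_negInv, ← hV, inv_inv]
  simp only [neg_smul, one_smul, neg_neg]
  rw [← mul_assoc, ← mul_assoc, neg_mul, neg_mul, neg_mul, coe_inv_mul_coe, ← mul_assoc,
    coe_inv_mul_coe]

/-- Straight lines in the Cayley chart pointing into the open cone are timelike. -/
lemma isTangentCurve_icaySp {A B : Mat n} (hA : A ∈ lieSp n)
    (hA' : ∀ u, 0 ≤ omega u (A *ᵥ u)) (hB : B ∈ openCone n) :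
    IsTangentCurve (openCone n) fun t => icaySp (A + t • B) := by
  have hmem : ∀ t ∈ Set.Icc (0 : ℝ) 1, A + t • B ∈ lieSp n ∧ (1 - (A + t • B)).det ≠ 0 := by
    intro t ht
    have h1 := add_mem_lieSp hA (smul_mem_lieSp t hB.1)
    refine ⟨h1, det_one_sub_ne_zero h1 fun u => ?_⟩
    rw [Matrix.add_mulVec, omega_add_right, Matrix.smul_mulVec, omega_smul_right]
    exact add_nonneg (hA' u) (mul_nonneg ht.1 (openCone_nonneg hB u))
  have hs : MSmooth (fun t : ℝ => A + t • B) (Set.Icc 0 1) := by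
    intro i j
    simp only [Matrix.add_apply, Matrix.smul_apply, smul_eq_mul]
    fun_prop
  have hv : ∀ t, HasVel (fun t : ℝ => A + t • B) B (Set.Icc 0 1) t := by
    intro t i j
    simpa using ((hasDerivWithinAt_id t (Set.Icc 0 1)).mul_const (B i j)).const_add (A i j)
  have hs1 := (msmooth_const 1 _).sub hs
  have hs2 := hs1.inv fun t ht => (hmem t ht).2
  have hmul : ∀ t ∈ Set.Icc (0 : ℝ) 1, (1 - (A + t • B)) * (1 - (A + t • B))⁻¹ = 1 :=
    fun t ht => Matrix.mul_nonsing_inv _ (hmem t ht).2.isUnit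
  have he : ∀ t ∈ Set.Icc (0 : ℝ) 1, (icaySp (A + t • B)).1
      = (1 - (A + t • B))⁻¹ + (1 - (A + t • B))⁻¹ - 1 := by
    intro t ht
    rw [coe_icaySp (hmem t ht).1 (hmem t ht).2, icay_eq (hmem t ht).2, two_smul]
  rw [isTangentCurve_iff]
  refine ⟨((hs2.add hs2).sub (msmooth_const 1 _)).congr he, fun t ht => ?_⟩
  have hM := ((hasVel_const 1 _ t).sub (hv t)).of_mul_eq_one ht hs2 hmul
  have hW := ((hM.add hM).sub (hasVel_const 1 _ t)).congr he ht
  set C := A + t • B with hC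
  set M := (1 - C)⁻¹ with hMdef
  set W := icaySp C with hWdef
  have hC1 : C ∈ lieSp n := (hmem t ht).1
  have hdet : (1 - C).det ≠ 0 := (hmem t ht).2
  have hMmul : ∀ a, M *ᵥ ((1 - C) *ᵥ a) = a := fun a => by
    rw [Matrix.mulVec_mulVec, Matrix.nonsing_inv_mul _ hdet.isUnit, Matrix.one_mulVec]
  have hWmul : ∀ a, W.1 *ᵥ ((1 - C) *ᵥ a) = (1 + C) *ᵥ a := fun a => by
    rw [hWdef, coe_icaySp hC1 hdet, icay_mulVec hdet]
  -- In the variable `a`, the velocity has the quadratic form `2 ω(a, Ba)`.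
  have key : ∀ a b, omega ((1 - C) *ᵥ a) (((W⁻¹).1 * (M * B * M + M * B * M)) *ᵥ ((1 - C) *ᵥ b))
      = 2 * omega a (B *ᵥ b) := by
    intro a b
    rw [← Matrix.mulVec_mulVec, omega_inv_mulVec, hWmul, Matrix.add_mulVec (M * B * M), omega_add_right,
      ← Matrix.mulVec_mulVec, ← Matrix.mulVec_mulVec, hMmul]
    obtain ⟨c, hc⟩ := exists_mulVec_eq hdet (B *ᵥ b)
    rw [← hc, hMmul]
    simp only [Matrix.add_mulVec, Matrix.sub_mulVec, Matrix.one_mulVec, omega_add_left,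
      omega_sub_right, lieSp_antisymm hC1]
    ring
  refine ⟨(W⁻¹).1 * (M * B * M + M * B * M), ⟨fun v w => ?_, fun v hv0 => ?_⟩, ?_⟩
  · obtain ⟨a, rfl⟩ := exists_mulVec_eq hdet v
    obtain ⟨b, rfl⟩ := exists_mulVec_eq hdet w
    rw [key, key, hB.1]
  · obtain ⟨a, rfl⟩ := exists_mulVec_eq hdet v
    rw [key]
    have : a ≠ 0 := by rintro rfl; simp at hv0
    linarith [hB.2 a this]
  · convert hW using 1
    rw [← mul_assoc, coe_mul_coe_inv]
    simp only [zero_sub, mul_neg, neg_mul, neg_neg, one_mul, sub_zero]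

lemma HasVel.omega {C : ℝ → Mat n} {C' : Mat n} {s : Set ℝ} {t : ℝ} (h : HasVel C C' s t)
    (v w : Vec n) :
    HasDerivWithinAt (fun r => SpCausal.omega v (C r *ᵥ w)) (SpCausal.omega v (C' *ᵥ w)) s t := by
  have h1 : ∀ i, HasDerivWithinAt (fun r => (C r *ᵥ w) i) ((C' *ᵥ w) i) s t := fun i =>
    HasDerivWithinAt.fun_sum (u := Finset.univ) fun j _ => (h i j).mul_const (w j)
  unfold SpCausal.omega
  exact HasDerivWithinAt.fun_sum fun i _ => ((h1 _).const_mul _).sub ((h1 _).const_mul _)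

lemma cay_lt_of_tangent {W : ℝ → Sp n} (hW : IsTangentCurve (openCone n) W)
    (hdet : ∀ t ∈ Set.Icc (0 : ℝ) 1, ((W t).1 + 1).det ≠ 0) {v : Vec n} (hv : v ≠ 0) :
    omega v (cay (W 0).1 *ᵥ v) < omega v (cay (W 1).1 *ᵥ v) := by
  rw [isTangentCurve_iff] at hW
  have hs1 := hW.1.add (msmooth_const 1 _)
  have hs2 := hs1.inv hdet
  have he : ∀ t ∈ Set.Icc (0 : ℝ) 1, cay (W t).1
      = 1 - (((W t).1 + 1)⁻¹ + ((W t).1 + 1)⁻¹) := by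
    intro t ht
    rw [cay_eq (hdet t ht), two_smul]
  have hderiv : ∀ t ∈ Set.Icc (0 : ℝ) 1, ∃ d, 0 < d ∧
      HasDerivWithinAt (fun r => omega v (cay (W r).1 *ᵥ v)) d (Set.Icc 0 1) t := by
    intro t ht
    obtain ⟨X, hX, hXv⟩ := hW.2 t ht
    have hM := (hXv.add (hasVel_const 1 _ t)).of_mul_eq_one ht hs2
      fun r hr => Matrix.mul_nonsing_inv _ (hdet r hr).isUnit
    have hC := (((hasVel_const 1 _ t).sub (hM.add hM)).congr he ht).omega v v
    refine ⟨_, ?_, hC⟩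
    set M := ((W t).1 + 1)⁻¹ with hMdef
    obtain ⟨a, rfl⟩ := exists_mulVec_eq (hdet t ht) v
    have hMmul : ∀ a, M *ᵥ (((W t).1 + 1) *ᵥ a) = a := fun a => by
      rw [Matrix.mulVec_mulVec, Matrix.nonsing_inv_mul _ (hdet t ht).isUnit, Matrix.one_mulVec]
    obtain ⟨b, hb⟩ := exists_mulVec_eq (hdet t ht) ((W t).1 *ᵥ (X *ᵥ a))
    have hval : omega (((W t).1 + 1) *ᵥ a)
        ((M * ((W t).1 * X) * M) *ᵥ (((W t).1 + 1) *ᵥ a)) = omega a (X *ᵥ a) := by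
      rw [← Matrix.mulVec_mulVec, hMmul, ← Matrix.mulVec_mulVec, ← Matrix.mulVec_mulVec, ← hb,
        hMmul, ← omega_mulVec (W t) a (X *ᵥ a), ← hb]
      simp only [Matrix.add_mulVec, Matrix.one_mulVec, omega_add_left, omega_add_right,
        omega_mulVec]
      ring
    simp only [add_zero, zero_sub, neg_add_rev, neg_neg, Matrix.add_mulVec, omega_add_right] at *
    have ha : a ≠ 0 := by rintro rfl; simp at hv
    have := hX.2 a ha
    linarith
  choose! d hd hd' using hderiv
  have hmono : StrictMonoOn (fun r => omega v (cay (W r).1 *ᵥ v)) (Set.Icc 0 1) := by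
    refine strictMonoOn_of_hasDerivWithinAt_pos (f' := d) (convex_Icc 0 1)
      (fun t ht => (hd' t ht).continuousWithinAt) ?_ ?_
    · intro t ht
      exact (hd' t (interior_subset ht)).mono interior_subset
    · intro t ht
      exact hd t (interior_subset ht)
  exact hmono (by simp) (by simp) zero_lt_one

/-- The Cayley transform is strictly increasing along timelike curves, as long as `-1` is not an
eigenvalue. -/
lemma cay_lt {W : ℝ → Sp n} (hW : IsTangentCurve (openCone n) W) (g : Sp n) {r s : ℝ}
    (hr : 0 ≤ r) (hrs : r < s) (hs : s ≤ 1)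
    (hdet : ∀ t ∈ Set.Icc r s, ((W t * g).1 + 1).det ≠ 0) {v : Vec n} (hv : v ≠ 0) :
    omega v (cay (W r * g).1 *ᵥ v) < omega v (cay (W s * g).1 *ᵥ v) := by
  have := cay_lt_of_tangent ((hW.affine hr hrs hs).mul_const g) (fun t ht => hdet _ ?_) hv
  · simpa using this
  · constructor <;> nlinarith [ht.1, ht.2]

lemma cay_step_mem {W : ℝ → Sp n} (hW : IsTangentCurve (openCone n) W) {r s : ℝ}
    (hr : 0 ≤ r) (hrs : r < s) (hs : s ≤ 1)
    (hdet : ∀ t ∈ Set.Icc r s, ((W t * (W r)⁻¹).1 + 1).det ≠ 0) :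
    cay (W s * (W r)⁻¹).1 ∈ openCone n := by
  refine ⟨cay_mem_lieSp _ (hdet s ⟨hrs.le, le_rfl⟩), fun u hu => ?_⟩
  have := cay_lt hW _ hr hrs hs hdet hu
  rw [mul_inv_cancel, Submonoid.coe_one, cay_one, Matrix.zero_mulVec, omega_zero_right] at this
  exact this

end

/-! ### The positively elliptic region -/

section

variable {n : ℕ}

/-- The extension of `ω` to `ℂ²ⁿ`, linear in the first and conjugate linear in the second
variable. -/
def omegaC (v w : Fin n ⊕ Fin n → ℂ) : ℂ :=
  ∑ i, (v (Sum.inl i) * (starRingEnd ℂ) (w (Sum.inr i)) -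
    v (Sum.inr i) * (starRingEnd ℂ) (w (Sum.inl i)))

lemma krein_re (v w : Fin n ⊕ Fin n → ℂ) : (krein v w).re = (omegaC v w).im := by
  simp [krein, omegaC, Complex.mul_re]

lemma omegaC_add_left (u v w : Fin n ⊕ Fin n → ℂ) :
    omegaC (u + v) w = omegaC u w + omegaC v w := by
  simp only [omegaC, Pi.add_apply, ← Finset.sum_add_distrib]
  exact Finset.sum_congr rfl fun i _ => by ring

lemma omegaC_add_right (u v w : Fin n ⊕ Fin n → ℂ) :
    omegaC u (v + w) = omegaC u v + omegaC u w := by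
  simp only [omegaC, Pi.add_apply, ← Finset.sum_add_distrib, map_add]
  exact Finset.sum_congr rfl fun i _ => by ring

lemma omegaC_smul_left (c : ℂ) (v w : Fin n ⊕ Fin n → ℂ) :
    omegaC (c • v) w = c * omegaC v w := by
  simp only [omegaC, Pi.smul_apply, smul_eq_mul, Finset.mul_sum]
  exact Finset.sum_congr rfl fun i _ => by ring

lemma omegaC_smul_right (c : ℂ) (v w : Fin n ⊕ Fin n → ℂ) :
    omegaC v (c • w) = (starRingEnd ℂ) c * omegaC v w := by
  simp only [omegaC, Pi.smul_apply, smul_eq_mul, Finset.mul_sum, map_mul]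
  exact Finset.sum_congr rfl fun i _ => by ring

lemma omegaC_sum_left {ι : Type*} (s : Finset ι) (f : ι → Fin n ⊕ Fin n → ℂ)
    (w : Fin n ⊕ Fin n → ℂ) : omegaC (∑ k ∈ s, f k) w = ∑ k ∈ s, omegaC (f k) w :=
  map_sum (AddMonoidHom.mk' (fun v => omegaC v w) fun u v => omegaC_add_left u v w) f s

lemma omegaC_sum_right {ι : Type*} (s : Finset ι) (f : ι → Fin n ⊕ Fin n → ℂ)
    (v : Fin n ⊕ Fin n → ℂ) : omegaC v (∑ k ∈ s, f k) = ∑ k ∈ s, omegaC v (f k) :=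
  map_sum (AddMonoidHom.mk' (fun w => omegaC v w) fun u w => omegaC_add_right v u w) f s

lemma omegaC_swap (v w : Fin n ⊕ Fin n → ℂ) : omegaC v w = -(starRingEnd ℂ) (omegaC w v) := by
  simp only [omegaC, map_sum, map_sub, map_mul, Complex.conj_conj, ← Finset.sum_neg_distrib]
  exact Finset.sum_congr rfl fun i _ => by ring

lemma omegaC_self_re (v : Fin n ⊕ Fin n → ℂ) : (omegaC v v).re = 0 := by
  have := congrArg Complex.re (omegaC_swap v v)
  simp only [Complex.neg_re, Complex.conj_re] at this
  linarith

lemma omegaC_star (v w : Fin n ⊕ Fin n → ℂ) :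
    omegaC (star v) (star w) = (starRingEnd ℂ) (omegaC v w) := by
  simp [omegaC, map_sum]

lemma omegaC_re (v w : Fin n ⊕ Fin n → ℂ) :
    (omegaC v w).re = omega (fun i => (v i).re) (fun i => (w i).re)
      + omega (fun i => (v i).im) (fun i => (w i).im) := by
  simp only [omegaC, omega, Complex.re_sum, ← Finset.sum_add_distrib]
  refine Finset.sum_congr rfl fun i _ => ?_
  simp [Complex.mul_re]
  ring

lemma complexify_apply (W : Sp n) (v : Fin n ⊕ Fin n → ℂ) (i : Fin n ⊕ Fin n) :
    complexify W v i = ∑ j, (W.1 i j : ℂ) * v j := by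
  simp [complexify, Matrix.mulVec, dotProduct]

lemma complexify_re (W : Sp n) (v : Fin n ⊕ Fin n → ℂ) :
    (fun i => (complexify W v i).re) = W.1 *ᵥ fun i => (v i).re := by
  funext i
  simp [complexify_apply, Matrix.mulVec, dotProduct, Complex.re_sum]

lemma complexify_im (W : Sp n) (v : Fin n ⊕ Fin n → ℂ) :
    (fun i => (complexify W v i).im) = W.1 *ᵥ fun i => (v i).im := by
  funext i
  simp [complexify_apply, Matrix.mulVec, dotProduct, Complex.im_sum]

lemma complexify_star (W : Sp n) (v : Fin n ⊕ Fin n → ℂ) :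
    complexify W (star v) = star (complexify W v) := by
  funext i
  simp [complexify_apply]

lemma omegaC_complexify (W : Sp n) (v w : Fin n ⊕ Fin n → ℂ) :
    omegaC (complexify W v) (complexify W w) = omegaC v w := by
  have hre : ∀ v w : Fin n ⊕ Fin n → ℂ,
      (omegaC (complexify W v) (complexify W w)).re = (omegaC v w).re := by
    intro v w
    rw [omegaC_re, omegaC_re, complexify_re, complexify_re, complexify_im, complexify_im,
      omega_mulVec, omega_mulVec]
  refine Complex.ext (hre v w) ?_
  have h := hre (Complex.I • v) w
  rw [map_smul, omegaC_smul_left, omegaC_smul_left] at h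
  simpa using h

lemma omegaC_re_complexify_pos {W : Sp n} (hW : Pos W.1) {v : Fin n ⊕ Fin n → ℂ} (hv : v ≠ 0) :
    0 < (omegaC v (complexify W v)).re := by
  rw [omegaC_re, complexify_re, complexify_im]
  have h0 : ∀ u : Vec n, 0 ≤ omega u (W.1 *ᵥ u) := by
    intro u
    by_cases hu : u = 0
    · simp [hu]
    · exact (hW u hu).le
  by_cases ha : (fun i => (v i).re) = 0
  · have hb : (fun i => (v i).im) ≠ 0 := by
      intro hb
      exact hv (funext fun i => Complex.ext (congrFun ha i) (congrFun hb i))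
    linarith [h0 fun i => (v i).re, hW _ hb]
  · linarith [h0 fun i => (v i).im, hW _ ha]

lemma omegaC_re_smul (z : ℂ) (v : Fin n ⊕ Fin n → ℂ) :
    (omegaC v (z • v)).re = z.im * (krein v v).re := by
  rw [omegaC_smul_right, krein_re, Complex.mul_re, omegaC_self_re]
  simp

/-- Eigenvectors of a symplectic matrix whose eigenvalues are not related by `λ μ̄ = 1` are
orthogonal. -/
lemma omegaC_eq_zero {W : Sp n} {v w : Fin n ⊕ Fin n → ℂ} {y z : ℂ}
    (hv : complexify W v = z • v) (hw : complexify W w = y • w)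
    (h : z * (starRingEnd ℂ) y ≠ 1) : omegaC v w = 0 := by
  have h1 := omegaC_complexify W v w
  rw [hv, hw, omegaC_smul_left, omegaC_smul_right, ← mul_assoc] at h1
  by_contra h0
  exact h (mul_right_cancel₀ h0 (by rw [h1, one_mul]))

/-- If the Krein form has no isotropic eigenvectors for the unitary eigenvalue `z`, then the
generalised eigenspace is an eigenspace. -/
lemma complexify_eq_smul_of_mem {W : Sp n} {z : ℂ} (hz : ‖z‖ = 1)
    (hiso : ∀ u, complexify W u = z • u → omegaC u u = 0 → u = 0) {v : Fin n ⊕ Fin n → ℂ}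
    (hv : v ∈ (complexify W).maxGenEigenspace z) : complexify W v = z • v := by
  have hz1 : z * (starRingEnd ℂ) z = 1 := by
    rw [Complex.mul_conj, Complex.normSq_eq_norm_sq, hz]; norm_num
  -- there are no Jordan blocks of size two
  have hsq : ∀ w, (complexify W - z • 1) ((complexify W - z • 1) w) = 0 →
      (complexify W - z • 1) w = 0 := by
    intro w hw
    set u := (complexify W - z • 1) w with hu
    have hu1 : complexify W w = z • w + u := by simp [hu]
    have hu2 : complexify W u = z • u := by
      simpa [sub_eq_zero] using hw
    refine hiso u hu2 ?_
    have h1 := omegaC_complexify W w u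
    rw [hu1, hu2, omegaC_add_left, omegaC_smul_left, omegaC_smul_right, omegaC_smul_right,
      ← mul_assoc, hz1, one_mul, add_eq_left, mul_eq_zero] at h1
    refine h1.resolve_left fun h0 => ?_
    rw [h0, mul_zero] at hz1
    exact zero_ne_one hz1
  rw [Module.End.mem_maxGenEigenspace] at hv
  obtain ⟨k, hk⟩ := hv
  have : ∀ k : ℕ, ((complexify W - z • (1 : Module.End ℂ (Fin n ⊕ Fin n → ℂ))) ^ (k + 1)) v = 0 → (complexify W - z • 1) v = 0 := by
    intro k
    induction k with
    | zero => intro h; simpa using h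
    | succ k ih =>
      intro h
      apply ih
      rw [pow_succ', Module.End.mul_apply]
      apply hsq
      rwa [pow_succ', pow_succ', Module.End.mul_apply, Module.End.mul_apply] at h
  have h := this k (by rw [pow_succ', Module.End.mul_apply, hk, map_zero])
  simpa [sub_eq_zero] using h

lemma ellPos_subset {W : Sp n} (hW : W ∈ ellPos n) : Pos W.1 := by
  -- on every eigenvector `v` with eigenvalue `z`, the sign of the Krein form is that of `Im z`
  have hsign : ∀ (z : ℂ) v, v ≠ 0 → complexify W v = z • v → 0 < z.im * (krein v v).re := by
    have hpos : ∀ (z : ℂ) v, v ≠ 0 → complexify W v = z • v → 0 < z.im → 0 < (krein v v).re := by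
      intro z v hv hvz hz
      have hev : (complexify W).HasEigenvector z v :=
        ⟨Module.End.mem_eigenspace_iff.2 hvz, hv⟩
      have := (hW z (Module.End.hasEigenvalue_of_hasEigenvector hev)).2.2.2.2 hz
      refine this v ?_ hv
      rw [Module.End.mem_maxGenEigenspace]
      exact ⟨1, by simp [hvz]⟩
    intro z v hv hvz
    have hev : (complexify W).HasEigenvector z v :=
      ⟨Module.End.mem_eigenspace_iff.2 hvz, hv⟩
    obtain ⟨h1, h2, h3, -⟩ := hW z (Module.End.hasEigenvalue_of_hasEigenvector hev)
    rcases lt_trichotomy z.im 0 with h | h | h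
    · have h4 := hpos ((starRingEnd ℂ) z) (star v) (by simpa using hv)
        (by rw [complexify_star, hvz]; ext i; simp) (by simpa using h)
      rw [krein_re, omegaC_star, Complex.conj_im, ← krein_re] at h4
      nlinarith
    · exfalso
      have h5 : z.re ^ 2 = 1 := by
        have := Complex.sq_norm z
        rw [h1, Complex.normSq_apply, h] at this
        nlinarith
      rcases sq_eq_one_iff.1 h5 with h6 | h6
      · exact h2 (Complex.ext h6 h)
      · exact h3 (Complex.ext h6 (by simpa using h))
    · exact mul_pos h (hpos z v hv hvz h)
  have hnorm : ∀ (z : ℂ) v, v ≠ 0 → complexify W v = z • v → ‖z‖ = 1 := fun z v hv hvz =>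
    (hW z (Module.End.hasEigenvalue_of_hasEigenvector
      ⟨Module.End.mem_eigenspace_iff.2 hvz, hv⟩)).1
  intro a ha
  set v : Fin n ⊕ Fin n → ℂ := fun i => (a i : ℂ) with hvdef
  have hv : v ≠ 0 := by
    intro h
    refine ha (funext fun i => ?_)
    have := congrFun h i
    simpa [hvdef] using this
  have hre : omega a (W.1 *ᵥ a) = (omegaC v (complexify W v)).re := by
    rw [omegaC_re, complexify_re, complexify_im]
    have h1 : (fun i => (v i).re) = a := by funext i; simp [hvdef]
    have h2 : (fun i => (v i).im) = 0 := by funext i; simp [hvdef]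
    rw [h1, h2]; simp
  have htop : v ∈ ⨆ z, (complexify W).maxGenEigenspace z := by
    rw [Module.End.iSup_maxGenEigenspace_eq_top]; trivial
  obtain ⟨f, hf, hfv⟩ := (Submodule.mem_iSup_iff_exists_finsupp _ _).1 htop
  have hfe : ∀ z, complexify W (f z) = z • f z := by
    intro z
    by_cases hz0 : f z = 0
    · simp [hz0]
    have hev : (complexify W).HasEigenvalue z := by
      refine (Module.End.hasUnifEigenvalue_iff_hasUnifEigenvalue_one (k := ⊤) (by simp)).1 ?_
      intro h
      have := hf z
      rw [Module.End.maxGenEigenspace, h] at this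
      exact hz0 (by simpa using this)
    refine complexify_eq_smul_of_mem (hW z hev).1 (fun u hu h0 => ?_) (hf z)
    by_contra hu0
    have := hsign z u hu0 hu
    rw [krein_re, h0] at this
    simp at this
  have hfv' : v = ∑ z ∈ f.support, f z := hfv.symm
  have hsum : (omegaC v (complexify W v)).re
      = ∑ z ∈ f.support, z.im * (krein (f z) (f z)).re := by
    rw [hfv', map_sum, omegaC_sum_left, Complex.re_sum]
    refine Finset.sum_congr rfl fun z hz => ?_
    rw [omegaC_sum_right, Finset.sum_eq_single z]
    · rw [hfe, omegaC_re_smul]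
    · intro y hy hyz
      rw [hfe, omegaC_smul_right]
      have hy1 := hnorm y (f y) (Finsupp.mem_support_iff.1 hy) (hfe y)
      rw [omegaC_eq_zero (hfe z) (hfe y), mul_zero]
      intro h
      have hyy : y * (starRingEnd ℂ) y = 1 := by
        rw [Complex.mul_conj, Complex.normSq_eq_norm_sq, hy1]; norm_num
      have hy0 : (starRingEnd ℂ) y ≠ 0 := by
        intro h0; rw [h0, mul_zero] at h; exact zero_ne_one h
      exact hyz (mul_right_cancel₀ hy0 (hyy.trans h.symm))
    · intro h; exact absurd hz h
  rw [hre, hsum]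
  refine Finset.sum_pos (fun z hz => hsign z _ (Finsupp.mem_support_iff.1 hz) (hfe z)) ?_
  rw [Finset.nonempty_iff_ne_empty]
  intro h
  rw [h, Finset.sum_empty] at hfv'
  exact hv hfv'

/-- The positively elliptic region is the set of the symplectic matrices `W` for which the
quadratic form `u ↦ ω(u, Wu)` is positive definite. -/
lemma mem_ellPos_iff {W : Sp n} : W ∈ ellPos n ↔ Pos W.1 := by
  refine ⟨ellPos_subset, fun hW z hz => ?_⟩
  have hsign : ∀ v, v ≠ 0 → complexify W v = z • v → 0 < z.im * (krein v v).re := by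
    intro v hv hvz
    have := omegaC_re_complexify_pos hW hv
    rwa [hvz, omegaC_re_smul] at this
  obtain ⟨v, hv⟩ := hz.exists_hasEigenvector
  have hvz := hv.apply_eq_smul
  have him := hsign v hv.2 hvz
  have hz1 : ‖z‖ = 1 := by
    have h1 := omegaC_complexify W v v
    rw [hvz, omegaC_smul_left, omegaC_smul_right, ← mul_assoc, Complex.mul_conj,
      Complex.normSq_eq_norm_sq] at h1
    have h2 : omegaC v v ≠ 0 := by
      intro h0
      rw [krein_re, h0] at him
      simp at him
    have h3 := mul_right_cancel₀ h2 (h1.trans (one_mul _).symm)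
    have h4 : ‖z‖ ^ 2 = 1 := by exact_mod_cast h3
    nlinarith [norm_nonneg z]
  refine ⟨hz1, ?_, ?_, ?_⟩
  · rintro rfl; simp at him
  · rintro rfl; simp at him
  · constructor
    · intro hK
      have hm : v ∈ (complexify W).maxGenEigenspace z := by
        rw [Module.End.mem_maxGenEigenspace]
        exact ⟨1, by simp [hvz]⟩
      exact pos_of_mul_pos_left him (hK v hm hv.2).le
    · intro h u hu hu0
      have hu1 : complexify W u = z • u := by
        refine complexify_eq_smul_of_mem hz1 (fun x hx h0 => ?_) hu
        by_contra hx0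
        have := hsign x hx0 hx
        rw [krein_re, h0] at this
        simp at this
      exact pos_of_mul_pos_right (hsign u hu0 hu1) h.le

end

/-! ### Sections over the positively elliptic region -/

section

variable {n : ℕ} {E : Type*} {p : E → Sp n}

lemma convex_openCone : Convex ℝ (openCone n) := by
  intro A hA B hB a b ha hb hab
  rcases ha.eq_or_lt with rfl | ha
  · have : b = 1 := by linarith
    simpa [this] using hB
  · refine add_comm (a • A) _ ▸ add_mem_openCone (smul_mem_lieSp b hB.1) (fun u => ?_)
      (smul_mem_openCone ha hA)
    rw [Matrix.smul_mulVec, omega_smul_right]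
    exact mul_nonneg hb (openCone_nonneg hB u)

/-- The extension by a constant of a section over the positively elliptic region. -/
def secExt (s : ellPos n → E) (x : E) (W : Sp n) : E :=
  open Classical in if h : W ∈ ellPos n then s ⟨W, h⟩ else x

lemma secExt_of_mem (s : ellPos n → E) (x : E) {W : Sp n} (h : W ∈ ellPos n) :
    secExt s x W = s ⟨W, h⟩ := dif_pos h

/-- The section over the positively elliptic region for the covering `x ↦ -(p x)⁻¹`, with the
same image as the section `s` of `p`. -/
def secNegInv (s : ellPos n → E) (W : ellPos n) : E :=
  s ⟨negInv W, mem_ellPos_iff.2 (pos_negInv _ (mem_ellPos_iff.1 W.2))⟩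

lemma negInv_comp_negInv_comp : negInv ∘ (negInv ∘ p) = p := by
  funext x
  exact negInv_negInv (p x)

lemma proj_secNegInv {s : ellPos n → E} (hps : ∀ W, p (s W) = W) (W : ellPos n) :
    (negInv ∘ p) (secNegInv s W) = W := by
  simp [secNegInv, hps, negInv_negInv]

lemma range_secNegInv (s : ellPos n → E) : Set.range (secNegInv s) = Set.range s := by
  refine Set.Subset.antisymm ?_ ?_
  · rintro _ ⟨W, rfl⟩
    exact ⟨_, rfl⟩
  · rintro _ ⟨W, rfl⟩
    refine ⟨⟨negInv W, mem_ellPos_iff.2 (pos_negInv _ (mem_ellPos_iff.1 W.2))⟩, ?_⟩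
    simp [secNegInv, negInv_negInv]

lemma pos_of_mem_range {s : ellPos n → E} (hps : ∀ W, p (s W) = W) {x : E}
    (hx : x ∈ Set.range s) : Pos (p x).1 := by
  obtain ⟨W, rfl⟩ := hx
  rw [hps]
  exact mem_ellPos_iff.1 W.2

lemma eq_of_mem_range {s : ellPos n → E} (hps : ∀ W, p (s W) = W) {x : E}
    (hx : x ∈ Set.range s) (h : p x ∈ ellPos n) : x = s ⟨p x, h⟩ := by
  obtain ⟨W, rfl⟩ := hx
  congr 1
  exact Subtype.ext (hps W).symm

variable [TopologicalSpace E]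

/-! ### The chronological relation on a covering -/

lemma IsTimelikeCurve.affine {γ : ℝ → E} (hγ : IsTimelikeCurve p γ) {r s : ℝ} (hr : 0 ≤ r)
    (hrs : r < s) (hs : s ≤ 1) : IsTimelikeCurve p fun t => γ (r + (s - r) * t) :=
  ⟨hγ.1.comp (by fun_prop) (mapsTo_affine hr hrs.le hs), hγ.2.affine hr hrs hs⟩

lemma IsTimelikeCurve.chron {γ : ℝ → E} (hγ : IsTimelikeCurve p γ) {r s : ℝ} (hr : 0 ≤ r)
    (hrs : r < s) (hs : s ≤ 1) : γ s ∈ chronFuture p (γ r) :=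
  ⟨_, hγ.affine hr hrs hs, by simp, by simp⟩

lemma IsTimelikeCurve.continuousOn_proj {γ : ℝ → E} (hγ : IsTimelikeCurve p γ) :
    ContinuousOn (fun t => p (γ t)) (Set.Icc 0 1) := by
  rw [Topology.IsInducing.subtypeVal.continuousOn_iff]
  exact (isTangentCurve_iff.1 hγ.2).1.continuousOn

lemma IsTimelikeCurve.reverse {γ : ℝ → E} (hγ : IsTimelikeCurve p γ) :
    IsTimelikeCurve (negInv ∘ p) fun t => γ (1 - t) := by
  refine ⟨hγ.1.comp (by fun_prop) ?_, hγ.2.negInv_reverse⟩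
  intro t ht
  constructor <;> linarith [ht.1, ht.2]

/-- Passing from `p` to `x ↦ -(p x)⁻¹` reverses the chronological relation. -/
lemma mem_chronFuture_negInv {a b : E} :
    a ∈ chronFuture (negInv ∘ p) b ↔ b ∈ chronFuture p a := by
  have key : ∀ (q : E → Sp n) (a b : E), b ∈ chronFuture q a →
      a ∈ chronFuture (negInv ∘ q) b := by
    rintro q a b ⟨γ, hγ, h0, h1⟩
    exact ⟨_, hγ.reverse, by simpa using h1, by simpa using h0⟩
  refine ⟨fun h => ?_, key p a b⟩
  have := key _ _ _ h
  rwa [negInv_comp_negInv_comp] at this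

lemma IsTimelikeCurve.isCausalCurve (hn : 0 < n) {γ : ℝ → E} (hγ : IsTimelikeCurve p γ) :
    IsCausalCurve p γ :=
  ⟨hγ.1, hγ.2.1, fun t ht => by
    obtain ⟨X, hX, h⟩ := hγ.2.2 t ht
    exact ⟨X, openCone_subset_cone hn hX, h⟩⟩

/-- The lift of the left multiplication by a path `g` that starts at `1`: the isotopy `T` of the
covering space with `T 0 = id` that covers `W ↦ g(t) W`. -/
lemma exists_translation (hp : IsCoveringMap p) {g : ℝ → Sp n}
    (hg : ContinuousOn g (Set.Icc 0 1)) (hg0 : g 0 = 1) :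
    ∃ T : ℝ → E → E, Continuous (fun q : ℝ × E => T q.1 q.2) ∧ (∀ b, T 0 b = b) ∧
      ∀ t ∈ Set.Icc (0 : ℝ) 1, ∀ b, p (T t b) = g t * p b := by
  let H : C(unitInterval × E, Sp n) := ⟨fun q => g q.1 * p q.2, by
    have h1 : Continuous fun t : unitInterval => g t := by
      simpa [Set.domRestrict_def] using continuousOn_iff_continuous_domRestrict.1 hg
    exact (h1.comp continuous_fst).mul (hp.continuous.comp continuous_snd)⟩
  have H0 : ∀ a, H (0, a) = p (ContinuousMap.id E a) := fun a => by
    show g ((0 : unitInterval) : ℝ) * p a = p a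
    rw [Set.Icc.coe_zero, hg0, one_mul]
  refine ⟨fun t b => hp.liftHomotopy H (ContinuousMap.id E) H0
    (Set.projIcc 0 1 zero_le_one t, b), ?_, fun b => ?_, fun t ht b => ?_⟩
  · exact (hp.liftHomotopy H (ContinuousMap.id E) H0).continuous.comp
      ((continuous_projIcc.comp continuous_fst).prodMk continuous_snd)
  · have : Set.projIcc (0 : ℝ) 1 zero_le_one 0 = 0 := Set.projIcc_left _
    simp only [this]
    exact hp.liftHomotopy_zero H _ H0 b
  · have := congrFun (hp.liftHomotopy_lifts H _ H0) (Set.projIcc 0 1 zero_le_one t, b)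
    refine this.trans ?_
    show g ((Set.projIcc (0 : ℝ) 1 zero_le_one t : unitInterval) : ℝ) * p b = _
    rw [Set.projIcc_of_mem _ ht]

/-- Uniqueness of lifts of curves. -/
lemma eqOn_Icc_of_proj_eq (hp : IsCoveringMap p) {γ δ : ℝ → E}
    (hγ : ContinuousOn γ (Set.Icc 0 1)) (hδ : ContinuousOn δ (Set.Icc 0 1))
    (h : ∀ t ∈ Set.Icc (0 : ℝ) 1, p (γ t) = p (δ t)) {r : ℝ} (hr : r ∈ Set.Icc (0 : ℝ) 1)
    (hrr : γ r = δ r) : Set.EqOn γ δ (Set.Icc 0 1) :=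
  hp.eqOn_of_comp_eqOn isPreconnected_Icc hγ hδ h hr hrr

/-- The chronological relation is transitive: the lift of `t ↦ W₂(t) W_b⁻¹ W₁(t)` joins the end
points of the concatenation of the curves that lie over `W₁` and `W₂`. -/
lemma chronFuture_trans (hp : IsCoveringMap p) {a b c : E} (hab : b ∈ chronFuture p a)
    (hbc : c ∈ chronFuture p b) : c ∈ chronFuture p a := by
  obtain ⟨γ₁, h₁, h₁0, h₁1⟩ := hab
  obtain ⟨γ₂, h₂, h₂0, h₂1⟩ := hbc
  obtain ⟨T, hT, hT0, hTp⟩ := exists_translation hp (g := fun t => p (γ₂ t) * (p b)⁻¹)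
    (h₂.continuousOn_proj.mul continuousOn_const) (by simp [h₂0])
  have hTb : Set.EqOn (fun t => T t b) γ₂ (Set.Icc 0 1) := by
    refine eqOn_Icc_of_proj_eq hp (hT.comp (by fun_prop : Continuous fun t => (t, b))).continuousOn
      h₂.1 (fun t ht => ?_) (r := 0) (by simp) (by rw [hT0, h₂0])
    rw [hTp t ht, inv_mul_cancel_right]
  refine ⟨fun t => T t (γ₁ t), ⟨?_, ?_⟩, ?_, ?_⟩
  · exact hT.comp_continuousOn (continuousOn_id.prodMk h₁.1)
  · exact (h₂.2.mul_mul (p b)⁻¹ h₁.2).congr fun t ht => hTp t ht _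
  · exact (hT0 _).trans h₁0
  · show T 1 (γ₁ 1) = c
    rw [h₁1, ← h₂1]
    exact hTb (by simp)

/-! ### Lifts of the positively elliptic region -/

instance : LocallyConvexSpace ℝ (Mat n) :=
  inferInstanceAs (LocallyConvexSpace ℝ (Fin n ⊕ Fin n → Fin n ⊕ Fin n → ℝ))

lemma continuousOn_secExt {s : ellPos n → E} (hs : Continuous s) (x : E) :
    ContinuousOn (secExt s x) (ellPos n) := by
  rw [continuousOn_iff_continuous_domRestrict]
  convert hs using 1
  funext W
  exact secExt_of_mem s x W.2

lemma continuous_secNegInv {s : ellPos n → E} (hs : Continuous s) : Continuous (secNegInv s) :=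
  hs.comp (Continuous.subtype_mk (continuous_negInv.comp continuous_subtype_val) _)

lemma isCoveringMap_negInv (hp : IsCoveringMap p) : IsCoveringMap (negInv ∘ p) :=
  hp.homeomorph_comp negInvHomeo

lemma nonneg_of_mem_closure {s : ellPos n → E} (hp : IsCoveringMap p)
    (hps : ∀ W, p (s W) = W) {x : E} (hx : x ∈ closure (Set.range s)) (u : Vec n) :
    0 ≤ omega u ((p x).1 *ᵥ u) := by
  have hc : IsClosed {y : E | 0 ≤ omega u ((p y).1 *ᵥ u)} := by
    refine isClosed_le continuous_const (continuous_omega continuous_const ?_)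
    exact (continuous_subtype_val.comp hp.continuous).matrix_mulVec continuous_const
  refine closure_minimal ?_ hc hx
  intro y hy
  by_cases hu : u = 0
  · simp [hu]
  · exact (pos_of_mem_range hps hy u hu).le

lemma cay_nonneg_of_mem_closure {s : ellPos n → E} (hp : IsCoveringMap p)
    (hps : ∀ W, p (s W) = W) {x : E} (hx : x ∈ closure (Set.range s))
    (hdet : ((p x).1 + 1).det ≠ 0) (u : Vec n) : 0 ≤ omega u (cay (p x).1 *ᵥ u) := by
  obtain ⟨a, rfl⟩ := exists_mulVec_eq hdet u
  rw [omega_cay _ hdet]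
  linarith [nonneg_of_mem_closure hp hps hx a]

/-- Near a point `x` of the closure of a lift at which the Cayley chart is defined, the lift
consists of all points over the positively elliptic region: in the chart, the part of the region
near `p x` is convex, hence connected. -/
lemma exists_nhds_mem_range {s : ellPos n → E} (hp : IsCoveringMap p) (hs : Continuous s)
    (hps : ∀ W, p (s W) = W) {x : E} (hx : x ∈ closure (Set.range s))
    (hdet : ((p x).1 + 1).det ≠ 0) :
    ∃ V ∈ 𝓝 x, ∀ v ∈ V, Pos (p v).1 → v ∈ Set.range s := by
  obtain ⟨φ, hxφ, hφ⟩ := hp.isLocalHomeomorph x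
  set D : Set (Mat n) := {C | C ∈ lieSp n ∧ (1 - C).det ≠ 0} with hD
  have hC0 : cay (p x).1 ∈ D := ⟨cay_mem_lieSp _ hdet, det_one_sub_cay hdet⟩
  have htar : φ.target ∈ 𝓝 (icaySp (cay (p x).1)) := by
    rw [icaySp_cay _ hdet, hφ]
    exact φ.open_target.mem_nhds (φ.map_source hxφ)
  have hpre := continuousOn_icaySp _ hC0 htar
  rw [Filter.mem_map, mem_nhdsWithin_iff_exists_mem_nhds_inter] at hpre
  obtain ⟨U, hU, hUs⟩ := hpre
  obtain ⟨S, hS, hSconv, hSU⟩ :=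
    (locallyConvexSpace_iff_exists_convex_subset ℝ (Mat n)).1 inferInstance _ U hU
  have hcont : ContinuousAt (fun v => cay (p v).1) x :=
    ContinuousAt.comp (f := fun v => (p v).1) (continuousAt_cay hdet)
      (continuous_subtype_val.comp hp.continuous).continuousAt
  have hV : φ.source ∩ (fun v => cay (p v).1) ⁻¹' S ∈ 𝓝 x :=
    Filter.inter_mem (φ.open_source.mem_nhds hxφ) (hcont hS)
  refine ⟨_, hV, ?_⟩
  have hopenD : openCone n ⊆ D := fun C hC => ⟨hC.1, det_one_sub_of_openCone hC⟩
  have hconv : Convex ℝ (S ∩ openCone n) := hSconv.inter convex_openCone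
  set K := icaySp '' (S ∩ openCone n) with hK
  have hKpre : IsPreconnected K := hconv.isPreconnected.image _
    (continuousOn_icaySp.mono fun C hC => hopenD hC.2)
  have hKtar : K ⊆ φ.target := by
    rintro _ ⟨C, hC, rfl⟩
    exact hUs ⟨hSU hC.1, hopenD hC.2⟩
  have hKell : K ⊆ ellPos n := by
    rintro _ ⟨C, hC, rfl⟩
    exact mem_ellPos_iff.2 (pos_icaySp hC.2)
  have hmemK : ∀ v ∈ φ.source ∩ (fun v => cay (p v).1) ⁻¹' S, Pos (p v).1 → p v ∈ K := by
    intro v hv hpos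
    exact ⟨cay (p v).1, ⟨hv.2, cay_mem_openCone _ hpos⟩, icaySp_cay _ hpos.det_add_one⟩
  obtain ⟨v₀, hv₀, hv₀s⟩ := mem_closure_iff_nhds.1 hx _ hV
  have hv₀K := hmemK v₀ hv₀ (pos_of_mem_range hps hv₀s)
  have hsymm : ∀ v ∈ φ.source, φ.symm (p v) = v := fun v hv => by
    rw [hφ]; exact φ.left_inv hv
  have hEq : Set.EqOn φ.symm (secExt s x) K := by
    refine hp.eqOn_of_comp_eqOn hKpre (φ.continuousOn_symm.mono hKtar)
      ((continuousOn_secExt hs x).mono hKell) ?_ hv₀K ?_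
    · intro W hW
      rw [Function.comp_apply, Function.comp_apply, secExt_of_mem _ _ (hKell hW), hps, hφ]
      exact φ.right_inv (hKtar hW)
    · rw [hsymm v₀ hv₀.1, secExt_of_mem _ _ (hKell hv₀K)]
      exact eq_of_mem_range hps hv₀s _
  intro v hv hpos
  have h1 := hEq (hmemK v hv hpos)
  rw [hsymm v hv.1, secExt_of_mem _ _ (hKell (hmemK v hv hpos))] at h1
  exact ⟨_, h1.symm⟩

lemma isOpen_range_section {s : ellPos n → E} (hp : IsCoveringMap p) (hs : Continuous s)
    (hps : ∀ W, p (s W) = W) (hopen : IsOpen {W : Sp n | Pos W.1}) : IsOpen (Set.range s) := by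
  rw [isOpen_iff_mem_nhds]
  intro x hx
  have hpos := pos_of_mem_range hps hx
  obtain ⟨V, hV, hVs⟩ := exists_nhds_mem_range hp hs hps (subset_closure hx) hpos.det_add_one
  filter_upwards [hV, hp.continuous.continuousAt.preimage_mem_nhds (hopen.mem_nhds hpos)]
    with v hv hv' using hVs v hv hv'

/-- A straight line in the Cayley chart that starts at a point `x` of the closure of a lift in a
direction of the open cone lifts to a timelike curve which enters the lift at once. -/
lemma exists_timelike_straight {s : ellPos n → E} (hp : IsCoveringMap p) (hs : Continuous s)
    (hps : ∀ W, p (s W) = W) {x : E} (hx : x ∈ closure (Set.range s))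
    (hdet : ((p x).1 + 1).det ≠ 0) {B : Mat n} (hB : B ∈ openCone n) :
    ∃ γ : ℝ → E, IsTimelikeCurve p γ ∧ γ 0 = x ∧ (∀ t ∈ Set.Ioc (0 : ℝ) 1, γ t ∈ Set.range s) ∧
      ∀ t ∈ Set.Icc (0 : ℝ) 1, p (γ t) = icaySp (cay (p x).1 + t • B) := by
  set A := cay (p x).1 with hA
  have hAl : A ∈ lieSp n := cay_mem_lieSp _ hdet
  have hA0 := cay_nonneg_of_mem_closure hp hps hx hdet
  have htan := isTangentCurve_icaySp hAl hA0 hB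
  set c : ℝ → Sp n := fun t => icaySp (A + t • B) with hc
  have hcc : ContinuousOn c (Set.Icc 0 1) := by
    rw [Topology.IsInducing.subtypeVal.continuousOn_iff]
    exact (isTangentCurve_iff.1 htan).1.continuousOn
  have hcpos : ∀ t, 0 < t → c t ∈ ellPos n := fun t ht => mem_ellPos_iff.2
    (pos_icaySp (add_mem_openCone hAl hA0 (smul_mem_openCone ht hB)))
  have hc0 : c 0 = p x := by simp [hc, hA, icaySp_cay _ hdet]
  set γ : ℝ → E := fun t => if t ≤ 0 then x else secExt s x (c t) with hγ
  have hγpos : ∀ t, (ht : 0 < t) → γ t = s ⟨c t, hcpos t ht⟩ := fun t ht => by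
    simp only [hγ]
    rw [if_neg (not_le.2 ht), secExt_of_mem _ _ (hcpos t ht)]
  have hγ0 : γ 0 = x := by simp [hγ]
  have hγp : ∀ t ∈ Set.Icc (0 : ℝ) 1, p (γ t) = c t := by
    intro t ht
    rcases ht.1.eq_or_lt with rfl | h
    · rw [hγ0, hc0]
    · rw [hγpos t h, hps]
  have hγc : ContinuousOn γ (Set.Icc 0 1) := by
    intro t ht
    rcases ht.1.eq_or_lt with rfl | h
    · -- continuity at the starting point, as `p` is open and the lift is known near `x`
      obtain ⟨V, hV, hVs⟩ := exists_nhds_mem_range hp hs hps hx hdet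
      intro U hU
      rw [hγ0] at hU
      have h1 : p '' (V ∩ U) ∈ 𝓝 (c 0) := by
        rw [hc0]
        exact hp.isOpenMap.image_mem_nhds (Filter.inter_mem hV hU)
      have h2 : Set.Icc (0 : ℝ) 1 ∈ 𝓝[Set.Icc 0 1] 0 := self_mem_nhdsWithin
      rw [Filter.mem_map]
      filter_upwards [hcc 0 ht h1, h2] with t ht1 ht2
      rcases ht2.1.eq_or_lt with rfl | h
      · show γ 0 ∈ U
        rw [hγ0]; exact mem_of_mem_nhds hU
      · obtain ⟨v, hv, hvc⟩ := ht1
        have hvell : p v ∈ ellPos n := by rw [hvc]; exact hcpos t h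
        have h2 := eq_of_mem_range hps (hVs v hv.1 (mem_ellPos_iff.1 hvell)) hvell
        have h3 : γ t = v := by
          rw [hγpos t h, h2]
          congr 1
          exact Subtype.ext hvc.symm
        show γ t ∈ U
        rw [h3]; exact hv.2
    · have h1 : ContinuousWithinAt (fun t => secExt s x (c t)) (Set.Icc 0 1 ∩ Set.Ioi 0) t :=
        ((continuousOn_secExt hs x).comp (hcc.mono Set.inter_subset_left)
          fun r hr => hcpos r hr.2) t ⟨ht, h⟩
      have h2 : ContinuousWithinAt γ (Set.Icc 0 1 ∩ Set.Ioi 0) t := by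
        refine h1.congr (fun r hr => ?_) ?_
        · have hr2 : ¬ r ≤ 0 := not_le.2 (Set.mem_Ioi.1 hr.2)
          simp only [hγ, if_neg hr2]
        · simp only [hγ, if_neg (not_le.2 h)]
      exact (continuousWithinAt_inter (Ioi_mem_nhds h)).1 h2
  exact ⟨γ, ⟨hγc, htan.congr hγp⟩, hγ0, fun t ht => ⟨_, (hγpos t ht.1).symm⟩, hγp⟩

end

/-! ### Topology of the positively elliptic region -/

section

variable {n : ℕ}

lemma isOpen_pos : IsOpen {W : Sp n | Pos W.1} := by
  have h : {W : Sp n | Pos W.1}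
      = {W : Sp n | ∀ u ∈ Metric.sphere (0 : Vec n) 1, 0 < omega u (W.1 *ᵥ u)} := by
    ext W
    refine ⟨fun h u hu => h u ?_, fun h u hu => ?_⟩
    · rintro rfl; simp at hu
    · have hn : ‖u‖ ≠ 0 := norm_ne_zero_iff.2 hu
      have := h (‖u‖⁻¹ • u) (by simp [norm_smul, hn])
      rw [Matrix.mulVec_smul, omega_smul_left, omega_smul_right] at this
      have h2 : 0 < ‖u‖⁻¹ := by positivity
      exact pos_of_mul_pos_right (pos_of_mul_pos_right this h2.le) h2.le
  rw [h, isOpen_iff_mem_nhds]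
  intro W hW
  refine (isCompact_sphere (0 : Vec n) 1).eventually_forall_of_forall_eventually fun u hu => ?_
  have hc : Continuous fun z : Sp n × Vec n => omega z.2 (z.1.1 *ᵥ z.2) :=
    continuous_omega continuous_snd
      ((continuous_subtype_val.comp continuous_fst).matrix_mulVec continuous_snd)
  exact hc.continuousAt.eventually (lt_mem_nhds (hW u hu))

lemma isPreconnected_ellPos : IsPreconnected (ellPos n) := by
  have h : ellPos n = icaySp '' openCone n := by
    ext W
    rw [mem_ellPos_iff]
    refine ⟨fun h => ⟨_, cay_mem_openCone W h, icaySp_cay W h.det_add_one⟩, ?_⟩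
    rintro ⟨C, hC, rfl⟩
    exact pos_icaySp hC
  rw [h]
  exact convex_openCone.isPreconnected.image _
    (continuousOn_icaySp.mono fun C hC => ⟨hC.1, det_one_sub_of_openCone hC⟩)

lemma one_notMem_ellPos (hn : 0 < n) : (1 : Sp n) ∉ ellPos n := by
  rw [mem_ellPos_iff]
  intro h
  have := h (Pi.single (Sum.inl ⟨0, hn⟩) 1) (by simp)
  rw [Submonoid.coe_one, Matrix.one_mulVec, omega_self] at this
  exact lt_irrefl _ this

lemma smul_mem_chart {C : Mat n} (hC : C ∈ openCone n) {t : ℝ} (ht : 0 ≤ t) :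
    t • C ∈ lieSp n ∧ (1 - t • C).det ≠ 0 := by
  have h := smul_mem_lieSp t hC.1
  refine ⟨h, det_one_sub_ne_zero h fun u => ?_⟩
  rw [Matrix.smul_mulVec, omega_smul_right]
  exact mul_nonneg ht (openCone_nonneg hC u)

variable {E : Type*} [TopologicalSpace E] {p : E → Sp n}

/-! ### Existence and uniqueness of the lift and of its end point -/

/-- The section is constructed by lifting the contraction `(t, W) ↦ icay (t cay W)` of the
positively elliptic region to the identity. -/
lemma exists_section (hp : IsCoveringMap p) {e : E} (he : p e = 1) :
    ∃ s : ellPos n → E, Continuous s ∧ (∀ W, p (s W) = W) ∧ e ∈ closure (Set.range s) := by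
  have hpos : ∀ W : ellPos n, cay W.1.1 ∈ openCone n := fun W =>
    cay_mem_openCone _ (mem_ellPos_iff.1 W.2)
  have hHc : Continuous fun q : unitInterval × ellPos n => icaySp (q.1.1 • cay q.2.1.1) := by
    refine continuousOn_icaySp.comp_continuous ?_ fun q => smul_mem_chart (hpos q.2) q.1.2.1
    refine (continuous_subtype_val.comp continuous_fst).smul ?_
    rw [continuous_iff_continuousAt]
    intro q
    exact ContinuousAt.comp (f := fun q : unitInterval × ellPos n => q.2.1.1)
      (continuousAt_cay (mem_ellPos_iff.1 q.2.2).det_add_one) (by fun_prop)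
  let H : C(unitInterval × ellPos n, Sp n) := ⟨_, hHc⟩
  have H0 : ∀ W, H (0, W) = p (ContinuousMap.const (ellPos n) e W) := fun W => by
    show icaySp ((0 : unitInterval).1 • cay W.1.1) = p e
    rw [he]; simp
  set G := hp.liftHomotopy H _ H0 with hG
  have hGp : ∀ t W, p (G (t, W)) = icaySp (t.1 • cay W.1.1) := fun t W =>
    congrFun (hp.liftHomotopy_lifts H _ H0) (t, W)
  have hG0 : ∀ W, G (0, W) = e := fun W => hp.liftHomotopy_zero H _ H0 W
  refine ⟨fun W => G (1, W), by fun_prop, fun W => ?_, ?_⟩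
  · rw [hGp]
    simp [icaySp_cay W.1 (mem_ellPos_iff.1 W.2).det_add_one]
  · -- `t ↦ G (t, W₀)` is a curve in the lift that converges to `e`
    let W₀ : ellPos n := ⟨icaySp (Matrix.J (Fin n) ℝ), mem_ellPos_iff.2 (pos_icaySp
      J_mem_openCone)⟩
    have hW₀ : cay W₀.1.1 = Matrix.J (Fin n) ℝ :=
      cay_icaySp J_mem_openCone.1 (det_one_sub_of_openCone J_mem_openCone)
    have hmem : ∀ t : unitInterval, 0 < t.1 → G (t, W₀) ∈ Set.range fun W => G (1, W) := by
      intro t ht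
      have hJ := smul_mem_openCone ht J_mem_openCone (n := n)
      let W : ellPos n := ⟨icaySp (t.1 • Matrix.J (Fin n) ℝ), mem_ellPos_iff.2 (pos_icaySp hJ)⟩
      have hW : cay W.1.1 = t.1 • Matrix.J (Fin n) ℝ :=
        cay_icaySp hJ.1 (det_one_sub_of_openCone hJ)
      have h := hp.eq_of_comp_eq (g₁ := fun r : unitInterval => G (r, W))
        (g₂ := fun r : unitInterval => G (r * t, W₀)) (by fun_prop) (by fun_prop) (by
          funext r
          simp only [Function.comp_apply, hGp, hW, hW₀]
          rw [smul_smul]; rfl) 0 (by simp only [hG0, zero_mul])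
      refine ⟨W, ?_⟩
      have := congrFun h 1
      simpa using this
    have hcont : Continuous fun t : unitInterval => G (t, W₀) := by fun_prop
    have h2 : (0 : unitInterval) ∈ closure {t : unitInterval | 0 < t.1} := by
      have : (Set.Ioi (0 : unitInterval)) = {t : unitInterval | 0 < t.1} := rfl
      rw [← this, closure_Ioi' ⟨1, by simp⟩]
      exact Set.self_mem_Ici
    have h3 := map_mem_closure hcont h2 (t := Set.range fun W => G (1, W))
      fun t ht => hmem t ht
    rwa [hG0] at h3

lemma section_unique (hp : IsCoveringMap p) {e : E} (he : p e = 1) {s s' : ellPos n → E}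
    (hs : Continuous s) (hps : ∀ W, p (s W) = W) (hes : e ∈ closure (Set.range s))
    (hs' : Continuous s') (hps' : ∀ W, p (s' W) = W) (hes' : e ∈ closure (Set.range s')) :
    s = s' := by
  have hdet : ((p e).1 + 1).det ≠ 0 := by
    rw [he, Submonoid.coe_one, ← two_smul ℝ]
    exact det_two_smul_one
  obtain ⟨V, hV, hVs⟩ := exists_nhds_mem_range hp hs' hps' hes' hdet
  obtain ⟨v, hv, W, rfl⟩ := mem_closure_iff_nhds.1 hes V hV
  have h1 := hVs _ hv (by rw [hps]; exact mem_ellPos_iff.1 W.2)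
  have h2 := eq_of_mem_range hps' h1 (by rw [hps]; exact W.2)
  have : PreconnectedSpace (ellPos n) := Subtype.preconnectedSpace isPreconnected_ellPos
  refine hp.eq_of_comp_eq hs hs' (by funext W; simp [hps, hps']) W ?_
  rw [h2]
  congr 1
  exact Subtype.ext (hps W)

/-- Every lift has a point over the identity in its closure. For the covering `x ↦ -(p x)⁻¹` this
is a point over `-1` for `p`. -/
lemma exists_end_point (hp : IsCoveringMap p) {s : ellPos n → E} (hs : Continuous s)
    (hps : ∀ W, p (s W) = W) : ∃ m, p m = 1 ∧ m ∈ closure (Set.range s) := by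
  have hcmem : ∀ t : ℝ, t < 1 → icaySp ((1 - t) • Matrix.J (Fin n) ℝ) ∈ ellPos n := fun t ht =>
    mem_ellPos_iff.2 (pos_icaySp (smul_mem_openCone (sub_pos.2 ht) J_mem_openCone))
  have hcc : Continuous fun t : unitInterval => icaySp ((1 - t.1) • Matrix.J (Fin n) ℝ) :=
    continuousOn_icaySp.comp_continuous (by fun_prop)
      fun t => smul_mem_chart J_mem_openCone (sub_nonneg.2 t.2.2)
  let c : C(unitInterval, Sp n) := ⟨_, hcc⟩
  obtain ⟨Γ, hΓ, hΓ0⟩ := hp.exists_path_lifts c (s ⟨_, hcmem 0 zero_lt_one⟩) (by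
    rw [hps]; simp [c])
  have hΓp : ∀ t, p (Γ t) = icaySp ((1 - t.1) • Matrix.J (Fin n) ℝ) := fun t => congrFun hΓ t
  refine ⟨Γ 1, by rw [hΓp]; simp, ?_⟩
  have hcell : ∀ t ∈ Set.Iio (1 : unitInterval), c t ∈ ellPos n := fun t ht => hcmem t.1 ht
  have hIio : ∀ t ∈ Set.Iio (1 : unitInterval), Γ t ∈ Set.range s := by
    have h := hp.eqOn_of_comp_eqOn (s := Set.Iio (1 : unitInterval)) isPreconnected_Iio
      (g₁ := Γ) (g₂ := fun t => secExt s (Γ 1) (c t)) Γ.continuous.continuousOn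
      ((continuousOn_secExt hs _).comp c.continuous.continuousOn hcell)
      (fun t ht => by
        rw [Function.comp_apply, Function.comp_apply, secExt_of_mem _ _ (hcell t ht), hps, hΓp]
        rfl) (a := 0) (by simp) (by
        rw [hΓ0]
        exact (secExt_of_mem _ _ (hcell 0 (by simp))).symm)
    intro t ht
    rw [h ht]
    simp only
    rw [secExt_of_mem _ _ (hcell t ht)]
    exact ⟨_, rfl⟩
  have h1 : (1 : unitInterval) ∈ closure (Set.Iio (1 : unitInterval)) := by
    rw [closure_Iio' ⟨0, by simp⟩]
    exact Set.self_mem_Iic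
  exact map_mem_closure Γ.continuous h1 hIio

lemma end_point_unique (hp : IsCoveringMap p) {s : ellPos n → E} (hs : Continuous s)
    (hps : ∀ W, p (s W) = W) {m m' : E} (hm : p m = 1) (hms : m ∈ closure (Set.range s))
    (hm' : p m' = 1) (hms' : m' ∈ closure (Set.range s)) : m = m' := by
  have hdet : ((1 : Sp n).1 + 1).det ≠ 0 := by
    rw [Submonoid.coe_one, ← two_smul ℝ]
    exact det_two_smul_one
  obtain ⟨γ, hγ, hγ0, hγs, hγp⟩ :=
    exists_timelike_straight hp hs hps hms (hm ▸ hdet) J_mem_openCone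
  obtain ⟨δ, hδ, hδ0, hδs, hδp⟩ :=
    exists_timelike_straight hp hs hps hms' (hm' ▸ hdet) J_mem_openCone
  have h1 : (1 : ℝ) ∈ Set.Icc (0 : ℝ) 1 := by simp
  have heq : ∀ t ∈ Set.Icc (0 : ℝ) 1, p (γ t) = p (δ t) := fun t ht => by
    rw [hγp t ht, hδp t ht, hm, hm']
  have hend : γ 1 = δ 1 := by
    have ha := hγs 1 (by simp)
    have hb := hδs 1 (by simp)
    have hc := mem_ellPos_iff.2 (pos_of_mem_range hps ha)
    have hd := mem_ellPos_iff.2 (pos_of_mem_range hps hb)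
    rw [eq_of_mem_range hps ha hc, eq_of_mem_range hps hb hd]
    congr 1
    exact Subtype.ext (heq 1 h1)
  rw [← hγ0, ← hδ0]
  exact eqOn_Icc_of_proj_eq hp hγ.1 hδ.1 heq h1 hend (by simp)

/-! ### Timelike curves and the lift -/

/-- A timelike curve that starts over the identity at a point of the closure of a lift enters
the lift. -/
lemma exists_initial (hp : IsCoveringMap p) {s : ellPos n → E} (hs : Continuous s)
    (hps : ∀ W, p (s W) = W) {γ : ℝ → E} (hγ : IsTimelikeCurve p γ) (h0 : p (γ 0) = 1)
    (hcl : γ 0 ∈ closure (Set.range s)) :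
    ∃ ε, 0 < ε ∧ ε ≤ 1 ∧ ∀ t ∈ Set.Ioc 0 ε, γ t ∈ Set.range s := by
  have hdet : ((p (γ 0)).1 + 1).det ≠ 0 := by
    rw [h0, Submonoid.coe_one, ← two_smul ℝ]
    exact det_two_smul_one
  obtain ⟨V, hV, hVs⟩ := exists_nhds_mem_range hp hs hps hcl hdet
  have h1 : ∀ᶠ t in 𝓝[Set.Icc 0 1] (0 : ℝ), γ t ∈ V ∧ ((p (γ t)).1 + 1).det ≠ 0 := by
    have hγc := hγ.1 0 (by simp)
    have hd : Continuous fun x : E => ((p x).1 + 1).det :=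
      ((continuous_subtype_val.comp hp.continuous).add continuous_const).matrix_det
    exact hγc.eventually
      (Filter.inter_mem hV (hd.continuousAt.eventually (isOpen_ne.mem_nhds hdet)))
  rw [eventually_nhdsWithin_iff, Metric.eventually_nhds_iff] at h1
  obtain ⟨δ, hδ, hδV⟩ := h1
  have hmem : ∀ t ∈ Set.Icc (0 : ℝ) (min (δ / 2) 1), γ t ∈ V ∧ ((p (γ t)).1 + 1).det ≠ 0 := by
    intro t ht
    have h2 : t ≤ δ / 2 := ht.2.trans (min_le_left _ _)
    refine hδV ?_ ⟨ht.1, ht.2.trans (min_le_right _ _)⟩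
    rw [Real.dist_eq, sub_zero, abs_of_nonneg ht.1]
    linarith
  refine ⟨min (δ / 2) 1, by positivity, min_le_right _ _, fun t ht => ?_⟩
  refine hVs _ (hmem t ⟨ht.1.le, ht.2⟩).1 ?_
  rw [pos_iff_cay]
  refine ⟨(hmem t ⟨ht.1.le, ht.2⟩).2, fun u hu => ?_⟩
  have := cay_lt hγ.2 1 le_rfl ht.1 (ht.2.trans (min_le_right _ _)) (fun r hr => by
    rw [mul_one]
    exact (hmem r ⟨hr.1, hr.2.trans ht.2⟩).2) hu
  simpa [h0] using this

/-- Along a timelike curve in the positively elliptic region the Cayley transform increases. In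
this form, without inverse matrices, the inequality extends to the end point of the curve. -/
lemma cay_le_end {W : ℝ → Sp n} (hW : IsTangentCurve (openCone n) W) {r s : ℝ}
    (hr : 0 ≤ r) (hrs : r < s) (hs : s ≤ 1) (hpos : ∀ t ∈ Set.Ico r s, Pos (W t).1) (a : Vec n) :
    omega (((W s).1 + 1) *ᵥ a) (cay (W r).1 *ᵥ (((W s).1 + 1) *ᵥ a))
      ≤ 2 * omega a ((W s).1 *ᵥ a) := by
  have hWc : ContinuousOn (fun t => (W t).1) (Set.Icc 0 1) :=
    (isTangentCurve_iff.1 hW).1.continuousOn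
  have hle : ∀ t ∈ Set.Ioo r s, omega (((W t).1 + 1) *ᵥ a)
      (cay (W r).1 *ᵥ (((W t).1 + 1) *ᵥ a)) ≤ 2 * omega a ((W t).1 *ᵥ a) := by
    intro t ht
    have hdet : ∀ t ∈ Set.Ico r s, ((W t).1 + 1).det ≠ 0 := fun t ht => (hpos t ht).det_add_one
    rw [← omega_cay _ (hdet t ⟨ht.1.le, ht.2⟩)]
    by_cases h0 : ((W t).1 + 1) *ᵥ a = 0
    · simp [h0]
    · have := cay_lt hW 1 hr ht.1 (ht.2.le.trans hs)
        (fun q hq => by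
          rw [mul_one]; exact hdet q ⟨hq.1, hq.2.trans_lt ht.2⟩) h0
      simpa using this.le
  have hF : Continuous fun M : Mat n =>
      omega ((M + 1) *ᵥ a) (cay (W r).1 *ᵥ ((M + 1) *ᵥ a)) := by
    have h1 : Continuous fun M : Mat n => (M + 1) *ᵥ a :=
      (continuous_id.add continuous_const).matrix_mulVec continuous_const
    exact continuous_omega h1 (continuous_const.matrix_mulVec h1)
  have hG : Continuous fun M : Mat n => 2 * omega a (M *ᵥ a) :=
    continuous_const.mul (continuous_omega continuous_const
      (continuous_id.matrix_mulVec continuous_const))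
  have hlim : Filter.Tendsto (fun t => (W t).1) (𝓝[Set.Ioo r s] s) (𝓝 (W s).1) :=
    (hWc s ⟨(hr.trans hrs.le), hs⟩).mono fun t ht => ⟨hr.trans ht.1.le, ht.2.le.trans hs⟩
  have : (𝓝[Set.Ioo r s] s).NeBot := right_nhdsWithin_Ioo_neBot hrs
  refine le_of_tendsto_of_tendsto ((hF.tendsto _).comp hlim) ((hG.tendsto _).comp hlim) ?_
  filter_upwards [self_mem_nhdsWithin] with t ht using hle t ht

/-- A timelike curve that leaves a lift does so through a point at which `-1` is an eigenvalue,
but `1` is not. -/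
lemma exists_exit (hp : IsCoveringMap p) {s : ellPos n → E} (hs : Continuous s)
    (hps : ∀ W, p (s W) = W) {e b : E} (he : p e = 1) (hcl : e ∈ closure (Set.range s))
    (hb : b ∈ chronFuture p e) (hbs : b ∉ Set.range s) :
    ∃ x, x ∈ chronFuture p e ∧ (x = b ∨ b ∈ chronFuture p x) ∧ x ∈ closure (Set.range s) ∧
      ((p x).1 + 1).det = 0 ∧ ∀ u, (p x).1 *ᵥ u = u → u = 0 := by
  obtain ⟨γ, hγ, h0, h1⟩ := hb
  obtain ⟨ε, hε, hε1, hεs⟩ := exists_initial hp hs hps hγ (by rw [h0, he]) (by rwa [h0])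
  have hopen := isOpen_range_section hp hs hps isOpen_pos
  have hcont : ContinuousOn γ (Set.Icc ε 1) := hγ.1.mono (Set.Icc_subset_Icc_left hε.le)
  have hcpt : IsCompact (Set.Icc ε 1 ∩ γ ⁻¹' (Set.range s)ᶜ) :=
    isCompact_Icc.of_isClosed_subset
      (hcont.preimage_isClosed_of_isClosed isClosed_Icc hopen.isClosed_compl)
      Set.inter_subset_left
  obtain ⟨T, ⟨⟨hεT, hT1⟩, hTs⟩, hTle⟩ := hcpt.exists_isLeast ⟨1, ⟨hε1, le_rfl⟩, by
    rw [Set.mem_preimage, h1]; exact hbs⟩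
  have hεT' : ε < T := lt_of_le_of_ne hεT fun h => hTs (h ▸ hεs ε ⟨hε, le_rfl⟩)
  have hbefore : ∀ t ∈ Set.Ico ε T, γ t ∈ Set.range s := by
    intro t ht
    by_contra hts
    exact absurd (hTle ⟨⟨ht.1, ht.2.le.trans hT1⟩, hts⟩) (not_le.2 ht.2)
  have hxcl : γ T ∈ closure (Set.range s) := by
    refine ContinuousWithinAt.mem_closure (s := Set.Ico ε T)
      ((hcont T ⟨hεT, hT1⟩).mono fun t ht => ⟨ht.1, ht.2.le.trans hT1⟩) ?_ hbefore
    rw [closure_Ico hεT'.ne]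
    exact ⟨hεT, le_rfl⟩
  have hineq := cay_le_end hγ.2 hε.le hεT' hT1 fun t ht => pos_of_mem_range hps (hbefore t ht)
  have hB : cay (p (γ ε)).1 ∈ openCone n :=
    cay_mem_openCone _ (pos_of_mem_range hps (hεs ε ⟨hε, le_rfl⟩))
  refine ⟨γ T, h0 ▸ hγ.chron le_rfl (hε.trans hεT') hT1, ?_, hxcl, ?_, fun u hu => ?_⟩
  · rcases hT1.eq_or_lt with rfl | hT1
    · exact Or.inl h1
    · exact Or.inr (h1 ▸ hγ.chron (hε.trans hεT').le hT1 le_rfl)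
  · by_contra hdet
    obtain ⟨V, hV, hVs⟩ := exists_nhds_mem_range hp hs hps hxcl hdet
    refine hTs (hVs _ (mem_of_mem_nhds hV) fun u hu => ?_)
    have h2 : ((p (γ T)).1 + 1) *ᵥ u ≠ 0 := fun h => hu (eq_zero_of_det_ne_zero hdet h)
    linarith [hB.2 _ h2, hineq u]
  · by_contra hu0
    have h2 := hineq u
    rw [hu, omega_self, Matrix.add_mulVec, Matrix.one_mulVec, hu] at h2
    have h3 : u + u ≠ 0 := by
      rw [← two_smul ℝ]; exact smul_ne_zero two_ne_zero hu0
    linarith [hB.2 _ h3]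

end

/-! ### The positive index of inertia in families of quadratic forms -/

section Signature

variable {Z : Type*} [NormedAddCommGroup Z] [NormedSpace ℝ Z] [FiniteDimensional ℝ Z]
  {S : Type*} [TopologicalSpace S]

/-- The positive index of inertia is lower semicontinuous. -/
lemma eventually_sigPos_le {Q : S → QuadraticForm ℝ Z}
    (hQ : Continuous fun q : S × Z => Q q.1 q.2) (s₀ : S) :
    ∀ᶠ s in 𝓝 s₀, sigPos (Q s₀) ≤ sigPos (Q s) := by
  obtain ⟨V, hV, hpos⟩ := exists_finrank_eq_sigPos_and_posDef (Q s₀)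
  have h := (isCompact_sphere (0 : V) 1).eventually_forall_of_forall_eventually (x₀ := s₀)
    (P := fun s v => 0 < Q s v) fun v hv => by
      have hv0 : v ≠ 0 := by rintro rfl; simp at hv
      have hc : Continuous fun q : S × V => Q q.1 (q.2 : Z) :=
        hQ.comp (continuous_fst.prodMk (continuous_subtype_val.comp continuous_snd))
      exact hc.continuousAt.eventually (lt_mem_nhds (hpos v hv0))
  filter_upwards [h] with s hs
  rw [← hV]
  refine le_sigPos_of_posDef _ fun v hv => ?_
  have hn : ‖v‖ ≠ 0 := norm_ne_zero_iff.2 hv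
  have h1 := hs (‖v‖⁻¹ • v) (by
    rw [mem_sphere_zero_iff_norm, norm_smul, norm_inv, norm_norm, inv_mul_cancel₀ hn])
  rw [Submodule.coe_smul, QuadraticMap.map_smul, smul_eq_mul] at h1
  exact pos_of_mul_pos_right h1 (mul_self_nonneg _)

/-- The positive index of inertia is constant in connected families of nondegenerate forms. -/
lemma sigPos_eq_of_nondegenerate [PreconnectedSpace S] {Q : S → QuadraticForm ℝ Z}
    (hQ : Continuous fun q : S × Z => Q q.1 q.2) (hnd : ∀ s, (Q s).radical = ⊥) (s t : S) :
    sigPos (Q s) = sigPos (Q t) := by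
  refine IsLocallyConstant.apply_eq_of_preconnectedSpace (f := fun s => sigPos (Q s))
    ((IsLocallyConstant.iff_eventually_eq _).2 fun s => ?_) s t
  have hneg : Continuous fun q : S × Z => (-Q q.1) q.2 := by
    exact hQ.neg
  have hsum : ∀ s, sigPos (Q s) + sigNeg (Q s) = Module.finrank ℝ Z := fun s => by
    have := QuadraticForm.sigPos_add_sigNeg_add_radical (Q := Q s)
    rwa [hnd, finrank_bot, add_zero] at this
  filter_upwards [eventually_sigPos_le hQ s, eventually_sigPos_le (Q := fun s => -Q s) hneg s] with t h1 h2
  simp only [sigPos_neg] at h2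
  have := hsum s
  have := hsum t
  omega

/-- If `Q₀ ≤ Q₁` and if `Q₁` is positive at a null vector of an intermediate form `Q` that lies in
the radical of `Q`, then the index of `Q₁` exceeds that of `Q₀`. -/
lemma sigPos_lt_of_null_vector {Q₀ Q Q₁ : QuadraticForm ℝ Z} (h₀ : ∀ z, Q₀ z ≤ Q z)
    (h₁ : ∀ z, Q z ≤ Q₁ z) {z : Z} (hz : z ∈ Q.radical) (hz₁ : 0 < Q₁ z) :
    sigPos Q₀ < sigPos Q₁ := by
  obtain ⟨V, hV, hpos⟩ := exists_finrank_eq_sigPos_and_posDef Q₀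
  have hpos' : ∀ v ∈ V, v ≠ 0 → 0 < Q₀ v := fun v hv hv0 =>
    hpos ⟨v, hv⟩ (by simpa using hv0)
  have hzc : ∀ c : ℝ, c • z ∈ Q.radical := fun c => Submodule.smul_mem _ c hz
  have hz0 : z ≠ 0 := by rintro rfl; simp at hz₁
  have hdisj : V ⊓ Submodule.span ℝ {z} = ⊥ := by
    rw [Submodule.eq_bot_iff]
    rintro v ⟨hv, hvz⟩
    obtain ⟨c, rfl⟩ := Submodule.mem_span_singleton.1 hvz
    by_contra hne
    have h2 := ((QuadraticMap.mem_radical_iff').1 (hzc c)).1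
    linarith [hpos' _ hv hne, h₀ (c • z)]
  have hdim := Submodule.finrank_sup_add_finrank_inf_eq V (Submodule.span ℝ {z})
  rw [hdisj, finrank_bot, finrank_span_singleton hz0, hV] at hdim
  have hposdef : (Q₁.restrict (V ⊔ Submodule.span ℝ {z})).PosDef := by
    rintro ⟨x, hx⟩ hx0
    have hx0' : x ≠ 0 := by simpa using hx0
    obtain ⟨v, hv, w, hw, rfl⟩ := Submodule.mem_sup.1 hx
    obtain ⟨c, rfl⟩ := Submodule.mem_span_singleton.1 hw
    show 0 < Q₁ (v + c • z)
    by_cases hv0 : v = 0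
    · subst hv0
      have hc : c ≠ 0 := by rintro rfl; simp at hx0'
      rw [zero_add, QuadraticMap.map_smul, smul_eq_mul]
      exact mul_pos (mul_self_pos.2 hc) hz₁
    · have h2 := ((QuadraticMap.mem_radical_iff').1 (hzc c)).2 v
      rw [add_comm] at h2
      linarith [h₁ (v + c • z), h₀ v, hpos' v hv hv0]
  have := le_sigPos_of_posDef _ hposdef
  omega

end Signature

/-! ### The quadratic form of a discretized path -/

section

variable {n : ℕ}

/-- A tuple `(z₀, …, z_m)` of vectors, extended by the antiperiodic end point `z_{m+1} = -z₀`. -/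
def extend (m : ℕ) (i : ℕ) : (Fin (m + 1) → Vec n) →ₗ[ℝ] Vec n :=
  if h : i < m + 1 then LinearMap.proj ⟨i, h⟩ else -LinearMap.proj 0

lemma extend_of_lt {m i : ℕ} (h : i < m + 1) (z : Fin (m + 1) → Vec n) :
    extend m i z = z ⟨i, h⟩ := by
  rw [extend, dif_pos h]; rfl

lemma extend_zero {m : ℕ} (z : Fin (m + 1) → Vec n) : extend m 0 z = z 0 :=
  extend_of_lt (Nat.succ_pos m) z

lemma extend_last {m : ℕ} (z : Fin (m + 1) → Vec n) : extend m (m + 1) z = -z 0 := by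
  rw [extend, dif_neg (lt_irrefl _)]; rfl

/-- The sums `z_i + z_{i+1}` of consecutive vectors of an antiperiodic sequence. -/
def consecutiveSum (m : ℕ) (i : ℕ) : (Fin (m + 1) → Vec n) →ₗ[ℝ] Vec n :=
  extend m i + extend m (i + 1)

lemma consecutiveSum_apply {m : ℕ} (i : ℕ) (z : Fin (m + 1) → Vec n) :
    consecutiveSum m i z = extend m i z + extend m (i + 1) z := rfl

/-- The symmetric bilinear form on antiperiodic sequences with quadratic form
`∑ᵢ ω(zᵢ + zᵢ₊₁, Cᵢ (zᵢ + zᵢ₊₁)) - 2 ω(zᵢ, zᵢ₊₁)`. Here the `Cᵢ` stand for the Cayley transforms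
of the steps `Wᵢ` of a discretized path of symplectic matrices; the critical points are the
sequences with `zᵢ₊₁ = Wᵢ zᵢ`. -/
def stepBilin (m : ℕ) (C : ℕ → Mat n) (z w : Fin (m + 1) → Vec n) : ℝ :=
  ∑ i ∈ Finset.range (m + 1), (omega (consecutiveSum m i w) (C i *ᵥ consecutiveSum m i z)
    - (omega (extend m i z) (extend m (i + 1) w) + omega (extend m i w) (extend m (i + 1) z)))

lemma stepBilin_add_left (m : ℕ) (C : ℕ → Mat n) (z z' w : Fin (m + 1) → Vec n) :
    stepBilin m C (z + z') w = stepBilin m C z w + stepBilin m C z' w := by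
  simp only [stepBilin, ← Finset.sum_add_distrib, map_add, Matrix.mulVec_add, omega_add_left,
    omega_add_right]
  exact Finset.sum_congr rfl fun i _ => by ring

lemma stepBilin_add_right (m : ℕ) (C : ℕ → Mat n) (z w w' : Fin (m + 1) → Vec n) :
    stepBilin m C z (w + w') = stepBilin m C z w + stepBilin m C z w' := by
  simp only [stepBilin, ← Finset.sum_add_distrib, map_add, omega_add_left, omega_add_right]
  exact Finset.sum_congr rfl fun i _ => by ring

lemma stepBilin_smul_left (m : ℕ) (C : ℕ → Mat n) (c : ℝ) (z w : Fin (m + 1) → Vec n) :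
    stepBilin m C (c • z) w = c * stepBilin m C z w := by
  simp only [stepBilin, Finset.mul_sum, map_smul, Matrix.mulVec_smul, omega_smul_left,
    omega_smul_right]
  exact Finset.sum_congr rfl fun i _ => by ring

lemma stepBilin_smul_right (m : ℕ) (C : ℕ → Mat n) (c : ℝ) (z w : Fin (m + 1) → Vec n) :
    stepBilin m C z (c • w) = c * stepBilin m C z w := by
  simp only [stepBilin, Finset.mul_sum, map_smul, omega_smul_left, omega_smul_right]
  exact Finset.sum_congr rfl fun i _ => by ring

lemma stepBilin_comm {m : ℕ} {C : ℕ → Mat n} (hC : ∀ i < m + 1, C i ∈ lieSp n)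
    (z w : Fin (m + 1) → Vec n) : stepBilin m C z w = stepBilin m C w z := by
  refine Finset.sum_congr rfl fun i hi => ?_
  rw [hC i (Finset.mem_range.1 hi), add_comm (omega (extend m i z) _)]

/-- The quadratic form of `stepBilin`. -/
def stepForm (m : ℕ) (C : ℕ → Mat n) : QuadraticForm ℝ (Fin (m + 1) → Vec n) :=
  LinearMap.BilinMap.toQuadraticMap (LinearMap.mk₂ ℝ (stepBilin m C) (stepBilin_add_left m C)
    (fun c z w => by rw [stepBilin_smul_left, smul_eq_mul]) (stepBilin_add_right m C)
    (fun c z w => by rw [stepBilin_smul_right, smul_eq_mul]))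

lemma stepForm_apply (m : ℕ) (C : ℕ → Mat n) (z : Fin (m + 1) → Vec n) :
    stepForm m C z = stepBilin m C z z := rfl

lemma mem_radical_stepForm {m : ℕ} {C : ℕ → Mat n} (hC : ∀ i < m + 1, C i ∈ lieSp n)
    {z : Fin (m + 1) → Vec n} :
    z ∈ (stepForm m C).radical ↔ ∀ w, stepBilin m C z w = 0 := by
  rw [QuadraticMap.mem_radical_iff']
  simp only [stepForm_apply, stepBilin_add_left, stepBilin_add_right]
  constructor
  · rintro ⟨h1, h2⟩ w
    have := h2 w
    rw [h1, stepBilin_comm hC w z] at this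
    linarith
  · intro h
    refine ⟨h z, fun w => ?_⟩
    rw [h z, h w, stepBilin_comm hC w z, h w]
    ring

/-- Summation by parts, using the antiperiodicity. -/
lemma stepBilin_eq (m : ℕ) (C : ℕ → Mat n) (z w : Fin (m + 1) → Vec n) :
    stepBilin m C z w = ∑ i ∈ Finset.range (m + 1), omega (consecutiveSum m i w)
      (C i *ᵥ consecutiveSum m i z - (extend m (i + 1) z - extend m i z)) := by
  have htel : ∑ i ∈ Finset.range (m + 1), (omega (extend m (i + 1) w) (extend m (i + 1) z)
      - omega (extend m i w) (extend m i z)) = 0 := by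
    rw [Finset.sum_range_sub fun i => omega (extend m i w) (extend m i z), extend_last,
      extend_last, extend_zero, extend_zero, omega_neg_left, omega_neg_right]
    ring
  rw [← sub_eq_zero, ← htel, stepBilin, ← Finset.sum_sub_distrib]
  refine Finset.sum_congr rfl fun i _ => ?_
  simp only [consecutiveSum_apply, omega_sub_right, omega_add_left]
  rw [omega_swap (extend m i z) (extend m (i + 1) w)]
  ring

/-- For an even number `m + 1` of steps, antiperiodic sequences are determined by their
consecutive sums, which are arbitrary. -/
lemma exists_consecutiveSum {m : ℕ} (hm : Odd m) (y : Fin (m + 1) → Vec n) :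
    ∃ w : Fin (m + 1) → Vec n, ∀ i : Fin (m + 1), consecutiveSum m (i : ℕ) w = y i := by
  let L : (Fin (m + 1) → Vec n) →ₗ[ℝ] (Fin (m + 1) → Vec n) :=
    LinearMap.pi fun i => consecutiveSum m (i : ℕ)
  have hinj : Function.Injective L := by
    rw [← LinearMap.ker_eq_bot, LinearMap.ker_eq_bot']
    intro w hw
    have hstep : ∀ i < m + 1, extend m (i + 1) w = -extend m i w := by
      intro i hi
      have : consecutiveSum m i w = 0 := congrFun hw ⟨i, hi⟩
      rw [consecutiveSum_apply] at this
      exact (neg_eq_of_add_eq_zero_right this).symm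
    have hpow : ∀ i ≤ m + 1, extend m i w = (-1 : ℝ) ^ i • w 0 := by
      intro i
      induction i with
      | zero => intro _; simp [extend_zero]
      | succ i ih =>
        intro hi
        rw [hstep i (by omega), ih (by omega), pow_succ]
        simp
    have h0 : w 0 = 0 := by
      have := hpow (m + 1) le_rfl
      rw [extend_last, (hm.add_one).neg_one_pow, one_smul] at this
      exact self_eq_neg.1 this.symm
    funext i
    have := hpow i i.2.le
    rw [extend_of_lt i.2, h0, smul_zero] at this
    exact this
  obtain ⟨w, hw⟩ := (LinearMap.injective_iff_surjective.1 hinj) y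
  exact ⟨w, fun i => congrFun hw i⟩

lemma stepForm_mono {m : ℕ} {C D : ℕ → Mat n}
    (h : ∀ i < m + 1, ∀ v, omega v (C i *ᵥ v) ≤ omega v (D i *ᵥ v)) (z : Fin (m + 1) → Vec n) :
    stepForm m C z ≤ stepForm m D z := by
  rw [stepForm_apply, stepForm_apply]
  refine Finset.sum_le_sum fun i hi => ?_
  linarith [h i (Finset.mem_range.1 hi) (consecutiveSum m i z)]

lemma stepForm_lt {m : ℕ} {C D : ℕ → Mat n}
    (h : ∀ i < m + 1, ∀ v, omega v (C i *ᵥ v) ≤ omega v (D i *ᵥ v)) {z : Fin (m + 1) → Vec n}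
    {j : ℕ} (hj : j < m + 1) (hlt : omega (consecutiveSum m j z) (C j *ᵥ consecutiveSum m j z)
      < omega (consecutiveSum m j z) (D j *ᵥ consecutiveSum m j z)) :
    stepForm m C z < stepForm m D z := by
  rw [stepForm_apply, stepForm_apply]
  refine Finset.sum_lt_sum (fun i hi => ?_) ⟨j, Finset.mem_range.2 hj, ?_⟩
  · linarith [h i (Finset.mem_range.1 hi) (consecutiveSum m i z)]
  · linarith

lemma continuous_stepForm {S : Type*} [TopologicalSpace S] {m : ℕ} {C : S → ℕ → Mat n}
    (hC : ∀ i < m + 1, Continuous fun s => C s i) :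
    Continuous fun q : S × (Fin (m + 1) → Vec n) => stepForm m (C q.1) q.2 := by
  have hlin : ∀ f : (Fin (m + 1) → Vec n) →ₗ[ℝ] Vec n,
      Continuous fun q : S × (Fin (m + 1) → Vec n) => f q.2 := fun f =>
    f.continuous_of_finiteDimensional.comp continuous_snd
  simp only [stepForm_apply, stepBilin]
  refine continuous_finsetSum _ fun i hi => ?_
  refine Continuous.sub ?_ (Continuous.add ?_ ?_)
  · exact continuous_omega (hlin _)
      (((hC i (Finset.mem_range.1 hi)).comp continuous_fst).matrix_mulVec (hlin _))
  · exact continuous_omega (hlin _) (hlin _)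
  · exact continuous_omega (hlin _) (hlin _)

/-- The Cayley transforms of the steps of a discretized path. -/
def steps (P : ℕ → Sp n) (i : ℕ) : Mat n := cay (P (i + 1) * (P i)⁻¹).1

lemma steps_mem {P : ℕ → Sp n} {i : ℕ} (h : ((P (i + 1) * (P i)⁻¹).1 + 1).det ≠ 0) :
    steps P i ∈ lieSp n := cay_mem_lieSp _ h

lemma steps_mulVec {P : ℕ → Sp n} {i : ℕ} (h : ((P (i + 1) * (P i)⁻¹).1 + 1).det ≠ 0)
    (v : Vec n) : steps P i *ᵥ ((P i).1 *ᵥ v + (P (i + 1)).1 *ᵥ v)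
      = (P (i + 1)).1 *ᵥ v - (P i).1 *ᵥ v := by
  have h1 := cay_mulVec h ((P i).1 *ᵥ v)
  have h2 : (P (i + 1) * (P i)⁻¹).1 *ᵥ ((P i).1 *ᵥ v) = (P (i + 1)).1 *ᵥ v := by
    rw [Matrix.mulVec_mulVec, ← Submonoid.coe_mul, inv_mul_cancel_right]
  rw [Matrix.add_mulVec, Matrix.sub_mulVec, Matrix.one_mulVec, h2] at h1
  rw [steps, add_comm ((P i).1 *ᵥ v), h1]

/-- A path from `1` to a matrix without eigenvalue `-1` has a nondegenerate quadratic form: the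
null vectors are the sequences `zᵢ = P(i) z₀` with `P(m + 1) z₀ = -z₀`. -/
lemma radical_stepForm_eq_bot {m : ℕ} (hm : Odd m) {P : ℕ → Sp n} (h0 : P 0 = 1)
    (hstep : ∀ i < m + 1, ((P (i + 1) * (P i)⁻¹).1 + 1).det ≠ 0)
    (hend : ((P (m + 1)).1 + 1).det ≠ 0) : (stepForm m (steps P)).radical = ⊥ := by
  rw [Submodule.eq_bot_iff]
  intro z hz
  rw [mem_radical_stepForm fun i hi => steps_mem (hstep i hi)] at hz
  have hcrit : ∀ i < m + 1,
      steps P i *ᵥ consecutiveSum m i z - (extend m (i + 1) z - extend m i z) = 0 := by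
    intro i hi
    refine eq_zero_of_omega_left fun v => ?_
    obtain ⟨w, hw⟩ := exists_consecutiveSum hm (Pi.single (⟨i, hi⟩ : Fin (m + 1)) v)
    have h1 := hz w
    rw [stepBilin_eq, Finset.sum_eq_single i] at h1
    · rw [hw ⟨i, hi⟩, Pi.single_eq_same] at h1
      exact h1
    · intro j hj hji
      have hj' := Finset.mem_range.1 hj
      rw [hw ⟨j, hj'⟩, Pi.single_eq_of_ne (by simpa using hji), omega_zero_left]
    · intro hi'
      exact absurd (Finset.mem_range.2 hi) hi'
  have hsol : ∀ i ≤ m + 1, extend m i z = (P i).1 *ᵥ z 0 := by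
    intro i
    induction i with
    | zero => intro _; rw [h0]; simp [extend_zero]
    | succ i ih =>
      intro hi
      have hi' : i < m + 1 := hi
      have h1 := hcrit i hi'
      have h2 := steps_mulVec (hstep i hi') (z 0)
      rw [consecutiveSum_apply, ih hi'.le, sub_eq_zero] at h1
      -- the difference of two solutions is a fixed vector of the Cayley transform
      have h3 : (1 - steps P i) *ᵥ (extend m (i + 1) z - (P (i + 1)).1 *ᵥ z 0) = 0 := by
        have h4 : steps P i *ᵥ (extend m (i + 1) z - (P (i + 1)).1 *ᵥ z 0)
            = extend m (i + 1) z - (P (i + 1)).1 *ᵥ z 0 := by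
          have : extend m (i + 1) z - (P (i + 1)).1 *ᵥ z 0
              = ((P i).1 *ᵥ z 0 + extend m (i + 1) z)
                - ((P i).1 *ᵥ z 0 + (P (i + 1)).1 *ᵥ z 0) := by abel
          rw [this, Matrix.mulVec_sub, h1, h2]
          abel
        rw [Matrix.sub_mulVec, Matrix.one_mulVec, h4, sub_self]
      exact sub_eq_zero.1 (eq_zero_of_det_ne_zero (det_one_sub_cay (hstep i hi')) h3)
  have hz0 : z 0 = 0 := by
    refine eq_zero_of_det_ne_zero hend ?_
    have h1 := hsol (m + 1) le_rfl
    rw [extend_last] at h1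
    rw [Matrix.add_mulVec, Matrix.one_mulVec, ← h1, neg_add_cancel]
  funext i
  have h1 := hsol i i.2.le
  rw [extend_of_lt i.2, hz0, Matrix.mulVec_zero] at h1
  exact h1

/-- If all steps of a discretized path from `1` are positive, and if `-1` is an eigenvalue at an
intermediate point, then the index exceeds that of the constant path. -/
lemma sigPos_lt_of_crossing {m : ℕ} {P : ℕ → Sp n} (h0 : P 0 = 1)
    (hstep : ∀ i < m + 1, ((P (i + 1) * (P i)⁻¹).1 + 1).det ≠ 0)
    (hpos : ∀ i < m + 1, steps P i ∈ openCone n) {k : ℕ} (hk : k < m + 1)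
    (hcross : ((P k).1 + 1).det = 0) :
    sigPos (stepForm m fun _ => (0 : Mat n)) < sigPos (stepForm m (steps P)) := by
  obtain ⟨u, hu, hPu⟩ := exists_eq_neg_of_det hcross
  -- the path that is stopped at the crossing, and its null vector
  set C : ℕ → Mat n := fun i => if i < k then steps P i else 0 with hC
  have hCl : ∀ i < m + 1, C i ∈ lieSp n := by
    intro i hi
    by_cases h : i < k
    · simpa [hC, h] using (hpos i hi).1
    · simpa [hC, h] using zero_mem_lieSp
  set z : Fin (m + 1) → Vec n := fun i => (P (min i k)).1 *ᵥ u with hz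
  have hext : ∀ i ≤ m + 1, extend m i z = (P (min i k)).1 *ᵥ u := by
    intro i hi
    rcases hi.lt_or_eq with h | rfl
    · rw [extend_of_lt h]
    · rw [extend_last, min_eq_right hk.le, hPu, hz]
      simp [h0]
  have hrad : z ∈ (stepForm m C).radical := by
    rw [mem_radical_stepForm hCl]
    intro w
    rw [stepBilin_eq]
    refine Finset.sum_eq_zero fun i hi => ?_
    have hi' := Finset.mem_range.1 hi
    rw [consecutiveSum_apply i z, hext i hi'.le, hext (i + 1) hi']
    by_cases h : i < k
    · have h1 : C i = steps P i := by simp [hC, h]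
      rw [min_eq_left h.le, min_eq_left (Nat.succ_le_of_lt h), h1, steps_mulVec (hstep i hi'),
        sub_self, omega_zero_right]
    · have h1 : C i = 0 := by simp [hC, h]
      rw [min_eq_right (not_lt.1 h), min_eq_right ((not_lt.1 h).trans (Nat.le_succ i)), h1]
      simp
  have hle0 : ∀ i < m + 1, ∀ v, omega v ((0 : Mat n) *ᵥ v) ≤ omega v (C i *ᵥ v) := by
    intro i hi v
    rw [Matrix.zero_mulVec, omega_zero_right]
    by_cases h : i < k
    · simpa [hC, h] using openCone_nonneg (hpos i hi) v
    · simp [hC, h]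
  have hle1 : ∀ i < m + 1, ∀ v, omega v (C i *ᵥ v) ≤ omega v (steps P i *ᵥ v) := by
    intro i hi v
    by_cases h : i < k
    · simp [hC, h]
    · simpa [hC, h] using openCone_nonneg (hpos i hi) v
  refine sigPos_lt_of_null_vector (Q := stepForm m C) (fun v => stepForm_mono hle0 v)
    (fun v => stepForm_mono hle1 v) hrad ?_
  -- after the crossing the null vector is constant, with consecutive sum `-2u`
  have hnull : stepForm m C z = 0 := ((QuadraticMap.mem_radical_iff').1 hrad).1
  rw [← hnull]
  have hm : m < m + 1 := Nat.lt_succ_self m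
  refine stepForm_lt hle1 hm ?_
  have hkm : k ≤ m := Nat.lt_succ_iff.1 hk
  have hy : consecutiveSum m m z = -(u + u) := by
    rw [consecutiveSum_apply, hext m hm.le, hext (m + 1) le_rfl, min_eq_right hkm,
      min_eq_right hk.le, hPu]
    abel
  have hCm : C m = 0 := by simp [hC, not_lt.2 hkm]
  rw [hy, hCm, Matrix.zero_mulVec, omega_zero_right]
  refine (hpos m hm).2 _ (neg_ne_zero.2 ?_)
  rw [← two_smul ℝ]
  exact smul_ne_zero two_ne_zero hu

end

/-! ### Timelike paths and homotopies -/

section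

variable {n : ℕ} {E : Type*} [TopologicalSpace E]

open unitInterval

/-- The values of a path at the points `i / (m + 1)`. -/
def sample (m : ℕ) (f : I → Sp n) (i : ℕ) : Sp n :=
  f (Set.projIcc 0 1 zero_le_one ((i : ℝ) / (m + 1)))

lemma sample_zero (m : ℕ) (f : I → Sp n) : sample m f 0 = f 0 := by
  simp [sample]

lemma sample_last (m : ℕ) (f : I → Sp n) : sample m f (m + 1) = f 1 := by
  have : ((m + 1 : ℕ) : ℝ) / (m + 1) = 1 := by push_cast; exact div_self (by positivity)
  rw [sample, this, Set.projIcc_right]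
  rfl

/-- Sufficiently short steps of the paths in a compact family do not have the eigenvalue `-1`. -/
lemma exists_step_size {F : I × I → Sp n} (hF : Continuous F) :
    ∃ δ > 0, ∀ s t t' : I, dist t t' < δ → ((F (s, t') * (F (s, t))⁻¹).1 + 1).det ≠ 0 := by
  have hc : Continuous fun q : I × I × I =>
      ((F (q.1, q.2.2) * (F (q.1, q.2.1))⁻¹).1 + 1).det := by
    have h1 : Continuous fun q : I × I × I => F (q.1, q.2.2) := hF.comp (by fun_prop)
    have h2 : Continuous fun q : I × I × I => (F (q.1, q.2.1))⁻¹ :=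
      continuous_sp_inv.comp (hF.comp (by fun_prop))
    exact ((continuous_subtype_val.comp (h1.mul h2)).add continuous_const).matrix_det
  have hu := CompactSpace.uniformContinuous_of_continuous hc
  obtain ⟨δ, hδ, h⟩ := Metric.uniformContinuous_iff.1 hu |((2 : ℝ) • (1 : Mat n)).det|
    (abs_pos.2 det_two_smul_one)
  refine ⟨δ, hδ, fun s t t' htt' h0 => ?_⟩
  have h1 := h (a := (s, t, t)) (b := (s, t, t')) (by
    rw [Prod.dist_eq, Prod.dist_eq, dist_self, dist_self]
    simpa [hδ] using htt')
  simp only [h0, mul_inv_cancel, Submonoid.coe_one, Real.dist_eq, sub_zero] at h1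
  rw [← two_smul ℝ (1 : Mat n)] at h1
  exact lt_irrefl _ h1

lemma dist_projIcc_lt {m : ℕ} {δ : ℝ} (hm : 1 / ((m : ℝ) + 1) < δ) (i : ℕ) :
    dist (Set.projIcc (0 : ℝ) 1 zero_le_one ((i : ℝ) / (m + 1)))
      (Set.projIcc 0 1 zero_le_one (((i + 1 : ℕ) : ℝ) / (m + 1))) < δ := by
  refine ((LipschitzWith.projIcc zero_le_one).dist_le_mul _ _).trans_lt ?_
  have : (i : ℝ) / (m + 1) - ((i + 1 : ℕ) : ℝ) / (m + 1) = -(1 / ((m : ℝ) + 1)) := by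
    push_cast; ring
  rw [Real.dist_eq, this, abs_neg, abs_of_pos (by positivity)]
  simpa using hm

/-- The index is constant in families of paths from `1` whose end points do not have the
eigenvalue `-1`. -/
lemma sigPos_sample_eq {F : I × I → Sp n} (hF : Continuous F) {δ : ℝ}
    (hδ : ∀ s t t' : I, dist t t' < δ → ((F (s, t') * (F (s, t))⁻¹).1 + 1).det ≠ 0)
    {m : ℕ} (hm : Odd m) (hmδ : 1 / ((m : ℝ) + 1) < δ) (h0 : ∀ s, F (s, 0) = 1)
    (h1 : ∀ s, ((F (s, 1)).1 + 1).det ≠ 0) (s s' : I) :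
    sigPos (stepForm m (steps (sample m fun t => F (s, t))))
      = sigPos (stepForm m (steps (sample m fun t => F (s', t)))) := by
  refine sigPos_eq_of_nondegenerate
    (Q := fun s => stepForm m (steps (sample m fun t => F (s, t)))) ?_ (fun s => ?_) s s'
  · refine continuous_stepForm (C := fun s => steps (sample m fun t => F (s, t)))
      fun i _ => continuous_iff_continuousAt.2 fun s => ?_
    have h2 : Continuous fun s => (sample m (fun t => F (s, t)) (i + 1)
        * (sample m (fun t => F (s, t)) i)⁻¹).1 := by
      have h3 : ∀ j, Continuous fun s => sample m (fun t => F (s, t)) j := fun j =>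
        hF.comp (continuous_id.prodMk continuous_const)
      exact continuous_subtype_val.comp ((h3 _).mul (continuous_sp_inv.comp (h3 _)))
    exact ContinuousAt.comp (f := fun s => (sample m (fun t => F (s, t)) (i + 1)
        * (sample m (fun t => F (s, t)) i)⁻¹).1)
      (continuousAt_cay (hδ s _ _ (dist_projIcc_lt hmδ i))) h2.continuousAt
  · refine radical_stepForm_eq_bot hm ?_ (fun i _ => hδ s _ _ (dist_projIcc_lt hmδ i)) ?_
    · rw [sample_zero, h0]
    · rw [sample_last]; exact h1 s

/-- The path parametrized by a continuous curve on `[0,1]`. -/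
def pathOf {γ : ℝ → E} (hγ : ContinuousOn γ (Set.Icc 0 1)) : Path (γ 0) (γ 1) where
  toFun t := γ t
  continuous_toFun := continuousOn_iff_continuous_domRestrict.1 hγ
  source' := by simp
  target' := by simp

/-- Short steps of one half of a concatenated path are positive if this half is timelike. -/
lemma steps_mem_of_half {f : I → Sp n} {δ : ℝ}
    (hδ : ∀ t t' : I, dist t t' < δ → ((f t' * (f t)⁻¹).1 + 1).det ≠ 0)
    {W : ℝ → Sp n} (hW : IsTangentCurve (openCone n) W) {c : ℝ}
    (hf : ∀ t ∈ Set.Icc (0 : ℝ) 1, f (Set.projIcc 0 1 zero_le_one ((t + c) / 2)) = W t)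
    {m i : ℕ} (hmδ : 1 / ((m : ℝ) + 1) < δ) (hi : 0 ≤ 2 * ((i : ℝ) / (m + 1)) - c)
    (hi' : 2 * (((i + 1 : ℕ) : ℝ) / (m + 1)) - c ≤ 1) :
    steps (sample m f) i ∈ openCone n := by
  have hlt : (i : ℝ) / (m + 1) < ((i + 1 : ℕ) : ℝ) / (m + 1) := by
    push_cast; gcongr; linarith
  have hdiff : ((i + 1 : ℕ) : ℝ) / (m + 1) - (i : ℝ) / (m + 1) = 1 / ((m : ℝ) + 1) := by
    push_cast; ring
  set r := 2 * ((i : ℝ) / (m + 1)) - c with hr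
  set s := 2 * (((i + 1 : ℕ) : ℝ) / (m + 1)) - c with hs
  have hr2 : (r + c) / 2 = (i : ℝ) / (m + 1) := by rw [hr]; ring
  have hs2 : (s + c) / 2 = ((i + 1 : ℕ) : ℝ) / (m + 1) := by rw [hs]; ring
  have hrs : r < s := by linarith
  have h1 : sample m f i = W r := by
    rw [sample, ← hr2, hf r ⟨hi, by linarith⟩]
  have h2 : sample m f (i + 1) = W s := by
    rw [sample, ← hs2, hf s ⟨by linarith, hi'⟩]
  rw [steps, h1, h2]
  refine cay_step_mem hW hi hrs hi' fun t ht => ?_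
  rw [← hf t ⟨hi.trans ht.1, ht.2.trans hi'⟩, ← hf r ⟨hi, by linarith⟩]
  refine hδ _ _ (((LipschitzWith.projIcc zero_le_one).dist_le_mul _ _).trans_lt ?_)
  rw [Real.dist_eq, abs_sub_comm, abs_of_nonneg (by linarith [ht.1]), NNReal.coe_one, one_mul]
  linarith [ht.2]

/-- A timelike path from `e` over `1` that meets the locus of the eigenvalue `-1` does not end at
a point that can be joined to `e` outside of this locus: the index of the timelike path is
larger than that of the constant path, but it would be invariant under the homotopy between the
two paths and under the contraction of the second path. -/
lemma false_of_crossing [SimplyConnectedSpace E] {p : E → Sp n} (hp : Continuous p)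
    {γ₁ γ₂ ρ : ℝ → E} (h₁ : IsTimelikeCurve p γ₁) (h₂ : IsTimelikeCurve p γ₂)
    (hρ : ContinuousOn ρ (Set.Icc 0 1)) (h12 : γ₁ 1 = γ₂ 0) (hρ0 : ρ 0 = γ₁ 0)
    (hρ1 : ρ 1 = γ₂ 1) (h0 : p (γ₁ 0) = 1) (hx : ((p (γ₁ 1)).1 + 1).det = 0)
    (hd : ∀ t ∈ Set.Icc (0 : ℝ) 1, ((p (ρ t)).1 + 1).det ≠ 0) : False := by
  let α : Path (γ₁ 0) (γ₁ 1) := pathOf h₁.1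
  let β : Path (γ₁ 1) (γ₂ 1) := (pathOf h₂.1).cast h12 rfl
  let τ : Path (γ₁ 0) (γ₂ 1) := (pathOf hρ).cast hρ0.symm hρ1.symm
  obtain ⟨H⟩ := SimplyConnectedSpace.paths_homotopic (α.trans β) τ
  let F : I × I → Sp n := fun q => p (H q)
  let G : I × I → Sp n := fun q => p (τ (q.1 * q.2))
  have hF : Continuous F := hp.comp H.continuous
  have hG : Continuous G := hp.comp (τ.continuous.comp (by fun_prop))
  have hτ : ∀ t : I, ((p (τ t)).1 + 1).det ≠ 0 := fun t => hd t t.2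
  obtain ⟨δ₁, hδ₁, hFδ⟩ := exists_step_size hF
  obtain ⟨δ₂, hδ₂, hGδ⟩ := exists_step_size hG
  obtain ⟨K, hK⟩ := exists_nat_one_div_lt (lt_min hδ₁ hδ₂)
  -- an even number of steps, such that the middle is a sampling point
  set m := 2 * K + 1 with hm_def
  have hm : Odd m := ⟨K, rfl⟩
  have hmK : ((m : ℝ) + 1) = 2 * ((K : ℝ) + 1) := by rw [hm_def]; push_cast; ring
  have hK0 : (0 : ℝ) < (K : ℝ) + 1 := by positivity
  have hmδ : 1 / ((m : ℝ) + 1) < min δ₁ δ₂ := by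
    refine lt_of_le_of_lt ?_ hK
    rw [hmK]
    exact one_div_le_one_div_of_le hK0 (by linarith)
  have hm1 := hmδ.trans_le (min_le_left _ _)
  have hm2 := hmδ.trans_le (min_le_right _ _)
  have hH1 : ∀ t, F (1, t) = G (1, t) := fun t => by
    simp only [F, G, one_mul]
    exact congrArg p (H.apply_one t)
  have hi1 := sigPos_sample_eq hF hFδ hm hm1
    (fun s => (congrArg p (H.source s)).trans h0)
    (fun s => by
      have : F (s, 1) = p (τ 1) := (congrArg p (H.target s)).trans (by rw [τ.target])
      rw [this]; exact hτ 1) 0 1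
  have hi2 := sigPos_sample_eq hG hGδ hm hm2
    (fun s => by simp only [G, mul_zero]; rw [τ.source, h0])
    (fun s => hτ _) 1 0
  have hG0 : steps (sample m fun t => G (0, t)) = fun _ => (0 : Mat n) := by
    funext i
    simp [steps, sample, G]
  simp only [hH1] at hi1
  rw [hi2, hG0] at hi1
  have hF0 : ∀ t : I, F (0, t) = p ((α.trans β) t) := fun t => congrArg p (H.apply_zero t)
  have hleft : ∀ t ∈ Set.Icc (0 : ℝ) 1,
      F (0, Set.projIcc 0 1 zero_le_one ((t + 0) / 2)) = p (γ₁ t) := by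
    intro t ht
    rw [hF0, Set.projIcc_of_mem zero_le_one ⟨by linarith [ht.1], by linarith [ht.2]⟩,
      Path.trans_apply, dif_pos (by simpa using by linarith [ht.2])]
    show p (γ₁ (2 * ((t + 0) / 2))) = p (γ₁ t)
    congr 2
    ring
  have hright : ∀ t ∈ Set.Icc (0 : ℝ) 1,
      F (0, Set.projIcc 0 1 zero_le_one ((t + 1) / 2)) = p (γ₂ t) := by
    intro t ht
    rcases ht.1.eq_or_lt with rfl | h
    · have := hleft 1 ⟨zero_le_one, le_rfl⟩
      rw [add_zero] at this
      rw [zero_add, this, h12]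
    · rw [hF0, Set.projIcc_of_mem zero_le_one ⟨by linarith [ht.1], by linarith [ht.2]⟩,
        Path.trans_apply, dif_neg (by simpa using by linarith [ht.2])]
      show p (γ₂ (2 * ((t + 1) / 2) - 1)) = p (γ₂ t)
      congr 2
      ring
  have hpos : ∀ i < m + 1, steps (sample m fun t => F (0, t)) i ∈ openCone n := by
    intro i hi
    have hfrac : ∀ j : ℕ, 2 * ((j : ℝ) / (m + 1)) = j / (K + 1) := fun j => by
      rw [hmK]; field_simp
    by_cases hiK : i < K + 1
    · refine steps_mem_of_half (hFδ 0) h₁.2 hleft hm1 ?_ ?_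
      · rw [hfrac, sub_zero]; positivity
      · rw [hfrac, sub_zero, div_le_one hK0]
        exact_mod_cast hiK
    · refine steps_mem_of_half (hFδ 0) h₂.2 hright hm1 ?_ ?_
      · rw [hfrac, sub_nonneg, one_le_div hK0]
        exact_mod_cast not_lt.1 hiK
      · rw [hfrac, sub_le_iff_le_add, div_le_iff₀ hK0]
        have : i + 1 ≤ 2 * (K + 1) := by omega
        have : ((i + 1 : ℕ) : ℝ) ≤ 2 * (K + 1) := by exact_mod_cast this
        linarith
  have hmid : sample m (fun t => F (0, t)) (K + 1) = p (γ₁ 1) := by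
    have : ((K + 1 : ℕ) : ℝ) / (m + 1) = (1 + 0) / 2 := by
      rw [hmK]; push_cast; field_simp; ring
    rw [sample, this]
    exact hleft 1 ⟨zero_le_one, le_rfl⟩
  have hlt := sigPos_lt_of_crossing (m := m) (P := sample m fun t => F (0, t))
    (by rw [sample_zero]; exact (congrArg p (H.source 0)).trans h0)
    (fun i _ => hFδ 0 _ _ (dist_projIcc_lt hm1 i)) hpos (k := K + 1) (by omega)
    (by rw [hmid]; exact hx)
  exact hlt.ne hi1.symm

end

/-! ### The region between the identity and its negative -/

section

variable {n : ℕ} {E : Type*} [TopologicalSpace E] {p : E → Sp n}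

lemma det_one_add_one : ((1 : Sp n).1 + 1).det ≠ 0 := by
  rw [Submonoid.coe_one, ← two_smul ℝ (1 : Mat n)]
  exact det_two_smul_one

lemma exists_timelike_of_mem_range (hp : IsCoveringMap p) {s : ellPos n → E} (hs : Continuous s)
    (hps : ∀ W, p (s W) = W) {e b : E} (he : p e = 1) (hcl : e ∈ closure (Set.range s))
    (hb : b ∈ Set.range s) :
    ∃ γ : ℝ → E, IsTimelikeCurve p γ ∧ γ 0 = e ∧ γ 1 = b ∧
      ∀ t ∈ Set.Ioc (0 : ℝ) 1, γ t ∈ Set.range s := by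
  have hpos := pos_of_mem_range hps hb
  have hdet : ((p e).1 + 1).det ≠ 0 := by rw [he]; exact det_one_add_one
  obtain ⟨γ, hγ, h0, hmem, hform⟩ :=
    exists_timelike_straight hp hs hps hcl hdet (cay_mem_openCone (p b) hpos)
  refine ⟨γ, hγ, h0, ?_, hmem⟩
  have h1 : p (γ 1) = p b := by
    rw [hform 1 ⟨zero_le_one, le_rfl⟩, he, Submonoid.coe_one, cay_one, zero_add, one_smul,
      icaySp_cay _ hpos.det_add_one]
  obtain ⟨V, rfl⟩ := hb
  obtain ⟨V', hV'⟩ := hmem 1 ⟨one_pos, le_rfl⟩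
  rw [← hV', hps, hps] at h1
  rw [← hV', Subtype.ext h1]

lemma mem_chronFuture_of_mem_range (hp : IsCoveringMap p) {s : ellPos n → E} (hs : Continuous s)
    (hps : ∀ W, p (s W) = W) {e b : E} (he : p e = 1) (hcl : e ∈ closure (Set.range s))
    (hb : b ∈ Set.range s) : b ∈ chronFuture p e := by
  obtain ⟨γ, hγ, h0, h1, -⟩ := exists_timelike_of_mem_range hp hs hps he hcl hb
  exact ⟨γ, hγ, h0, h1⟩

lemma mem_chronPast_of_mem_range (hp : IsCoveringMap p) {s : ellPos n → E} (hs : Continuous s)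
    (hps : ∀ W, p (s W) = W) {m b : E} (hm : (negInv ∘ p) m = 1)
    (hcl : m ∈ closure (Set.range s)) (hb : b ∈ Set.range s) : m ∈ chronFuture p b := by
  refine mem_chronFuture_negInv.1 (mem_chronFuture_of_mem_range (isCoveringMap_negInv hp)
    (continuous_secNegInv hs) (proj_secNegInv hps) hm ?_ ?_) <;> rwa [range_secNegInv]

/-- A timelike curve from `e` that leaves the lift crosses the locus of the eigenvalue `-1`, and
then it cannot return to the end point `m` of the lift. -/
lemma mem_range_of_chron [SimplyConnectedSpace E] (hp : IsCoveringMap p) {s : ellPos n → E}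
    (hs : Continuous s) (hps : ∀ W, p (s W) = W) {e m b : E} (he : p e = 1)
    (hecl : e ∈ closure (Set.range s)) (hm : (negInv ∘ p) m = 1)
    (hmcl : m ∈ closure (Set.range s)) (heb : b ∈ chronFuture p e) (hbm : m ∈ chronFuture p b) :
    b ∈ Set.range s := by
  by_contra hbs
  obtain ⟨x, ⟨γ₁, h₁, h10, h11⟩, hxb, -, hdet, -⟩ := exists_exit hp hs hps he hecl heb hbs
  obtain ⟨γ₂, h₂, h20, h21⟩ : m ∈ chronFuture p x := by
    rcases hxb with rfl | hxb
    · exact hbm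
    · exact chronFuture_trans hp hxb hbm
  -- close to `m` the curve lies in the lift
  obtain ⟨ε, hε, hε1, hmem⟩ := exists_initial (isCoveringMap_negInv hp)
    (continuous_secNegInv hs) (proj_secNegInv hps) h₂.reverse (by simpa [h21] using hm)
    (by rw [range_secNegInv]; simpa [h21] using hmcl)
  have hm' := hmem (ε / 2) ⟨by linarith, by linarith⟩
  rw [range_secNegInv] at hm'
  obtain ⟨ρ, hρ, hρ0, hρ1, hρmem⟩ := exists_timelike_of_mem_range hp hs hps he hecl hm'
  refine false_of_crossing hp.continuous h₁
    (h₂.affine (r := 0) (s := 1 - ε / 2) le_rfl (by linarith) (by linarith)) hρ.1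
    (by simp [h11, h20]) (by rw [hρ0, h10]) (by rw [hρ1]; simp) (by rw [h10, he])
    (by rw [h11]; exact hdet) fun t ht => ?_
  rcases ht.1.eq_or_lt with rfl | h
  · rw [hρ0, he]; exact det_one_add_one
  · exact (pos_of_mem_range hps (hρmem t ⟨h, ht.2⟩)).det_add_one

theorem range_eq_inter [SimplyConnectedSpace E] (hp : IsCoveringMap p) {s : ellPos n → E}
    (hs : Continuous s) (hps : ∀ W, p (s W) = W) {e m : E} (he : p e = 1)
    (hecl : e ∈ closure (Set.range s)) (hm : (negInv ∘ p) m = 1)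
    (hmcl : m ∈ closure (Set.range s)) :
    Set.range s = chronFuture p e ∩ chronPast p m := by
  ext b
  exact ⟨fun hb => ⟨mem_chronFuture_of_mem_range hp hs hps he hecl hb,
    mem_chronPast_of_mem_range hp hs hps hm hmcl hb⟩,
    fun hb => mem_range_of_chron hp hs hps he hecl hm hmcl hb.1 hb.2⟩

/-! ### The end point of the region is unique -/

lemma mem_inter_of_timelike (hp : IsCoveringMap p) {e w : E} {γ : ℝ → E}
    (hγ : IsTimelikeCurve p γ) (h0 : γ 0 ∈ chronFuture p e) (h1 : w ∈ chronFuture p (γ 1))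
    {t : ℝ} (ht : t ∈ Set.Icc (0 : ℝ) 1) : γ t ∈ chronFuture p e ∩ chronPast p w := by
  constructor
  · rcases ht.1.eq_or_lt with rfl | h
    · exact h0
    · exact chronFuture_trans hp h0 (hγ.chron le_rfl h ht.2)
  · show w ∈ chronFuture p (γ t)
    rcases ht.2.eq_or_lt with rfl | h
    · exact h1
    · exact chronFuture_trans hp (hγ.chron ht.1 h le_rfl) h1

/-- If `I⁺(e) ∩ I⁻(w)` is the lift, then `w` is the end point of curves in the lift that start at
points with arbitrarily large Cayley transform. Monotonicity of the Cayley transform leaves only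
`-1` for the projection of `w`. -/
lemma eq_of_inter_eq_range (hp : IsCoveringMap p) {s : ellPos n → E}
    (hs : Continuous s) (hps : ∀ W, p (s W) = W) {e m w : E} (hm : (negInv ∘ p) m = 1)
    (hmcl : m ∈ closure (Set.range s))
    (h : chronFuture p e ∩ chronPast p w = Set.range s) : w = m := by
  have hcurve : ∀ b ∈ Set.range s, ∃ γ : ℝ → E, IsTimelikeCurve p γ ∧ γ 0 = b ∧ γ 1 = w ∧
      ∀ t ∈ Set.Ico (0 : ℝ) 1, γ t ∈ Set.range s := by
    intro b hb
    have hb' := hb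
    rw [← h] at hb'
    obtain ⟨heb, γ, hγ, rfl, rfl⟩ := hb'
    refine ⟨γ, hγ, rfl, rfl, fun t ht => ?_⟩
    rw [← h]
    refine ⟨?_, hγ.chron ht.1 ht.2 le_rfl⟩
    rcases ht.1.eq_or_lt with rfl | h0
    · exact heb
    · exact chronFuture_trans hp heb (hγ.chron le_rfl h0 ht.2.le)
  have hstart : ∀ r : ℝ, 0 < r → ∃ b ∈ Set.range s,
      p b = icaySp (r • Matrix.J (Fin n) ℝ) := fun r hr =>
    ⟨s ⟨_, mem_ellPos_iff.2 (pos_icaySp (smul_mem_openCone hr J_mem_openCone))⟩, ⟨_, rfl⟩, hps _⟩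
  have hwcl : w ∈ closure (Set.range s) := by
    obtain ⟨b, hb, -⟩ := hstart 1 one_pos
    obtain ⟨γ, hγ, -, rfl, hmem⟩ := hcurve b hb
    have h1 : (1 : ℝ) ∈ closure (Set.Ico 0 1) := by
      rw [closure_Ico zero_ne_one]; exact ⟨zero_le_one, le_rfl⟩
    have hc : ContinuousWithinAt γ (Set.Ico 0 1) 1 :=
      (hγ.1 1 ⟨zero_le_one, le_rfl⟩).mono Set.Ico_subset_Icc_self
    exact hc.mem_closure h1 hmem
  have hneg : ∀ a, ((p w).1 + 1) *ᵥ a = 0 := by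
    intro a
    by_contra hne
    set c := ((p w).1 + 1) *ᵥ a with hc
    have hJ : 0 < omega c (Matrix.J (Fin n) ℝ *ᵥ c) := J_mem_openCone.2 c hne
    have hle : ∀ r : ℝ, 0 < r → r * omega c (Matrix.J (Fin n) ℝ *ᵥ c)
        ≤ 2 * omega a ((p w).1 *ᵥ a) := by
      intro r hr
      obtain ⟨b, hb, hpb⟩ := hstart r hr
      obtain ⟨γ, hγ, h0, h1, hmem⟩ := hcurve b hb
      have hK := smul_mem_openCone hr (J_mem_openCone (n := n))
      have := cay_le_end hγ.2 le_rfl one_pos le_rfl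
        (fun t ht => pos_of_mem_range hps (hmem t ht)) a
      rwa [h1, h0, hpb, cay_icaySp hK.1 (det_one_sub_of_openCone hK), Matrix.smul_mulVec,
        omega_smul_right, ← hc] at this
    have h2 := hle ((|2 * omega a ((p w).1 *ᵥ a)| + 1) / omega c (Matrix.J (Fin n) ℝ *ᵥ c))
      (by positivity)
    rw [div_mul_cancel₀ _ hJ.ne'] at h2
    linarith [le_abs_self (2 * omega a ((p w).1 *ᵥ a))]
  have hw : (negInv ∘ p) w = 1 := by
    refine Subtype.ext (Matrix.ext_of_mulVec_single fun i => ?_)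
    have h1 := hneg (((p w)⁻¹).1 *ᵥ Pi.single i 1)
    rw [Matrix.add_mulVec, Matrix.one_mulVec, mulVec_inv_mulVec] at h1
    show (-((p w)⁻¹).1) *ᵥ Pi.single i 1 = (1 : Mat n) *ᵥ Pi.single i 1
    rw [Matrix.neg_mulVec, Matrix.one_mulVec]
    exact (eq_neg_of_add_eq_zero_left h1).symm
  rw [← range_secNegInv s] at hwcl hmcl
  exact end_point_unique (isCoveringMap_negInv hp) (continuous_secNegInv hs)
    (proj_secNegInv hps) hw hwcl hm hmcl

/-! ### Failure of global hyperbolicity beyond the region -/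

/-- The matrix of `z ↦ -ω(u, z) u`. It belongs to a degenerate positive semi-definite form. -/
def rankOne (u : Vec n) : Mat n := Matrix.vecMulVec u (u ᵥ* Matrix.J (Fin n) ℝ)

lemma rankOne_mulVec (u z : Vec n) : rankOne u *ᵥ z = -omega u z • u := by
  have h : omega u z = -((u ᵥ* Matrix.J (Fin n) ℝ) ⬝ᵥ z) := by
    rw [omega_eq, Matrix.dotProduct_mulVec]
  rw [rankOne, Matrix.vecMulVec_mulVec, h, neg_neg]
  simp

lemma rankOne_mem_lieSp (u : Vec n) : rankOne u ∈ lieSp n := by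
  intro v w
  rw [rankOne_mulVec, rankOne_mulVec, omega_smul_right, omega_smul_right, omega_swap v u,
    omega_swap w u]
  ring

lemma rankOne_nonneg (u v : Vec n) : 0 ≤ omega v (rankOne u *ᵥ v) := by
  rw [rankOne_mulVec, omega_smul_right, omega_swap v u]
  nlinarith [sq_nonneg (omega u v)]

/-- From a boundary point `x` of the lift with the eigenvalue `-1`, but without the eigenvalue
`1`, arbitrarily large points `y` of the lift with `y ≪ x` can be reached along the family of
straight curves for `-p⁻¹` in the directions `r • rankOne u + r⁻¹ • J`, where `u` is an eigenvector
for `-1`. The final equation, in which only `y` depends on `r`, expresses the unboundedness. -/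
lemma exists_unbounded_family (hp : IsCoveringMap p) {s : ellPos n → E} (hs : Continuous s)
    (hps : ∀ W, p (s W) = W) {x : E} (hx : x ∈ closure (Set.range s))
    (hdet : ((p x).1 + 1).det = 0) (hfix : ∀ u, (p x).1 *ᵥ u = u → u = 0) :
    ∃ (y : ℝ → E) (v a b c d : Vec n), ∀ r, 0 < r →
      y r ∈ Set.range s ∧ x ∈ chronFuture p (y r) ∧
      omega ((negInv (p (y r))).1 *ᵥ (a + r⁻¹ • b)) v = 2 * r + omega (c + r⁻¹ • d) v := by
  obtain ⟨u, hu, hpu⟩ := exists_eq_neg_of_det hdet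
  obtain ⟨v, huv⟩ := exists_omega_eq_one hu
  set Q := negInv (p x) with hQ
  have hQdet : (Q.1 + 1).det ≠ 0 := by
    refine det_ne_zero_of_injective fun z hz => ?_
    rw [Matrix.add_mulVec, Matrix.one_mulVec, hQ, coe_negInv, Matrix.neg_mulVec,
      neg_add_eq_zero] at hz
    refine hfix z ?_
    conv_lhs => rw [← hz]
    exact mulVec_inv_mulVec _ _
  have hQu : Q.1 *ᵥ u = u := by
    have := negInv_mulVec (p x) u
    rwa [hpu, Matrix.mulVec_neg, neg_inj] at this
  have hxq : x ∈ closure (Set.range (secNegInv s)) := by rwa [range_secNegInv]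
  set A := cay Q.1 with hA
  have hAl : A ∈ lieSp n := cay_mem_lieSp Q hQdet
  have hA0 : ∀ z, 0 ≤ omega z (A *ᵥ z) :=
    cay_nonneg_of_mem_closure (isCoveringMap_negInv hp) (proj_secNegInv hps) hxq hQdet
  have hAu : A *ᵥ u = 0 := by
    have h1 := cay_mulVec hQdet u
    rw [Matrix.add_mulVec, Matrix.sub_mulVec, Matrix.one_mulVec, hQu, sub_self,
      ← two_smul ℝ u, Matrix.mulVec_smul] at h1
    exact (smul_eq_zero.1 h1).resolve_left two_ne_zero
  set J := Matrix.J (Fin n) ℝ with hJ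
  have hB : ∀ r : ℝ, 0 < r → r • rankOne u + r⁻¹ • J ∈ openCone n := fun r hr =>
    add_mem_openCone (smul_mem_lieSp r (rankOne_mem_lieSp u))
      (fun z => by
        rw [Matrix.smul_mulVec, omega_smul_right]
        exact mul_nonneg hr.le (rankOne_nonneg u z))
      (smul_mem_openCone (inv_pos.2 hr) J_mem_openCone)
  have hy : ∀ r : ℝ, 0 < r → ∃ y, y ∈ Set.range s ∧ x ∈ chronFuture p y ∧
      (negInv (p y)).1 = icay (A + (r • rankOne u + r⁻¹ • J)) := by
    intro r hr
    obtain ⟨γ, hγ, h0, hmem, hform⟩ := exists_timelike_straight (isCoveringMap_negInv hp)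
      (continuous_secNegInv hs) (proj_secNegInv hps) hxq hQdet (hB r hr)
    have h1 := hmem 1 ⟨one_pos, le_rfl⟩
    rw [range_secNegInv] at h1
    have hC := add_mem_openCone hAl hA0 (hB r hr)
    refine ⟨γ 1, h1, mem_chronFuture_negInv.1 ⟨γ, hγ, h0, rfl⟩, ?_⟩
    have h2 := congrArg Subtype.val (hform 1 ⟨zero_le_one, le_rfl⟩)
    rw [one_smul] at h2
    exact h2.trans (coe_icaySp hC.1 (det_one_sub_of_openCone hC))
  have : Nonempty E := ⟨x⟩
  choose! y hys hyx hyform using hy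
  refine ⟨y, v, -v + A *ᵥ v - J *ᵥ u, J *ᵥ v, -v - A *ᵥ v + J *ᵥ u, -(J *ᵥ v),
    fun r hr => ⟨hys r hr, hyx r hr, ?_⟩⟩
  set C := A + (r • rankOne u + r⁻¹ • J) with hCdef
  have hC : C ∈ openCone n := add_mem_openCone hAl hA0 (hB r hr)
  -- the vector `r u - v` is almost fixed by `C`
  have hCz : C *ᵥ (r • u - v) = -(A *ᵥ v) + J *ᵥ u - r⁻¹ • (J *ᵥ v) + r • u := by
    have hω : omega u (r • u - v) = -1 := by
      rw [omega_sub_right, omega_smul_right, omega_self, huv]; ring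
    have hinv : r⁻¹ * r = 1 := inv_mul_cancel₀ hr.ne'
    rw [hCdef, Matrix.add_mulVec, Matrix.add_mulVec, Matrix.smul_mulVec, Matrix.smul_mulVec,
      rankOne_mulVec, hω, Matrix.mulVec_sub, Matrix.mulVec_sub, Matrix.mulVec_smul,
      Matrix.mulVec_smul, hAu, smul_sub, smul_smul, smul_smul, hinv]
    module
  have h1 := icay_mulVec (det_one_sub_of_openCone hC) (r • u - v)
  rw [Matrix.sub_mulVec, Matrix.add_mulVec 1 C, Matrix.one_mulVec, hCz] at h1
  have h2 : -v + A *ᵥ v - J *ᵥ u + r⁻¹ • J *ᵥ v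
      = r • u - v - (-(A *ᵥ v) + J *ᵥ u - r⁻¹ • (J *ᵥ v) + r • u) := by module
  have h3 : r • u - v + (-(A *ᵥ v) + J *ᵥ u - r⁻¹ • (J *ᵥ v) + r • u)
      = (2 * r) • u + (-v - A *ᵥ v + J *ᵥ u + r⁻¹ • -(J *ᵥ v)) := by module
  rw [hyform r hr, h2, h1, h3, omega_add_left, omega_smul_left, huv, mul_one]

/-- If `w` is not in the closure of the lift, a timelike curve from `e` to `w` leaves the lift at
a point `x` with eigenvalue `-1`. A translation moves the unbounded family of points between `e`
and `x` into a set `J⁺(a) ∩ J⁻(b)` with `a, b ∈ I⁺(e) ∩ I⁻(w)`. -/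
lemma mem_closure_of_isGloballyHyperbolic (hn : 0 < n) (hp : IsCoveringMap p)
    {s : ellPos n → E} (hs : Continuous s) (hps : ∀ W, p (s W) = W) {e w : E} (he : p e = 1)
    (hecl : e ∈ closure (Set.range s)) (hne : (chronFuture p e ∩ chronPast p w).Nonempty)
    (hgh : IsGloballyHyperbolic p (chronFuture p e ∩ chronPast p w)) :
    w ∈ closure (Set.range s) := by
  by_contra hw
  obtain ⟨b, heb, hbw⟩ := hne
  obtain ⟨x, hex, hxw, hxcl, hdet, hfix⟩ := exists_exit hp hs hps he hecl
    (chronFuture_trans hp heb hbw) fun h => hw (subset_closure h)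
  obtain ⟨γ, hγ, rfl, hγ1⟩ : w ∈ chronFuture p x := by
    rcases hxw with rfl | hxw
    · exact absurd hxcl hw
    · exact hxw
  set g : ℝ → Sp n := fun t => p (γ t) * (p (γ 0))⁻¹ with hg
  have hgt : IsTangentCurve (openCone n) g := hγ.2.mul_const _
  obtain ⟨T, hT, hT0, hTp⟩ := exists_translation hp (g := g)
    (hγ.continuousOn_proj.mul continuousOn_const) (mul_inv_cancel _)
  have hhalf : (1 / 2 : ℝ) ∈ Set.Icc (0 : ℝ) 1 := by norm_num
  have hTc : ∀ t, Continuous (T t) := fun t => hT.comp (continuous_const.prodMk continuous_id)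
  have hTb : ∀ b, ContinuousOn (fun t => T t b) (Set.Icc 0 1) := fun b =>
    (hT.comp (continuous_id.prodMk continuous_const)).continuousOn
  have hTx : T (1 / 2) (γ 0) = γ (1 / 2) := by
    refine eqOn_Icc_of_proj_eq hp (γ := fun t => T t (γ 0)) (hTb _) hγ.1 (fun t ht => ?_)
      (r := 0) ⟨le_rfl, zero_le_one⟩ (hT0 _) hhalf
    rw [hTp t ht, hg]
    simp
  have htrans : ∀ {δ : ℝ → E}, IsTimelikeCurve p δ →
      IsTimelikeCurve p fun t => T (1 / 2) (δ t) := fun {δ} hδ =>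
    ⟨(hTc _).comp_continuousOn hδ.1,
      (hδ.2.const_mul (g (1 / 2))).congr fun t _ => hTp _ hhalf _⟩
  have hfuture : T (1 / 2) e ∈ chronFuture p e := by
    have h1 : IsTimelikeCurve p fun t => T t e :=
      ⟨hTb e, (hgt.mul_const (p e)).congr fun t ht => hTp t ht e⟩
    have h2 := h1.chron (r := 0) (s := 1 / 2) le_rfl (by norm_num) (by norm_num)
    rwa [hT0] at h2
  have hpast : w ∈ chronFuture p (T (1 / 2) (γ 0)) := by
    rw [hTx, ← hγ1]
    exact hγ.chron (by norm_num) (by norm_num) le_rfl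
  have hchron : ∀ {b c}, c ∈ chronFuture p b → T (1 / 2) c ∈ chronFuture p (T (1 / 2) b) := by
    rintro b c ⟨δ, hδ, rfl, rfl⟩
    exact ⟨_, htrans hδ, rfl, rfl⟩
  have hcompact := hgh.2 (T (1 / 2) e) ⟨hfuture, chronFuture_trans hp (hchron hex) hpast⟩
    (T (1 / 2) (γ 0)) ⟨chronFuture_trans hp hfuture (hchron hex), hpast⟩
  obtain ⟨y, v, a, b, c, d, hy⟩ := exists_unbounded_family hp hs hps hxcl hdet hfix
  have hmem : ∀ r : ℝ, 0 < r → T (1 / 2) (y r) ∈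
      causalFutureIn p (chronFuture p e ∩ chronPast p w) (T (1 / 2) e) ∩
      causalPastIn p (chronFuture p e ∩ chronPast p w) (T (1 / 2) (γ 0)) := by
    intro r hr
    obtain ⟨hys, hyx, -⟩ := hy r hr
    have hey := mem_chronFuture_of_mem_range hp hs hps he hecl hys
    constructor
    · obtain ⟨δ, hδ, h0, h1⟩ := hey
      refine Or.inl ⟨_, (htrans hδ).isCausalCurve hn, fun t ht =>
        mem_inter_of_timelike hp (htrans hδ) ?_ ?_ ht, by rw [h0], by rw [h1]⟩
      · rw [h0]; exact hfuture
      · rw [h1]; exact chronFuture_trans hp (hchron hyx) hpast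
    · obtain ⟨δ, hδ, h0, h1⟩ := hyx
      refine Or.inl ⟨_, (htrans hδ).isCausalCurve hn, fun t ht =>
        mem_inter_of_timelike hp (htrans hδ) ?_ ?_ ht, by rw [h0], by rw [h1]⟩
      · rw [h0]; exact chronFuture_trans hp hfuture (hchron hey)
      · rw [h1]; exact hpast
  -- the points `negInv (p (y r))` stay in a compact set
  have hbound : ∀ z : Vec n, ∃ M : ℝ, ∀ r : ℝ, 0 < r →
      |omega ((negInv (p (y r))).1 *ᵥ z) v| ≤ M := by
    intro z
    have hc : Continuous fun b : E =>
        omega ((negInv ((g (1 / 2))⁻¹ * p b)).1 *ᵥ z) v := by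
      refine continuous_omega ?_ continuous_const
      exact (continuous_subtype_val.comp (continuous_negInv.comp
        (continuous_const.mul hp.continuous))).matrix_mulVec continuous_const
    obtain ⟨M, hM⟩ := hcompact.exists_bound_of_continuousOn hc.continuousOn
    refine ⟨M, fun r hr => ?_⟩
    have := hM _ (hmem r hr)
    rwa [hTp _ hhalf, inv_mul_cancel_left] at this
  obtain ⟨M₁, hM₁⟩ := hbound a
  obtain ⟨M₂, hM₂⟩ := hbound b
  have hM₁0 := (abs_nonneg _).trans (hM₁ 1 one_pos)
  have hM₂0 := (abs_nonneg _).trans (hM₂ 1 one_pos)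
  set r : ℝ := 1 + M₁ + M₂ + |omega c v| + |omega d v| with hr
  have hr1 : 1 ≤ r := by rw [hr]; linarith [abs_nonneg (omega c v), abs_nonneg (omega d v)]
  have hr0 : 0 < r := by linarith
  have h1 := (hy r hr0).2.2
  rw [Matrix.mulVec_add, Matrix.mulVec_smul, omega_add_left, omega_add_left, omega_smul_left,
    omega_smul_left] at h1
  have hle : ∀ t : ℝ, |r⁻¹ * t| ≤ |t| := fun t => by
    rw [abs_mul, abs_of_pos (inv_pos.2 hr0)]
    exact mul_le_of_le_one_left (abs_nonneg t) (inv_le_one_of_one_le₀ hr1)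
  have h2 := (le_abs_self _).trans (hM₁ r hr0)
  have h3 := (le_abs_self _).trans ((hle _).trans (hM₂ r hr0))
  have h4 := (neg_le_abs _).trans (hle (omega d v))
  have h5 := neg_le_abs (omega c v)
  linarith

/-! ### The lift of the region and its end points -/

lemma isEllLift_range (hn : 0 < n) (hp : IsCoveringMap p) {s : ellPos n → E} (hs : Continuous s)
    (hps : ∀ W, p (s W) = W) {e : E} (he : p e = 1) (hcl : e ∈ closure (Set.range s)) :
    IsEllLift p e (Set.range s) := by
  refine ⟨⟨s, hs, hps, rfl⟩, ?_⟩
  rw [(isOpen_range_section hp hs hps isOpen_pos).frontier_eq]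
  refine ⟨hcl, fun h => one_notMem_ellPos hn (mem_ellPos_iff.2 ?_)⟩
  rw [← he]
  exact pos_of_mem_range hps h

lemma isNegIdLift_iff (hn : 0 < n) (hp : IsCoveringMap p) {s : ellPos n → E} (hs : Continuous s)
    (hps : ∀ W, p (s W) = W) {m : E} :
    IsNegIdLift p (Set.range s) m ↔ (negInv ∘ p) m = 1 ∧ m ∈ closure (Set.range s) := by
  have h1 : (p m).1 = -1 ↔ (negInv ∘ p) m = 1 := by
    have h2 : (negInv (1 : Sp n)).1 = -1 := by rw [coe_negInv, inv_one, Submonoid.coe_one]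
    rw [← h2, Subtype.val_inj]
    constructor
    · intro h; rw [Function.comp_apply, h, negInv_negInv]
    · intro h; rw [← h, Function.comp_apply, negInv_negInv]
  rw [IsNegIdLift, h1, (isOpen_range_section hp hs hps isOpen_pos).frontier_eq]
  refine and_congr_right fun hm => ⟨fun h => h.1, fun h => ⟨h, fun hmem => ?_⟩⟩
  refine one_notMem_ellPos hn (mem_ellPos_iff.2 ?_)
  rw [← hm]
  exact pos_negInv _ (pos_of_mem_range hps hmem)

end

end

end SpCausal

theorem theorem2 {n : ℕ} (hn : 0 < n)
    {E : Type*} [TopologicalSpace E] [SimplyConnectedSpace E]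
    (p : E → SpCausal.Sp n) (hp : IsCoveringMap p) (e : E) (he : p e = 1) :
    (∃! L : Set E, SpCausal.IsEllLift p e L) ∧
    ∀ L : Set E, SpCausal.IsEllLift p e L →
      (∃! m : E, SpCausal.IsNegIdLift p L m) ∧
      ∀ m : E, SpCausal.IsNegIdLift p L m →
        L = SpCausal.chronFuture p e ∩ SpCausal.chronPast p m ∧
        (∀ w : E, (SpCausal.chronFuture p e ∩ SpCausal.chronPast p w).Nonempty →
          SpCausal.IsGloballyHyperbolic p
            (SpCausal.chronFuture p e ∩ SpCausal.chronPast p w) →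
          w ∈ closure L) ∧
        (∀ w : E, SpCausal.chronFuture p e ∩ SpCausal.chronPast p w = L → w = m) := by
  open SpCausal in
  refine ⟨?_, ?_⟩
  · obtain ⟨s, hs, hps, hcl⟩ := exists_section hp he
    refine ⟨Set.range s, isEllLift_range hn hp hs hps he hcl, ?_⟩
    rintro _ ⟨⟨s', hs', hps', rfl⟩, hcl'⟩
    rw [section_unique hp he hs hps hcl hs' hps' (frontier_subset_closure hcl')]
  · rintro _ ⟨⟨s, hs, hps, rfl⟩, hfr⟩
    have hcl := frontier_subset_closure hfr
    simp only [isNegIdLift_iff hn hp hs hps]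
    refine ⟨?_, fun m ⟨hm, hmcl⟩ => ⟨range_eq_inter hp hs hps he hcl hm hmcl,
      fun w hne hgh => mem_closure_of_isGloballyHyperbolic hn hp hs hps he hcl hne hgh,
      fun w hw => eq_of_inter_eq_range hp hs hps hm hmcl hw⟩⟩
    have hq := isCoveringMap_negInv hp
    obtain ⟨m, hm, hmcl⟩ := exists_end_point hq (continuous_secNegInv hs) (proj_secNegInv hps)
    refine ⟨m, ⟨hm, by rwa [range_secNegInv] at hmcl⟩, fun m' ⟨hm', hmcl'⟩ => ?_⟩
    exact end_point_unique hq (continuous_secNegInv hs) (proj_secNegInv hps) hm'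
      (by rwa [range_secNegInv]) hm hmcl
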